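/- Let $I\subset\mathbb R$ be an open interval, $J\subset I$ compact, and let $\kappa:I\to(0,\infty)$ and $p:I\to\mathbb R$ be of class $C^\infty$; put $a=p'$ and $\alpha=\sqrt{\kappa}$. For $k\in\mathbb N$ let $H^k=H^k(\mathbb R)$ be the space of real-valued $f\in L^2(\mathbb R)$ whose weak derivatives up to order $k$ lie in $L^2(\mathbb R)$, with $\|f\|_{H^k}^2=\sum_{l\le k}\|\partial_x^l f\|_{L^2}^2$, and $H^\infty=\bigcap_k H^k$. Let $\chi\in C^\infty(\mathbb R)\cap L^1(\mathbb R)$ be real-valued with Fourier transform compactly supported and equal to $1$ in a neighbourhood of the origin, and let $\eta:(0,\infty)\to(0,\infty)$ be smooth and nondecreasing with $\eta(\varepsilon)\to0$ as $\varepsilon\to0$. For $\varepsilon>0$ put $\chi_\varepsilon=\eta(\varepsilon)^{-1}\chi(\cdot/\eta(\varepsilon))$ and $v_{0,\varepsilon}=\chi_\varepsilon*v_0$, and consider the problem $$v_t+a(v)\,v_x+\partial_x\big(\alpha(v)\,\partial_x(\alpha(v)\,\partial_xv)\big)+\varepsilon^4\partial_x^4v=0,\qquad v(0,\cdot)=v_{0,\varepsilon}.\tag{$P_\varepsilon$}$$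 A solution of $(P_\varepsilon)$ on $[0,T]$ means a function $v\in C([0,T];H^\infty)$ with values in $I$ that satisfies the equation pointwise on $[0,T]\times\mathbb R$ (with one-sided time derivatives at $t=0$ and $t=T$) and the initial condition. Proposition. For every $R$ there are $T>0$ and $\varepsilon_0>0$ such that the following hold. (i) For every $v_0\in H^4$ with values in $J$ (almost everywhere) and $\|v_0\|_{H^4}\le R$, and every $\varepsilon\in(0,\varepsilon_0]$, the problem $(P_\varepsilon)$ has a unique solution $v_\varepsilon$ on $[0,T]$. (ii) For all integers $s\ge q\ge4$ there is a constant $C$ such that, for every $v_0\in H^q$ with values in $J$ and $\|v_0\|_{H^4}\le R$, every $\varepsilon\in(0,\varepsilon_0]$ and every $t\in[0,T]$, $$\|v_\varepsilon(t,\cdot)\|_{H^s}\le C\,\frac{\|v_0\|_{H^q}}{\eta(\varepsilon)^{s-q}}.$$ (iii) In particular, for every integer $s\ge4$ there is a constant $C$ such that, for every $v_0\in H^s$ with values in $J$ and $\|v_0\|_{H^4}\le R$, every $\varepsilon\in(0,\varepsilon_0]$ and every $t\in[0,T]$, one has $\|v_\varepsilon(t,\cdot)\|_{H^s}\le C\|v_0\|_{H^s}$.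 -/

import Mathlib

open MeasureTheory Set Filter Topology

noncomputable section

namespace QKdV

/-- `g` is the weak derivative of order `l` of `f` on the real line. -/
def IsWeakDeriv (l : ℕ) (f g : ℝ → ℝ) : Prop :=
  ∀ φ : ℝ → ℝ, ContDiff ℝ (⊤ : ℕ∞) φ → HasCompactSupport φ →
    ∫ x, f x * iteratedDeriv l φ x = (-1) ^ l * ∫ x, g x * φ x

/-- `f ∈ H^k(ℝ)`: `f` and its weak derivatives up to order `k` are in `L²(ℝ)`. -/
def MemSobolev (k : ℕ) (f : ℝ → ℝ) : Prop :=
  MemLp f 2 volume ∧ ∀ l ≤ k, ∃ g : ℝ → ℝ, MemLp g 2 volume ∧ IsWeakDeriv l f g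

open Classical in
/-- The square integrable weak derivative of order `l` of `f` (unique up to null sets), and `0` if
there is none. -/
def weakDeriv (l : ℕ) (f : ℝ → ℝ) : ℝ → ℝ :=
  if h : ∃ g : ℝ → ℝ, MemLp g 2 volume ∧ IsWeakDeriv l f g then h.choose else 0

/-- The norm of `H^k(ℝ)`, meaningful for `f ∈ H^k(ℝ)`:
`‖f‖² = ∑_{l ≤ k} ‖∂ₓˡ f‖²` with the norm of `L²(ℝ)` on the right. -/
def sobolevNorm (k : ℕ) (f : ℝ → ℝ) : ℝ :=
  Real.sqrt (∑ l ∈ Finset.range (k + 1), (eLpNorm (weakDeriv l f) 2 volume).toReal ^ 2)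

/-- The kernel `χ` of the mollifier: a smooth integrable real function whose Fourier transform is
compactly supported and equal to `1` in a neighbourhood of the origin. -/
structure IsMollifierKernel (χ : ℝ → ℝ) : Prop where
  smooth : ContDiff ℝ (⊤ : ℕ∞) χ
  integrable : Integrable χ volume
  fourier_support : HasCompactSupport (FourierTransform.fourier fun x : ℝ => (χ x : ℂ))
  fourier_one : ∀ᶠ ξ in 𝓝 (0 : ℝ), FourierTransform.fourier (fun x : ℝ => (χ x : ℂ)) ξ = 1

/-- The scale `η` of the mollifier: a positive, smooth, nondecreasing function on `(0, ∞)` with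
limit `0` at `0`. -/
structure IsMollifierScale (η : ℝ → ℝ) : Prop where
  pos : ∀ ε, 0 < ε → 0 < η ε
  smooth : ContDiffOn ℝ (⊤ : ℕ∞) η (Ioi 0)
  mono : MonotoneOn η (Ioi 0)
  tendsto : Tendsto η (𝓝[>] 0) (𝓝 0)

/-- The mollified data `χ_ε * v₀` with `χ_ε = δ⁻¹ χ (· / δ)` and `δ = η(ε)`. -/
def mollify (χ : ℝ → ℝ) (δ : ℝ) (v₀ : ℝ → ℝ) (x : ℝ) : ℝ :=
  ∫ y, (δ⁻¹ * χ ((x - y) / δ)) * v₀ y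

/-- The third order term `∂ₓ (α(u) ∂ₓ (α(u) ∂ₓ u))` with `α = √κ`. -/
def dispersiveTerm (κ : ℝ → ℝ) (u : ℝ → ℝ) : ℝ → ℝ :=
  deriv fun y => Real.sqrt (κ (u y)) * deriv (fun z => Real.sqrt (κ (u z)) * deriv u z) y

/-- `v` is a solution in `C([0,T]; H^∞(ℝ))`, with values in `I`, of
`v_t + a(v) v_x + ∂ₓ (α(v) ∂ₓ (α(v) ∂ₓ v)) + ε⁴ ∂ₓ⁴ v = 0`, `v(0) = u₀`, where `a = p'` and
`α = √κ`. Here `v t` is the function `x ↦ v(t, x)`; only `t ∈ [0,T]` matters. -/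
structure IsRegularizedSolution (I : Set ℝ) (κ p : ℝ → ℝ) (ε T : ℝ) (u₀ : ℝ → ℝ)
    (v : ℝ → ℝ → ℝ) : Prop where
  smooth : ∀ t ∈ Icc 0 T, ContDiff ℝ (⊤ : ℕ∞) (v t)
  mem_sobolev : ∀ t ∈ Icc 0 T, ∀ k : ℕ, MemSobolev k (v t)
  continuous_sobolev : ∀ k : ℕ, ∀ t ∈ Icc 0 T,
    Tendsto (fun τ => sobolevNorm k (fun x => v τ x - v t x)) (𝓝[Icc 0 T] t) (𝓝 0)
  range_subset : ∀ t ∈ Icc 0 T, ∀ x, v t x ∈ I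
  equation : ∀ t ∈ Icc 0 T, ∀ x,
    HasDerivWithinAt (fun τ => v τ x)
      (-(deriv p (v t x) * deriv (v t) x + dispersiveTerm κ (v t) x
          + ε ^ 4 * iteratedDeriv 4 (v t) x)) (Icc 0 T) t
  initial : ∀ x, v 0 x = u₀ x

end QKdV

end

open MeasureTheory Set Filter Topology

noncomputable section

namespace QKdV

local notation "𝒟" => iteratedDeriv
local notation "Smooth" => ContDiff ℝ ((⊤ : ℕ∞) : WithTop ℕ∞)

/-! ### The norm of `L²(ℝ)` -/

/-! For fixed `ε` the problem is parabolic; the point is that `T` and the constants do not depend on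
`ε`. Expanded, the dispersive term is `κ v_xxx + 2 κ' v_x v_xx + ½ κ'' v_x³` (`dispersiveTerm_eq`).
For `w = ∂ˢv`, differentiating it `s` times gives `κ w_xxx + (s+2) κ' v_x w_xx` plus terms of order
at most `s + 1` in `v` (`iter_Nop`). In the plain energy `∫ w²` these two terms lose a derivative.
In the weighted energy `∫ φ(v) w²` one has `2 ∫ G w w_xxx + 3 ∫ G_x w w_xx = ½ ∫ G_xxx w²` with `G =
φ(v) κ(v)` (`tri_dispersive`), and the loss disappears if `3 (φκ)' = 2 (s+2) φ κ'`, that is for `φ =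
κ^((2s+1)/3)` (`EvConst.exists_weight`). The fourth order term has the good sign, and its
commutators with the weight carry the same factor `ε⁴` and are absorbed by its own dissipation.
Hence `weighted_energy` is uniform in `ε ≤ 1`.

The remaining terms are controlled by tame estimates (`DP.tame`): linear in the norm of `H^s`, with
constants that depend on a bound in `H^4` only. This linearity is why a time `T` found at the level
`H^4` serves for every `s`.

For existence at fixed `ε`, the right-hand side is multiplied by a cutoff of the norm of `H^4`
(`cutF`), which makes the problem global in time, and is smoothed symmetrically, which makes it an
ordinary differential equation in `L²` (`exists_isC1_smoothed`). Parabolic energy estimates give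
bounds independent of the smoothing (`smoothed_bound`) and a Cauchy property (`smoothed_sub_le`);
the limit solves the truncated equation (`exists_isC1_cutF`). The weighted estimate passes to the
truncated equation because the cutoff does not depend on `x`, and its factor at time `0` does not
depend on the truncation level `M` (`eng_le_of_isC1_cutF`). So `M` is chosen first, then `T` so
small that the norm stays below `M`, and the truncation is invisible on `[0, T]`; no continuation
argument is needed.

The coefficients are defined on `I` only. They are extended from a compact interval around `J`
(`exists_extension`), and the solution stays in that interval: mollification moves the data little
(`IsMollifierKernel.exists_close`), and the displacement in time is at most of order `√t`
(`abs_sub_sq_le_of_isC1_cutF`). The powers of `η` come from Bernstein estimates for the data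
(`hInf_conv_of_memSobolev`), available because `χ` is reproduced by a Schwartz function and so has
integrable derivatives. Uniqueness is a parabolic energy estimate for the difference in `H^4`, once
both solutions are confined to one compact interval (`IsRegularizedSolution.exists_range`). -/

/-- The norm of `L²(ℝ)` as a real number. -/
def l2 (f : ℝ → ℝ) : ℝ := (eLpNorm f 2 volume).toReal

lemma l2_nonneg (f : ℝ → ℝ) : 0 ≤ l2 f := ENNReal.toReal_nonneg

lemma l2_eq_norm {f : ℝ → ℝ} (hf : MemLp f 2 volume) : l2 f = ‖hf.toLp f‖ := by
  rw [Lp.norm_toLp, l2]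

lemma l2_congr {f g : ℝ → ℝ} (h : f =ᵐ[volume] g) : l2 f = l2 g := by
  rw [l2, l2, eLpNorm_congr_ae h]

lemma integrable_mul {f g : ℝ → ℝ} (hf : MemLp f 2 volume) (hg : MemLp g 2 volume) :
    Integrable (fun x => f x * g x) volume := MemLp.integrable_mul hf hg

lemma integral_mul_eq_inner {f g : ℝ → ℝ} (hf : MemLp f 2 volume) (hg : MemLp g 2 volume) :
    ∫ x, f x * g x = inner ℝ (hg.toLp g) (hf.toLp f) := by
  rw [L2.inner_def]
  refine integral_congr_ae ?_
  filter_upwards [hf.coeFn_toLp, hg.coeFn_toLp] with x h1 h2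
  simp [h1, h2]

lemma l2_sq {f : ℝ → ℝ} (hf : MemLp f 2 volume) : l2 f ^ 2 = ∫ x, f x ^ 2 := by
  have := integral_mul_eq_inner hf hf
  rw [real_inner_self_eq_norm_sq, ← l2_eq_norm hf] at this
  rw [← this]; simp only [pow_two]

lemma abs_integral_mul_le {f g : ℝ → ℝ} (hf : MemLp f 2 volume) (hg : MemLp g 2 volume) :
    |∫ x, f x * g x| ≤ l2 f * l2 g := by
  rw [integral_mul_eq_inner hf hg, l2_eq_norm hf, l2_eq_norm hg, mul_comm]
  exact abs_real_inner_le_norm _ _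

lemma integral_mul_le {f g : ℝ → ℝ} (hf : MemLp f 2 volume) (hg : MemLp g 2 volume) :
    ∫ x, f x * g x ≤ l2 f * l2 g := (le_abs_self _).trans (abs_integral_mul_le hf hg)

lemma l2_add_le {f g : ℝ → ℝ} (hf : MemLp f 2 volume) (hg : MemLp g 2 volume) :
    l2 (fun x => f x + g x) ≤ l2 f + l2 g := by
  rw [l2_eq_norm hf, l2_eq_norm hg, l2_eq_norm (f := fun x => f x + g x) (hf.add hg)]
  exact norm_add_le (hf.toLp f) (hg.toLp g)

lemma l2_sub_le {f g : ℝ → ℝ} (hf : MemLp f 2 volume) (hg : MemLp g 2 volume) :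
    l2 (fun x => f x - g x) ≤ l2 f + l2 g := by
  rw [l2_eq_norm hf, l2_eq_norm hg, l2_eq_norm (f := fun x => f x - g x) (hf.sub hg)]
  exact norm_sub_le (hf.toLp f) (hg.toLp g)

lemma l2_const_mul (c : ℝ) (f : ℝ → ℝ) : l2 (fun x => c * f x) = |c| * l2 f := by
  have : (fun x => c * f x) = c • f := rfl
  rw [this, l2, eLpNorm_const_smul, ENNReal.toReal_mul]; simp [l2]

lemma l2_neg (f : ℝ → ℝ) : l2 (fun x => - f x) = l2 f := by
  have := l2_const_mul (-1) f
  simpa using this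

lemma l2_zero : l2 (fun _ => 0) = 0 := by simp [l2]

lemma l2_sub_comm (f g : ℝ → ℝ) : l2 (fun x => f x - g x) = l2 (fun x => g x - f x) := by
  rw [← l2_neg]; simp

lemma abs_l2_sub_le {f g : ℝ → ℝ} (hf : MemLp f 2 volume) (hg : MemLp g 2 volume) :
    |l2 f - l2 g| ≤ l2 (fun x => f x - g x) := by
  rw [l2_eq_norm hf, l2_eq_norm hg, l2_eq_norm (f := fun x => f x - g x) (hf.sub hg)]
  exact abs_norm_sub_norm_le (hf.toLp f) (hg.toLp g)

lemma l2_le_mul {f g : ℝ → ℝ} {c : ℝ} (hc : 0 ≤ c) (hg : MemLp g 2 volume)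
    (h : ∀ᵐ x, |f x| ≤ c * |g x|) : l2 f ≤ c * l2 g := by
  have h1 := eLpNorm_le_mul_eLpNorm_of_ae_le_mul (μ := volume) (f := f) (g := g) (c := c) h 2
  have h2 := ENNReal.toReal_mono (ENNReal.mul_ne_top ENNReal.ofReal_ne_top hg.2.ne) h1
  rwa [ENNReal.toReal_mul, ENNReal.toReal_ofReal hc] at h2

lemma memLp_bdd_mul {b f : ℝ → ℝ} {c : ℝ} (hb : AEStronglyMeasurable b volume)
    (hf : MemLp f 2 volume) (h : ∀ x, |b x| ≤ c) : MemLp (fun x => b x * f x) 2 volume :=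
  MemLp.of_le_mul (c := c) hf (hb.mul hf.1) (ae_of_all _ fun x => by
    simpa [abs_mul] using mul_le_mul_of_nonneg_right (h x) (abs_nonneg (f x)))

lemma l2_bdd_mul_le {b f : ℝ → ℝ} {c : ℝ} (hf : MemLp f 2 volume) (h : ∀ x, |b x| ≤ c) :
    l2 (fun x => b x * f x) ≤ c * l2 f :=
  l2_le_mul ((abs_nonneg _).trans (h 0)) hf (ae_of_all _ fun x => by
    simpa [abs_mul] using mul_le_mul_of_nonneg_right (h x) (abs_nonneg (f x)))

/-! ### Functions with all derivatives in `L²(ℝ)` -/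

/-- Smooth functions all of whose derivatives are in `L²(ℝ)`. -/
structure HInf (f : ℝ → ℝ) : Prop where
  smooth : Smooth f
  mem : ∀ k, MemLp (𝒟 k f) 2 volume

lemma iteratedDeriv_comp_iteratedDeriv (j k : ℕ) (f : ℝ → ℝ) : 𝒟 j (𝒟 k f) = 𝒟 (j + k) f := by
  simp only [iteratedDeriv_eq_iterate, Function.iterate_add_apply]

lemma smooth_iter {f : ℝ → ℝ} (hf : Smooth f) (k : ℕ) : Smooth (𝒟 k f) := by
  rw [iteratedDeriv_eq_iterate]; exact hf.iterate_deriv k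

lemma smooth_deriv {f : ℝ → ℝ} (hf : Smooth f) : Smooth (deriv f) := by
  simpa using smooth_iter hf 1

lemma smooth_hasDerivAt {f : ℝ → ℝ} (hf : Smooth f) (k : ℕ) (x : ℝ) :
    HasDerivAt (𝒟 k f) (𝒟 (k + 1) f x) x := by
  rw [iteratedDeriv_succ]
  exact ((smooth_iter hf k).differentiable (by simp)).differentiableAt.hasDerivAt

lemma smooth_le {f : ℝ → ℝ} (hf : Smooth f) {n : ℕ} : ContDiff ℝ n f := hf.of_le (by
  exact_mod_cast le_top)

lemma iter_add {f g : ℝ → ℝ} (hf : Smooth f) (hg : Smooth g) (n : ℕ) :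
    𝒟 n (fun x => f x + g x) = fun x => 𝒟 n f x + 𝒟 n g x := by
  ext x; exact iteratedDeriv_fun_add (smooth_le hf).contDiffAt (smooth_le hg).contDiffAt

lemma iter_sub {f g : ℝ → ℝ} (hf : Smooth f) (hg : Smooth g) (n : ℕ) :
    𝒟 n (fun x => f x - g x) = fun x => 𝒟 n f x - 𝒟 n g x := by
  ext x; exact iteratedDeriv_sub (smooth_le hf).contDiffAt (smooth_le hg).contDiffAt

lemma iter_const_mul (c : ℝ) (f : ℝ → ℝ) (n : ℕ) :
    𝒟 n (fun x => c * f x) = fun x => c * 𝒟 n f x := by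
  ext x; exact iteratedDeriv_const_mul_field c f

lemma iter_neg (f : ℝ → ℝ) (n : ℕ) : 𝒟 n (fun x => - f x) = fun x => - 𝒟 n f x := by
  ext x; exact iteratedDeriv_fun_neg n f x

namespace HInf

variable {f g : ℝ → ℝ}

lemma mem0 (hf : HInf f) : MemLp f 2 volume := by simpa using hf.mem 0

lemma iter (hf : HInf f) (k : ℕ) : HInf (𝒟 k f) :=
  ⟨smooth_iter hf.smooth k, fun j => by
    rw [iteratedDeriv_comp_iteratedDeriv]; exact hf.mem _⟩

lemma deriv (hf : HInf f) : HInf (deriv f) := by simpa using hf.iter 1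

lemma continuous (hf : HInf f) : Continuous f := hf.smooth.continuous

lemma hasDerivAt (hf : HInf f) (k : ℕ) (x : ℝ) : HasDerivAt (𝒟 k f) (𝒟 (k + 1) f x) x :=
  smooth_hasDerivAt hf.smooth k x

lemma hasDerivAt0 (hf : HInf f) (x : ℝ) : HasDerivAt f (𝒟 1 f x) x := by
  simpa using hf.hasDerivAt 0 x

lemma add (hf : HInf f) (hg : HInf g) : HInf (fun x => f x + g x) :=
  ⟨hf.smooth.add hg.smooth, fun k => by
    rw [iter_add hf.smooth hg.smooth]; exact (hf.mem k).add (hg.mem k)⟩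

lemma sub (hf : HInf f) (hg : HInf g) : HInf (fun x => f x - g x) :=
  ⟨hf.smooth.sub hg.smooth, fun k => by
    rw [iter_sub hf.smooth hg.smooth]; exact (hf.mem k).sub (hg.mem k)⟩

lemma const_mul (hf : HInf f) (c : ℝ) : HInf (fun x => c * f x) :=
  ⟨contDiff_const.mul hf.smooth, fun k => by
    rw [iter_const_mul]; exact (hf.mem k).const_mul c⟩

lemma neg (hf : HInf f) : HInf (fun x => - f x) :=
  ⟨hf.smooth.neg, fun k => by rw [iter_neg]; exact (hf.mem k).neg⟩

lemma zero : HInf (fun _ => 0) :=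
  ⟨contDiff_const, fun k => by
    have : 𝒟 k (fun _ : ℝ => (0 : ℝ)) = fun _ => 0 := by
      ext x; simp [iteratedDeriv_fun_const_zero]
    rw [this]; exact MemLp.zero'⟩

end HInf

lemma integral_mul_deriv {f g : ℝ → ℝ} (hf : HInf f) (hg : HInf g) :
    ∫ x, f x * 𝒟 1 g x = - ∫ x, 𝒟 1 f x * g x :=
  integral_mul_deriv_eq_deriv_mul_of_integrable (fun x _ => hf.hasDerivAt0 x)
    (fun x _ => hg.hasDerivAt0 x) (integrable_mul hf.mem0 (hg.mem 1))
    (integrable_mul (hf.mem 1) hg.mem0) (integrable_mul hf.mem0 hg.mem0)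

lemma integral_mul_iter {f g : ℝ → ℝ} (hf : HInf f) (hg : HInf g) (k : ℕ) :
    ∫ x, f x * 𝒟 k g x = (-1) ^ k * ∫ x, 𝒟 k f x * g x := by
  induction k generalizing f with
  | zero => simp
  | succ k ih =>
    have h1 := integral_mul_deriv hf (hg.iter k)
    rw [iteratedDeriv_comp_iteratedDeriv, add_comm 1 k] at h1
    rw [h1, ih (hf.iter 1), iteratedDeriv_comp_iteratedDeriv, pow_succ]
    ring

/-- The norm of the `k`-th derivative in `L²`. -/
def hs (k : ℕ) (f : ℝ → ℝ) : ℝ := l2 (𝒟 k f)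

/-- The norm of `H^k`, for smooth functions. -/
def Hn (k : ℕ) (f : ℝ → ℝ) : ℝ := Real.sqrt (∑ l ∈ Finset.range (k + 1), hs l f ^ 2)

lemma hs_nonneg (k : ℕ) (f : ℝ → ℝ) : 0 ≤ hs k f := l2_nonneg _

lemma hs_zero (f : ℝ → ℝ) : hs 0 f = l2 f := by simp [hs]

lemma hs_iter (j k : ℕ) (f : ℝ → ℝ) : hs j (𝒟 k f) = hs (j + k) f := by
  rw [hs, iteratedDeriv_comp_iteratedDeriv, hs]

lemma Hn_nonneg (k : ℕ) (f : ℝ → ℝ) : 0 ≤ Hn k f := Real.sqrt_nonneg _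

lemma Hn_sq (k : ℕ) (f : ℝ → ℝ) : Hn k f ^ 2 = ∑ l ∈ Finset.range (k + 1), hs l f ^ 2 :=
  Real.sq_sqrt (Finset.sum_nonneg fun _ _ => sq_nonneg _)

lemma hs_le_Hn {j k : ℕ} (h : j ≤ k) (f : ℝ → ℝ) : hs j f ≤ Hn k f := by
  refine Real.le_sqrt_of_sq_le ?_
  exact Finset.single_le_sum (f := fun l => hs l f ^ 2) (fun _ _ => sq_nonneg _)
    (Finset.mem_range.2 (by omega))

lemma Hn_mono {j k : ℕ} (h : j ≤ k) (f : ℝ → ℝ) : Hn j f ≤ Hn k f :=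
  Real.sqrt_le_sqrt (Finset.sum_le_sum_of_subset_of_nonneg
    (Finset.range_mono (by omega)) fun _ _ _ => sq_nonneg _)

lemma Hn_le_of_hs_le {k : ℕ} {f : ℝ → ℝ} {c : ℝ} (hc : 0 ≤ c) (h : ∀ j ≤ k, hs j f ≤ c) :
    Hn k f ≤ (k + 1) * c := by
  refine Real.sqrt_le_iff.2 ⟨by positivity, ?_⟩
  calc ∑ l ∈ Finset.range (k + 1), hs l f ^ 2 ≤ ∑ l ∈ Finset.range (k + 1), c ^ 2 :=
        Finset.sum_le_sum fun l hl => by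
          have := h l (by simp at hl; omega)
          exact pow_le_pow_left₀ (hs_nonneg _ _) this 2
    _ = (k + 1) * c ^ 2 := by simp
    _ ≤ ((k + 1) * c) ^ 2 := by
        have : (0 : ℝ) ≤ k := Nat.cast_nonneg k
        nlinarith [sq_nonneg c, mul_nonneg this (sq_nonneg c), mul_nonneg (mul_nonneg this this) (sq_nonneg c)]

lemma hs_sub_comm (k : ℕ) {f g : ℝ → ℝ} (hf : HInf f) (hg : HInf g) :
    hs k (fun x => f x - g x) = hs k (fun x => g x - f x) := by
  rw [hs, hs, iter_sub hf.smooth hg.smooth, iter_sub hg.smooth hf.smooth, l2_sub_comm]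

lemma hs_add_le (k : ℕ) {f g : ℝ → ℝ} (hf : HInf f) (hg : HInf g) :
    hs k (fun x => f x + g x) ≤ hs k f + hs k g := by
  rw [hs, iter_add hf.smooth hg.smooth]; exact l2_add_le (hf.mem k) (hg.mem k)

lemma hs_sub_le (k : ℕ) {f g : ℝ → ℝ} (hf : HInf f) (hg : HInf g) :
    hs k (fun x => f x - g x) ≤ hs k f + hs k g := by
  rw [hs, iter_sub hf.smooth hg.smooth]; exact l2_sub_le (hf.mem k) (hg.mem k)

lemma hs_const_mul (k : ℕ) (c : ℝ) (f : ℝ → ℝ) :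
    hs k (fun x => c * f x) = |c| * hs k f := by
  rw [hs, iter_const_mul, l2_const_mul, hs]

lemma abs_hs_sub_le (k : ℕ) {f g : ℝ → ℝ} (hf : HInf f) (hg : HInf g) :
    |hs k f - hs k g| ≤ hs k (fun x => f x - g x) := by
  rw [hs, hs, hs, iter_sub hf.smooth hg.smooth]; exact abs_l2_sub_le (hf.mem k) (hg.mem k)

lemma hs_sub_le_hs_sub_add (k : ℕ) {f g h : ℝ → ℝ} (hf : HInf f) (hg : HInf g) (hh : HInf h) :
    hs k (fun x => f x - h x) ≤ hs k (fun x => f x - g x) + hs k (fun x => g x - h x) := by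
  have := hs_add_le k (hf.sub hg) (hg.sub hh)
  simpa using this

/-- One integration by parts and Cauchy–Schwarz. Together with `logconvex_le` this is the source of
the interpolation between Sobolev norms in the tame estimates. -/
lemma hs_logconvex {f : ℝ → ℝ} (hf : HInf f) (k : ℕ) :
    hs (k + 1) f ^ 2 ≤ hs k f * hs (k + 2) f := by
  rw [hs, l2_sq (hf.mem _)]
  have h := integral_mul_deriv (hf.iter (k + 1)) (hf.iter k)
  rw [iteratedDeriv_comp_iteratedDeriv, iteratedDeriv_comp_iteratedDeriv, add_comm 1 k,
    add_comm 1 (k + 1)] at h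
  have h2 := abs_integral_mul_le (hf.mem (k + 2)) (hf.mem k)
  simp only [pow_two]
  rw [h]
  calc _ ≤ l2 (𝒟 (k + 2) f) * l2 (𝒟 k f) := (neg_le_abs _).trans h2
    _ = _ := mul_comm _ _

/-- A maximum principle for log-convex sequences: after the first strict increase above `A` the
sequence can never come down again. -/
lemma logconvex_le {c : ℕ → ℝ} {n : ℕ} {A : ℝ} (hA : 0 ≤ A)
    (h : ∀ i, i + 2 ≤ n → c (i + 1) ^ 2 ≤ c i * c (i + 2)) (hpos : ∀ i, 0 ≤ c i)
    (h0 : c 0 ≤ A) (hn : c n ≤ A) : ∀ i ≤ n, c i ≤ A := by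
  by_contra! hcon
  have hex : ∃ i, i ≤ n ∧ A < c i := hcon
  classical
  set i := Nat.find hex with hi
  obtain ⟨hin, hAi⟩ := Nat.find_spec hex
  have hmin : ∀ j < i, c j ≤ A := fun j hj => by
    by_contra! hj2
    exact Nat.find_min hex hj ⟨by omega, hj2⟩
  have hi0 : i ≠ 0 := fun h' => by rw [← hi, h'] at hAi; linarith
  -- At the first index `i` where the bound fails, `c (i - 1) ≤ A < c i`. Log-convexity propagates
  -- the growth step by step up to `n`, against `c n ≤ A`.
  have key : ∀ d, i + d ≤ n → A < c (i + d) ∧ c (i + d - 1) ≤ c (i + d) := by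
    intro d
    induction d with
    | zero => intro _; exact ⟨hAi, (hmin _ (by omega)).trans hAi.le⟩
    | succ d ih =>
      intro hd
      obtain ⟨h1, h2⟩ := ih (by omega)
      have h3 := h (i + d - 1) (by omega)
      rw [show i + d - 1 + 1 = i + d by omega, show i + d - 1 + 2 = i + (d + 1) by omega] at h3
      have h4 : c (i + d) ≤ c (i + (d + 1)) := by
        by_contra! h5
        have h6 := hpos (i + (d + 1))
        have h7 := hpos (i + d - 1)
        nlinarith [mul_le_mul_of_nonneg_right h2 h6]
      refine ⟨h1.trans_le h4, ?_⟩
      rw [show i + (d + 1) - 1 = i + d by omega]; exact h4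
  have := (key (n - i) (by omega)).1
  rw [show i + (n - i) = n by omega] at this
  linarith

lemma hs_sq_le {f : ℝ → ℝ} (hf : HInf f) {j m : ℕ} (h : j ≤ m) :
    hs j f ^ 2 ≤ hs 0 f ^ 2 + hs m f ^ 2 := by
  have h1 := logconvex_le (c := fun i => hs i f) (n := m) (A := Real.sqrt (hs 0 f ^ 2 + hs m f ^ 2))
    (Real.sqrt_nonneg _) (fun i _ => hs_logconvex hf i) (fun i => hs_nonneg i f)
    (Real.le_sqrt_of_sq_le (by nlinarith [sq_nonneg (hs m f)]))
    (Real.le_sqrt_of_sq_le (by nlinarith [sq_nonneg (hs 0 f)])) j h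
  calc hs j f ^ 2 ≤ (Real.sqrt (hs 0 f ^ 2 + hs m f ^ 2)) ^ 2 :=
        pow_le_pow_left₀ (hs_nonneg _ _) h1 2
    _ = _ := Real.sq_sqrt (by positivity)

lemma Hn_sq_le {f : ℝ → ℝ} (hf : HInf f) (m : ℕ) :
    Hn m f ^ 2 ≤ (m + 1) * (hs 0 f ^ 2 + hs m f ^ 2) := by
  rw [Hn_sq]
  calc _ ≤ ∑ l ∈ Finset.range (m + 1), (hs 0 f ^ 2 + hs m f ^ 2) :=
        Finset.sum_le_sum fun l hl => hs_sq_le hf (by simp at hl; omega)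
    _ = _ := by simp; ring

/-- Since `f²` vanishes at `-∞`, `f(x)²` is the integral of `2 f f'` up to `x`. The product form
matters later: smallness of the `L²` norm alone makes the supremum small once `hs 1 f` is bounded.
-/
lemma sq_le_two_mul {f : ℝ → ℝ} (hf : HInf f) (x : ℝ) : f x ^ 2 ≤ 2 * (hs 0 f * hs 1 f) := by
  have hd : ∀ y, HasDerivAt (fun y => f y ^ 2) (2 * (f y * 𝒟 1 f y)) y := fun y => by
    have := (hf.hasDerivAt0 y).pow 2
    refine this.congr_deriv ?_
    simp; ring
  have hi : Integrable (fun y => 2 * (f y * 𝒟 1 f y)) volume :=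
    (integrable_mul hf.mem0 (hf.mem 1)).const_mul 2
  have ht := tendsto_zero_of_hasDerivAt_of_integrableOn_Iic (a := x) (fun y _ => hd y)
    hi.integrableOn hf.mem0.integrable_sq.integrableOn
  have h := integral_Iic_of_hasDerivAt_of_tendsto (a := x) (hd x).continuousAt.continuousWithinAt
    (fun y _ => hd y) hi.integrableOn ht
  rw [sub_zero] at h
  rw [← h]
  have habs : ∀ g : ℝ → ℝ, HInf g → l2 (fun y => |g y|) = l2 g := fun g _ => by
    rw [l2, l2]; exact congrArg _ (eLpNorm_norm g)
  calc ∫ y in Iic x, 2 * (f y * 𝒟 1 f y) ≤ ∫ y in Iic x, 2 * (|f y| * |𝒟 1 f y|) := by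
        refine integral_mono hi.integrableOn ?_ fun y => ?_
        · exact ((integrable_mul hf.mem0.abs (hf.mem 1).abs).const_mul 2).integrableOn
        · simp only
          have := le_abs_self (f y * 𝒟 1 f y)
          rw [abs_mul] at this; linarith
    _ ≤ ∫ y, 2 * (|f y| * |𝒟 1 f y|) :=
        setIntegral_le_integral ((integrable_mul hf.mem0.abs (hf.mem 1).abs).const_mul 2)
          (ae_of_all _ fun y => by positivity)
    _ ≤ 2 * (hs 0 f * hs 1 f) := by
        rw [integral_const_mul]
        have : ∫ y, |f y| * |𝒟 1 f y| ≤ l2 (fun y => |f y|) * l2 (fun y => |𝒟 1 f y|) :=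
          integral_mul_le hf.mem0.abs (hf.mem 1).abs
        rw [habs _ hf, habs _ (hf.iter 1)] at this
        rw [hs_zero, hs]
        exact mul_le_mul_of_nonneg_left this (by norm_num)

lemma abs_le_hs {f : ℝ → ℝ} (hf : HInf f) (x : ℝ) : |f x| ≤ hs 0 f + hs 1 f := by
  refine abs_le_of_sq_le_sq ?_ (add_nonneg (hs_nonneg _ _) (hs_nonneg _ _))
  nlinarith [sq_le_two_mul hf x, sq_nonneg (hs 0 f), sq_nonneg (hs 1 f)]

lemma abs_iter_le_hs {f : ℝ → ℝ} (hf : HInf f) (k : ℕ) (x : ℝ) :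
    |𝒟 k f x| ≤ hs k f + hs (k + 1) f := by
  have := abs_le_hs (hf.iter k) x
  rwa [hs_iter, hs_iter, zero_add, add_comm 1 k] at this

lemma abs_iter_le_Hn {f : ℝ → ℝ} (hf : HInf f) {k m : ℕ} (h : k + 1 ≤ m) (x : ℝ) :
    |𝒟 k f x| ≤ 2 * Hn m f := by
  have := abs_iter_le_hs hf k x
  have h1 := hs_le_Hn (show k ≤ m by omega) f
  have h2 := hs_le_Hn h f
  linarith

lemma HInf.tendsto_zero {f : ℝ → ℝ} (hf : HInf f) :
    Tendsto f atBot (𝓝 0) ∧ Tendsto f atTop (𝓝 0) := by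
  have hd : ∀ y, HasDerivAt (fun y => f y ^ 2) (2 * (f y * 𝒟 1 f y)) y := fun y => by
    have := (hf.hasDerivAt0 y).pow 2
    refine this.congr_deriv ?_
    simp; ring
  have hi : Integrable (fun y => 2 * (f y * 𝒟 1 f y)) volume :=
    (integrable_mul hf.mem0 (hf.mem 1)).const_mul 2
  have h1 := tendsto_zero_of_hasDerivAt_of_integrableOn_Iic (a := 0) (fun y _ => hd y)
    hi.integrableOn hf.mem0.integrable_sq.integrableOn
  have h2 := tendsto_zero_of_hasDerivAt_of_integrableOn_Ioi (a := 0) (fun y _ => hd y)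
    hi.integrableOn hf.mem0.integrable_sq.integrableOn
  have h3 : ∀ l : Filter ℝ, Tendsto (fun y => f y ^ 2) l (𝓝 0) → Tendsto f l (𝓝 0) := by
    intro l hl
    have := hl.sqrt
    simp only [Real.sqrt_sq_eq_abs, Real.sqrt_zero] at this
    exact (tendsto_zero_iff_abs_tendsto_zero _).2 this
  exact ⟨h3 _ h1, h3 _ h2⟩

/-! ### Bounded smooth functions -/

/-- Smooth functions with bounded derivatives of all orders. -/
structure BInf (f : ℝ → ℝ) : Prop where
  smooth : Smooth f
  bdd : ∀ k, ∃ C, ∀ x, |𝒟 k f x| ≤ C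

lemma HInf.bInf {f : ℝ → ℝ} (hf : HInf f) : BInf f := ⟨hf.smooth, fun k => ⟨_, abs_iter_le_hs hf k⟩⟩

lemma iter_succ_mul {f g : ℝ → ℝ} (hf : Smooth f) (hg : Smooth g) (n : ℕ) :
    𝒟 (n + 1) (fun x => f x * g x) =
      fun x => 𝒟 n (fun x => deriv f x * g x) x + 𝒟 n (fun x => f x * deriv g x) x := by
  rw [iteratedDeriv_succ', ← iter_add ((smooth_deriv hf).mul hg) (hf.mul (smooth_deriv hg))]
  congr 1
  ext x
  exact deriv_fun_mul (hf.differentiable (by simp) x) (hg.differentiable (by simp) x)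

lemma bdd_iter_mul {f g : ℝ → ℝ} (hf : Smooth f) (hg : Smooth g) (n : ℕ)
    (hfb : ∀ k ≤ n, ∃ C, ∀ x, |𝒟 k f x| ≤ C) (hgb : ∀ k ≤ n, ∃ C, ∀ x, |𝒟 k g x| ≤ C) :
    ∃ C, ∀ x, |𝒟 n (fun x => f x * g x) x| ≤ C := by
  induction n generalizing f g with
  | zero =>
    obtain ⟨C, hC⟩ := hfb 0 le_rfl
    obtain ⟨D, hD⟩ := hgb 0 le_rfl
    refine ⟨C * D, fun x => ?_⟩
    have h1 := hC x; have h2 := hD x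
    simp only [iteratedDeriv_zero] at *
    rw [abs_mul]
    exact mul_le_mul h1 h2 (abs_nonneg _) ((abs_nonneg _).trans h1)
  | succ n ih =>
    obtain ⟨C, hC⟩ := ih (smooth_deriv hf) hg (fun k hk => by
      rw [← iteratedDeriv_succ']; exact hfb _ (by omega)) (fun k hk => hgb k (by omega))
    obtain ⟨D, hD⟩ := ih hf (smooth_deriv hg) (fun k hk => hfb k (by omega)) (fun k hk => by
      rw [← iteratedDeriv_succ']; exact hgb _ (by omega))
    refine ⟨C + D, fun x => ?_⟩
    rw [iter_succ_mul hf hg]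
    exact (abs_add_le _ _).trans (add_le_add (hC x) (hD x))

lemma bdd_iter_comp {F v : ℝ → ℝ} (hF : BInf F) (hv : BInf v) (n : ℕ) :
    ∀ k ≤ n, ∃ C, ∀ x, |𝒟 k (fun x => F (v x)) x| ≤ C := by
  induction n generalizing F with
  | zero =>
    intro k hk
    obtain rfl : k = 0 := by omega
    obtain ⟨C, hC⟩ := hF.bdd 0
    exact ⟨C, fun x => by simpa using hC (v x)⟩
  | succ n ih =>
    intro k hk
    rcases Nat.eq_zero_or_pos k with rfl | hk0
    · obtain ⟨C, hC⟩ := hF.bdd 0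
      exact ⟨C, fun x => by simpa using hC (v x)⟩
    · obtain ⟨k, rfl⟩ : ∃ j, k = j + 1 := ⟨k - 1, by omega⟩
      have hF' : BInf (deriv F) := ⟨smooth_deriv hF.smooth, fun k => by
        rw [← iteratedDeriv_succ']; exact hF.bdd _⟩
      have : deriv (fun x => F (v x)) = fun x => deriv F (v x) * deriv v x := by
        ext x
        exact ((hF.smooth.differentiable (by simp) (v x)).hasDerivAt.comp x
          (hv.smooth.differentiable (by simp) x).hasDerivAt).deriv
      rw [iteratedDeriv_succ', this]
      exact bdd_iter_mul (hF'.smooth.comp hv.smooth) (smooth_deriv hv.smooth) k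
        (fun j hj => ih hF' j (by omega)) fun j _ => by
          rw [← iteratedDeriv_succ']; exact hv.bdd _

namespace BInf

variable {f g : ℝ → ℝ}

lemma iter (hf : BInf f) (k : ℕ) : BInf (𝒟 k f) :=
  ⟨smooth_iter hf.smooth k, fun j => by
    rw [iteratedDeriv_comp_iteratedDeriv]; exact hf.bdd _⟩

lemma deriv (hf : BInf f) : BInf (deriv f) := by simpa using hf.iter 1

lemma mul (hf : BInf f) (hg : BInf g) : BInf (fun x => f x * g x) :=
  ⟨hf.smooth.mul hg.smooth, fun n => bdd_iter_mul hf.smooth hg.smooth n (fun k _ => hf.bdd k)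
    fun k _ => hg.bdd k⟩

lemma comp (hF : BInf f) (hv : BInf g) : BInf (fun x => f (g x)) :=
  ⟨hF.smooth.comp hv.smooth, fun n => bdd_iter_comp hF hv n n le_rfl⟩

lemma bdd0 (hf : BInf f) : ∃ C, 0 ≤ C ∧ ∀ x, |f x| ≤ C := by
  obtain ⟨C, hC⟩ := hf.bdd 0
  exact ⟨C, (abs_nonneg _).trans (hC 0), by simpa using hC⟩

lemma hasDerivAt0 (hf : BInf f) (x : ℝ) : HasDerivAt f (𝒟 1 f x) x := by
  simpa using smooth_hasDerivAt hf.smooth 0 x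

lemma lipschitz (hf : BInf f) : ∃ C, 0 ≤ C ∧ ∀ x y, |f x - f y| ≤ C * |x - y| := by
  obtain ⟨C, hC⟩ := hf.bdd 1
  refine ⟨C, (abs_nonneg _).trans (hC 0), fun x y => ?_⟩
  have := Convex.norm_image_sub_le_of_norm_hasDerivWithin_le (f := f) (f' := 𝒟 1 f) (C := C)
    (fun z _ => (hf.hasDerivAt0 z).hasDerivWithinAt) (fun z _ => hC z) convex_univ
    (mem_univ y) (mem_univ x)
  simpa using this

lemma mul_hInf (hf : BInf f) (hg : HInf g) : HInf (fun x => f x * g x) := by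
  refine ⟨hf.smooth.mul hg.smooth, fun n => ?_⟩
  induction n generalizing f g with
  | zero =>
    obtain ⟨C, _, hC⟩ := hf.bdd0
    simpa using memLp_bdd_mul hf.smooth.continuous.aestronglyMeasurable hg.mem0 hC
  | succ n ih =>
    rw [iter_succ_mul hf.smooth hg.smooth]
    exact (ih hf.deriv hg).add (ih hf hg.deriv)

end BInf

lemma HInf.mul {f g : ℝ → ℝ} (hf : HInf f) (hg : HInf g) : HInf (fun x => f x * g x) :=
  hf.bInf.mul_hInf hg

/-! ### Differential polynomials -/

/-- The differential monomial `F(v) ∏_{k ∈ L} ∂ᵏ v`. -/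
def dmono (F : ℝ → ℝ) (L : Multiset ℕ) (v : ℝ → ℝ) (x : ℝ) : ℝ :=
  F (v x) * (L.map fun k => 𝒟 k v x).prod

/-- Differential polynomials: sums of monomials with at least `e` factors `∂ᵏ v`, of orders `k`
between `1` and `m` and of total order at most `n`. -/
inductive DP (e n m : ℕ) : ((ℝ → ℝ) → ℝ → ℝ) → Prop
  | zero : DP e n m fun _ _ => 0
  | mono {F : ℝ → ℝ} {L : Multiset ℕ} (hF : BInf F) (he : e ≤ L.card)
      (hL : ∀ k ∈ L, 1 ≤ k ∧ k ≤ m) (hn : L.sum ≤ n) : DP e n m (dmono F L)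
  | add {r r' : (ℝ → ℝ) → ℝ → ℝ} (h : DP e n m r) (h' : DP e n m r') :
      DP e n m fun v x => r v x + r' v x

lemma dmono_cons (F : ℝ → ℝ) (k : ℕ) (L : Multiset ℕ) :
    dmono F (k ::ₘ L) = fun v x => 𝒟 k v x * dmono F L v x := by
  ext v x; simp only [dmono, Multiset.map_cons, Multiset.prod_cons]; ring

lemma dmono_zero (F : ℝ → ℝ) : dmono F 0 = fun v x => F (v x) := by
  ext v x; simp [dmono]

lemma bInf_const (c : ℝ) : BInf fun _ => c :=
  ⟨contDiff_const, fun k => ⟨|c|, fun x => by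
    rcases Nat.eq_zero_or_pos k with rfl | hk
    · simp
    · obtain ⟨j, rfl⟩ : ∃ j, k = j + 1 := ⟨k - 1, by omega⟩
      rw [iteratedDeriv_succ']; simp [iteratedDeriv_fun_const_zero]⟩⟩

namespace DP

variable {e n m : ℕ} {r r' : (ℝ → ℝ) → ℝ → ℝ}

lemma weaken (h : DP e n m r) {e' n' m' : ℕ} (he : e' ≤ e) (hn : n ≤ n') (hm : m ≤ m') :
    DP e' n' m' r := by
  induction h with
  | zero => exact .zero
  | mono hF h1 h2 h3 =>
    exact .mono hF (he.trans h1) (fun k hk => ⟨(h2 k hk).1, (h2 k hk).2.trans hm⟩) (h3.trans hn)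
  | add _ _ ih ih' => exact .add ih ih'

lemma cons (h : DP e n m r) {k m' : ℕ} (hk : 1 ≤ k) (hkm : k ≤ m') (hm : m ≤ m') :
    DP (e + 1) (n + k) m' fun v x => 𝒟 k v x * r v x := by
  induction h with
  | zero => simpa using DP.zero
  | @mono F L hF h1 h2 h3 =>
    rw [← dmono_cons]
    refine .mono hF (by simpa using h1) (fun j hj => ?_) (by simp; omega)
    rcases Multiset.mem_cons.1 hj with rfl | hj
    · exact ⟨hk, hkm⟩
    · exact ⟨(h2 j hj).1, (h2 j hj).2.trans hm⟩
  | add _ _ ih ih' => simp only [mul_add]; exact .add ih ih'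

lemma coef_mul (h : DP e n m r) {G : ℝ → ℝ} (hG : BInf G) :
    DP e n m fun v x => G (v x) * r v x := by
  induction h with
  | zero => simpa using DP.zero
  | @mono F L hF h1 h2 h3 =>
    have : (fun (v : ℝ → ℝ) x => G (v x) * dmono F L v x) = dmono (fun y => G y * F y) L := by
      ext v x; simp only [dmono]; ring
    rw [this]
    exact .mono (hG.mul hF) h1 h2 h3
  | add _ _ ih ih' => simp only [mul_add]; exact .add ih ih'

lemma const_mul (h : DP e n m r) (c : ℝ) : DP e n m fun v x => c * r v x :=
  h.coef_mul (bInf_const c)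

lemma coef {F : ℝ → ℝ} (hF : BInf F) : DP 0 0 0 fun v x => F (v x) := by
  rw [← dmono_zero]; exact .mono hF (by simp) (by simp) (by simp)

lemma one : DP 0 0 0 fun _ _ => 1 := coef (bInf_const 1)

/-- The product rule either creates a factor `v_x` from the coefficient or raises the order of one
factor by one. Both add one to the total order and never remove factors. -/
lemma exists_deriv (h : DP e n m r) : ∃ r', DP e (n + 1) (m + 1) r' ∧
    ∀ v, Smooth v → ∀ x, HasDerivAt (r v) (r' v x) x := by
  induction h with
  | zero => exact ⟨_, .zero, fun v _ x => hasDerivAt_const x 0⟩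
  | @mono F L hF h1 h2 h3 =>
    -- Replacing `e` and `n` by the exact number of factors and the exact total order leaves only a
    -- condition on the single factors, which is inherited in the induction on `L`.
    suffices hs : ∃ r', DP L.card (L.sum + 1) (m + 1) r' ∧
        ∀ v, Smooth v → ∀ x, HasDerivAt (dmono F L v) (r' v x) x by
      obtain ⟨r', hr, hd⟩ := hs
      exact ⟨r', hr.weaken h1 (by omega) le_rfl, hd⟩
    clear h1 h3
    induction L using Multiset.induction with
    | empty =>
      refine ⟨fun v x => 𝒟 1 v x * deriv F (v x), ?_, fun v hv x => ?_⟩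
      · exact ((coef hF.deriv).cons (k := 1) (m' := m + 1) le_rfl (by omega) (by omega)).weaken
          (by simp) (by simp) le_rfl
      · rw [dmono_zero]
        beta_reduce
        rw [mul_comm]
        have := smooth_hasDerivAt hv 0 x
        rw [iteratedDeriv_zero] at this
        exact (hF.smooth.differentiable (by simp) (v x)).hasDerivAt.comp x this
    | cons k L ih =>
      obtain ⟨r', hr, hd⟩ := ih (fun j hj => h2 j (Multiset.mem_cons_of_mem hj))
      have hk := h2 k (Multiset.mem_cons_self k L)
      refine ⟨fun v x => 𝒟 (k + 1) v x * dmono F L v x + 𝒟 k v x * r' v x, .add ?_ ?_, fun v hv x => ?_⟩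
      · have h0 : DP L.card L.sum m (dmono F L) :=
          .mono hF le_rfl (fun j hj => h2 j (Multiset.mem_cons_of_mem hj)) le_rfl
        exact (h0.cons (k := k + 1) (m' := m + 1) (by omega) (by omega) (by omega)).weaken
          (by simp) (by simp; omega) le_rfl
      · exact (hr.cons (k := k) (m' := m + 1) (by omega) (by omega) le_rfl).weaken
          (by simp) (by simp; omega) le_rfl
      · rw [dmono_cons]
        exact (smooth_hasDerivAt hv k x).mul (hd v hv x)
  | add _ _ ih ih' =>
    obtain ⟨r1, hr1, hd1⟩ := ih
    obtain ⟨r2, hr2, hd2⟩ := ih'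
    exact ⟨_, .add hr1 hr2, fun v hv x => (hd1 v hv x).add (hd2 v hv x)⟩

lemma exists_iter (h : DP e n m r) (j : ℕ) : ∃ r', DP e (n + j) (m + j) r' ∧
    ∀ v, Smooth v → 𝒟 j (r v) = r' v := by
  induction j with
  | zero => exact ⟨r, h, fun v _ => by simp⟩
  | succ j ih =>
    obtain ⟨r1, hr1, h1⟩ := ih
    obtain ⟨r2, hr2, h2⟩ := hr1.exists_deriv
    refine ⟨r2, hr2, fun v hv => ?_⟩
    rw [iteratedDeriv_succ, h1 v hv]
    ext x
    exact (h2 v hv x).deriv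

lemma bInf (h : DP e n m r) {v : ℝ → ℝ} (hv : HInf v) : BInf (r v) := by
  induction h with
  | zero => exact bInf_const 0
  | @mono F L hF h1 h2 h3 =>
    clear h1 h2 h3
    induction L using Multiset.induction with
    | empty => rw [dmono_zero]; exact hF.comp hv.bInf
    | cons k L ih => rw [dmono_cons]; exact (hv.iter k).bInf.mul ih
  | add _ _ ih ih' =>
    refine ⟨ih.smooth.add ih'.smooth, fun k => ?_⟩
    obtain ⟨C, hC⟩ := ih.bdd k
    obtain ⟨D, hD⟩ := ih'.bdd k
    refine ⟨C + D, fun x => ?_⟩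
    rw [iter_add ih.smooth ih'.smooth]
    exact (abs_add_le _ _).trans (add_le_add (hC x) (hD x))

lemma hInf (h : DP 1 n m r) {v : ℝ → ℝ} (hv : HInf v) : HInf (r v) := by
  induction h with
  | zero => exact HInf.zero
  | @mono F L hF h1 h2 h3 =>
    obtain ⟨k, hk⟩ : ∃ k, k ∈ L := Multiset.card_pos_iff_exists_mem.1 h1
    obtain ⟨L, rfl⟩ := Multiset.exists_cons_of_mem hk
    have h0 : DP 0 L.sum m (dmono F L) :=
      .mono hF (by simp) (fun j hj => h2 j (Multiset.mem_cons_of_mem hj)) le_rfl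
    rw [dmono_cons]
    simp only [mul_comm (𝒟 k v _)]
    exact (h0.bInf hv).mul_hInf (hv.iter k)
  | add _ _ ih ih' => exact ih.add ih'

lemma sup_bound (h : DP e n m r) (B : ℝ) :
    ∃ C, 0 ≤ C ∧ ∀ v, HInf v → Hn (m + 1) v ≤ B → ∀ x, |r v x| ≤ C := by
  induction h with
  | zero => exact ⟨0, le_rfl, fun v _ _ x => by simp⟩
  | @mono F L hF h1 h2 h3 =>
    clear h1 h3
    induction L using Multiset.induction with
    | empty =>
      obtain ⟨C, h0, hC⟩ := hF.bdd0
      exact ⟨C, h0, fun v _ _ x => by rw [dmono_zero]; exact hC _⟩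
    | cons k L ih =>
      obtain ⟨C, h0, hC⟩ := ih (fun j hj => h2 j (Multiset.mem_cons_of_mem hj))
      have hk := h2 k (Multiset.mem_cons_self k L)
      refine ⟨2 * |B| * C, by positivity, fun v hv hB x => ?_⟩
      rw [dmono_cons, abs_mul]
      have h4 := abs_iter_le_Hn hv (show k + 1 ≤ m + 1 by omega) x
      have h5 := le_abs_self B
      exact mul_le_mul (by linarith) (hC v hv hB x) (abs_nonneg _) (by positivity)
  | add _ _ ih ih' =>
    obtain ⟨C, h0, hC⟩ := ih
    obtain ⟨D, h0', hD⟩ := ih'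
    exact ⟨C + D, by positivity, fun v hv hB x =>
      (abs_add_le _ _).trans (add_le_add (hC v hv hB x) (hD v hv hB x))⟩

/-- Telescoping over the factors: the difference falls on one factor, measured in `L²`, and the
others are bounded in the supremum norm. The supremum norms are why the a priori bound needs one
derivative more than the conclusion. -/
lemma lipschitz (h : DP e n m r) (B : ℝ) : ∃ C, 0 ≤ C ∧ ∀ v w, HInf v → HInf w →
    Hn (m + 1) v ≤ B → Hn (m + 1) w ≤ B → MemLp (fun x => r v x - r w x) 2 volume ∧
      l2 (fun x => r v x - r w x) ≤ C * Hn m (fun x => v x - w x) := by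
  induction h with
  | zero => exact ⟨0, le_rfl, fun v w _ _ _ _ => by simp [l2_zero]⟩
  | @mono F L hF h1 h2 h3 =>
    clear h1 h3
    induction L using Multiset.induction with
    | empty =>
      obtain ⟨C, h0, hC⟩ := hF.lipschitz
      refine ⟨C, h0, fun v w hv hw _ _ => ?_⟩
      rw [dmono_zero]
      have hd := hv.sub hw
      have hc : Continuous fun x => F (v x) - F (w x) :=
        (hF.smooth.continuous.comp hv.continuous).sub (hF.smooth.continuous.comp hw.continuous)
      refine ⟨MemLp.of_le_mul (c := C) hd.mem0 hc.aestronglyMeasurable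
        (ae_of_all _ fun x => hC _ _), ?_⟩
      have h1 := l2_le_mul (f := fun x => F (v x) - F (w x)) h0 hd.mem0
        (ae_of_all _ fun x => hC (v x) (w x))
      refine h1.trans (mul_le_mul_of_nonneg_left ?_ h0)
      rw [← hs_zero]; exact hs_le_Hn (Nat.zero_le _) _
    | cons k L ih =>
      have h2' : ∀ j ∈ L, 1 ≤ j ∧ j ≤ m := fun j hj => h2 j (Multiset.mem_cons_of_mem hj)
      obtain ⟨C, h0, hC⟩ := ih h2'
      have hk := h2 k (Multiset.mem_cons_self k L)
      have hDP : DP 0 L.sum m (dmono F L) := .mono hF (by simp) h2' le_rfl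
      obtain ⟨D, hD0, hD⟩ := hDP.sup_bound B
      refine ⟨D + 2 * |B| * C, by positivity, fun v w hv hw hBv hBw => ?_⟩
      obtain ⟨hm, hl⟩ := hC v w hv hw hBv hBw
      have hd := hv.sub hw
      have e1 : (fun x => dmono F (k ::ₘ L) v x - dmono F (k ::ₘ L) w x) = fun x =>
          dmono F L v x * 𝒟 k (fun x => v x - w x) x +
            𝒟 k w x * (dmono F L v x - dmono F L w x) := by
        ext x; rw [dmono_cons, iter_sub hv.smooth hw.smooth]; ring
      have hb1 := hD v hv hBv
      have hb2 : ∀ x, |𝒟 k w x| ≤ 2 * |B| := fun x => by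
        have h4 := abs_iter_le_Hn hw (show k + 1 ≤ m + 1 by omega) x
        have h5 := le_abs_self B
        linarith
      have m1 : MemLp (fun x => dmono F L v x * 𝒟 k (fun x => v x - w x) x) 2 volume :=
        memLp_bdd_mul (hDP.bInf hv).smooth.continuous.aestronglyMeasurable (hd.mem k) hb1
      have m2 : MemLp (fun x => 𝒟 k w x * (dmono F L v x - dmono F L w x)) 2 volume :=
        memLp_bdd_mul (hw.iter k).continuous.aestronglyMeasurable hm hb2
      rw [e1]
      refine ⟨m1.add m2, (l2_add_le m1 m2).trans ?_⟩
      rw [add_mul]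
      refine add_le_add ((l2_bdd_mul_le (hd.mem k) hb1).trans ?_)
        ((l2_bdd_mul_le hm hb2).trans ?_)
      · exact mul_le_mul_of_nonneg_left (hs_le_Hn hk.2 _) hD0
      · rw [mul_assoc (2 * |B|)]
        exact mul_le_mul_of_nonneg_left hl (by positivity)
  | add _ _ ih ih' =>
    obtain ⟨C, h0, hC⟩ := ih
    obtain ⟨D, h0', hD⟩ := ih'
    refine ⟨C + D, by positivity, fun v w hv hw hBv hBw => ?_⟩
    obtain ⟨m1, l1⟩ := hC v w hv hw hBv hBw
    obtain ⟨m2, l2⟩ := hD v w hv hw hBv hBw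
    simp only [add_sub_add_comm]
    refine ⟨m1.add m2, (l2_add_le m1 m2).trans ?_⟩
    rw [add_mul]; exact add_le_add l1 l2

end DP

/-! ### Tame estimates -/

lemma hs_eq_zero_of_Hn {v : ℝ → ℝ} {m k : ℕ} (h : Hn m v = 0) (hk : k ≤ m) : hs k v = 0 :=
  le_antisymm ((hs_le_Hn hk v).trans h.le) (hs_nonneg _ _)

lemma eq_zero_of_Hn {v : ℝ → ℝ} (hv : HInf v) {m : ℕ} (hm : 1 ≤ m) (h : Hn m v = 0) (x : ℝ) :
    v x = 0 := by
  have := abs_le_hs hv x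
  rw [hs_eq_zero_of_Hn h (Nat.zero_le _), hs_eq_zero_of_Hn h hm] at this
  simpa using this

/-- Interpolation of the Sobolev norms between `H^4` and `H^s` by a geometric sequence. -/
lemma exists_ratio {v : ℝ → ℝ} (hv : HInf v) (h4 : 0 < Hn 4 v) {s : ℕ} (hs4 : 4 ≤ s) :
    ∃ ρ : ℝ, 1 ≤ ρ ∧ Hn 4 v * ρ ^ (s - 4) = Hn s v ∧ ∀ k ≤ s, hs k v ≤ Hn 4 v * ρ ^ (k - 4) := by
  have hmono := Hn_mono hs4 v
  obtain ⟨ρ, h1, h2⟩ : ∃ ρ : ℝ, 1 ≤ ρ ∧ Hn 4 v * ρ ^ (s - 4) = Hn s v := by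
    rcases Nat.eq_or_lt_of_le hs4 with rfl | hlt
    · exact ⟨1, le_rfl, by simp⟩
    · refine ⟨(Hn s v / Hn 4 v) ^ (((s - 4 : ℕ) : ℝ)⁻¹), ?_, ?_⟩
      · exact Real.one_le_rpow ((one_le_div h4).2 hmono) (by positivity)
      · rw [Real.rpow_inv_natCast_pow (div_nonneg (Hn_nonneg _ _) h4.le) (by omega)]
        field_simp
  have hρ : 0 < ρ := by linarith
  refine ⟨ρ, h1, h2, fun k hk => ?_⟩
  rcases le_total k 4 with hk4 | hk4
  · rw [Nat.sub_eq_zero_of_le hk4]; simpa using hs_le_Hn hk4 v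
  -- Log-convexity survives division by a geometric sequence, and `ρ` is chosen so that both ends of
  -- the normalized sequence are at most `Hn 4 v`.
  · have := logconvex_le (c := fun i => hs (4 + i) v / ρ ^ i) (n := s - 4) (A := Hn 4 v) h4.le
      (fun i _ => ?_) (fun i => div_nonneg (hs_nonneg _ _) (by positivity))
      (by simpa using hs_le_Hn le_rfl v) ?_ (k - 4) (by omega)
    · rw [div_le_iff₀ (by positivity), show 4 + (k - 4) = k by omega] at this
      exact this
    · have h3 := hs_logconvex hv (4 + i)
      rw [div_pow, div_mul_div_comm, ← pow_add, ← pow_mul, show i + (i + 2) = (i + 1) * 2 by ring]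
      exact div_le_div_of_nonneg_right h3 (by positivity)
    · rw [div_le_iff₀ (by positivity), h2, show 4 + (s - 4) = s by omega]
      exact hs_le_Hn le_rfl v

/-- The truncated difference `k - 3` is the power of `ρ` paid for `∂ᵏv` in the supremum norm. The
alternatives correspond to no factor, one factor, or at least two factors of order above `3`. -/
lemma excess_cases {s : ℕ} (hs4 : 4 ≤ s) (L : Multiset ℕ) (hL : ∀ k ∈ L, 1 ≤ k ∧ k + 1 ≤ s) :
    (L.map fun k => k - 3).sum = 0 ∨
    ((L.map fun k => k - 3).sum + 3 ≤ L.sum ∧ (L.map fun k => k - 3).sum + 4 ≤ s) ∨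
      (L.map fun k => k - 3).sum + 6 ≤ L.sum := by
  induction L using Multiset.induction with
  | empty => simp
  | cons k L ih =>
    have hk := hL k (Multiset.mem_cons_self k L)
    have := ih fun j hj => hL j (Multiset.mem_cons_of_mem hj)
    simp only [Multiset.map_cons, Multiset.sum_cons]
    omega

/-- The chosen factor `k` goes into `L²` at the price `ρ^(k-4)`, the others into the supremum norm.
A factor of order `s` must be the one in `L²`, since its supremum would need `s + 1` derivatives;
the rest then has total order at most `3` and costs nothing. Otherwise any factor can be chosen. -/
lemma exists_split {s : ℕ} (hs4 : 4 ≤ s) (L : Multiset ℕ) (h1 : 1 ≤ L.card)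
    (hL : ∀ k ∈ L, 1 ≤ k ∧ k ≤ s) (hsum : L.sum ≤ s + 3) :
    ∃ k L', L = k ::ₘ L' ∧ 1 ≤ k ∧ k ≤ s ∧ (∀ j ∈ L', 1 ≤ j ∧ j + 1 ≤ s) ∧
      (k - 4) + (L'.map fun k => k - 3).sum ≤ s - 4 := by
  by_cases hsL : s ∈ L
  · obtain ⟨L', rfl⟩ := Multiset.exists_cons_of_mem hsL
    simp only [Multiset.sum_cons] at hsum
    have hle : ∀ j ∈ L', j ≤ 3 := fun j hj => by
      have := Multiset.le_sum_of_mem hj; omega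
    refine ⟨s, L', rfl, by omega, le_rfl, fun j hj => ?_, ?_⟩
    · have := hL j (Multiset.mem_cons_of_mem hj); have := hle j hj; omega
    · have : (L'.map fun k => k - 3).sum = 0 := by
        rw [Multiset.sum_eq_zero_iff]
        intro i hi
        obtain ⟨j, hj, rfl⟩ := Multiset.mem_map.1 hi
        have := hle j hj; omega
      omega
  · obtain ⟨k, hk⟩ : ∃ k, k ∈ L := Multiset.card_pos_iff_exists_mem.1 h1
    obtain ⟨L', rfl⟩ := Multiset.exists_cons_of_mem hk
    have hL1 : ∀ j ∈ k ::ₘ L', 1 ≤ j ∧ j + 1 ≤ s := fun j hj => by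
      have h2 := hL j hj
      have : j ≠ s := fun h => hsL (h ▸ hj)
      omega
    have hk1 := hL1 k (Multiset.mem_cons_self k L')
    have hL2 : ∀ j ∈ L', 1 ≤ j ∧ j + 1 ≤ s := fun j hj => hL1 j (Multiset.mem_cons_of_mem hj)
    refine ⟨k, L', rfl, hk1.1, by omega, hL2, ?_⟩
    have := excess_cases hs4 L' hL2
    simp only [Multiset.sum_cons] at hsum
    omega

/-- Each factor satisfies `sup |∂ᵏv| ≤ hs k v + hs (k+1) v ≤ 2 M ρ^(k-3)`; truncated subtraction
covers the low orders, where no power of `ρ` is needed. -/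
lemma abs_prod_le {v : ℝ → ℝ} (hv : HInf v) {s : ℕ} {M ρ : ℝ} (hM : 0 ≤ M) (hρ : 1 ≤ ρ)
    (h : ∀ k ≤ s, hs k v ≤ M * ρ ^ (k - 4)) (L : Multiset ℕ) (hL : ∀ j ∈ L, 1 ≤ j ∧ j + 1 ≤ s)
    (x : ℝ) : |(L.map fun k => 𝒟 k v x).prod| ≤
      (2 * M) ^ L.card * ρ ^ (L.map fun k => k - 3).sum := by
  induction L using Multiset.induction with
  | empty => simp
  | cons k L ih =>
    have ih' := ih fun j hj => hL j (Multiset.mem_cons_of_mem hj)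
    have hk := hL k (Multiset.mem_cons_self k L)
    simp only [Multiset.map_cons, Multiset.sum_cons, Multiset.prod_cons, Multiset.card_cons, abs_mul]
    have h1 : |𝒟 k v x| ≤ 2 * M * ρ ^ (k - 3) := by
      have h2 := abs_iter_le_hs hv k x
      have h3 := h k (by omega)
      have h4 := h (k + 1) (by omega)
      have h5 : M * ρ ^ (k - 4) ≤ M * ρ ^ (k - 3) :=
        mul_le_mul_of_nonneg_left (pow_le_pow_right₀ hρ (by omega)) hM
      rw [show k + 1 - 4 = k - 3 by omega] at h4
      linarith
    have hρ0 : 0 ≤ ρ := by linarith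
    calc |𝒟 k v x| * |(L.map fun k => 𝒟 k v x).prod| ≤ (2 * M * ρ ^ (k - 3)) * ((2 * M) ^ L.card * ρ ^ (L.map fun k => k - 3).sum) :=
          mul_le_mul h1 ih' (abs_nonneg _) (by positivity)
      _ = _ := by rw [pow_succ, pow_add]; ring

/-- With `exists_split` the powers of `ρ` add up to at most `s - 4`, and `Hn 4 v * ρ^(s-4) = Hn s
v`: the bound is linear in the norm of `H^s`. The admissible total order `s + 3` is the one that `s`
derivatives of a third order operator produce. -/
lemma DP.tame {s m : ℕ} {r : (ℝ → ℝ) → ℝ → ℝ} (hs4 : 4 ≤ s) (h : DP 1 (s + 3) m r) (hm : m ≤ s)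
    (B : ℝ) :
    ∃ C, 0 ≤ C ∧ ∀ v, HInf v → Hn 4 v ≤ B → l2 (r v) ≤ C * Hn s v := by
  induction h with
  | zero => exact ⟨0, le_rfl, fun v _ _ => by simp [l2_zero]⟩
  | @mono F L hF h1 h2 h3 =>
    obtain ⟨k, L', rfl, hk1, hk2, hL', hsum⟩ :=
      exists_split hs4 L h1 (fun k hk => ⟨(h2 k hk).1, (h2 k hk).2.trans hm⟩) h3
    obtain ⟨C, hC0, hC⟩ := hF.bdd0
    refine ⟨C * (2 * |B|) ^ L'.card, by positivity, fun v hv hB => ?_⟩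
    have hDP : DP 0 L'.sum m (dmono F L') :=
      .mono hF (by simp) (fun j hj => h2 j (Multiset.mem_cons_of_mem hj)) le_rfl
    rw [dmono_cons]
    simp only [mul_comm (𝒟 k v _)]
    -- The ratio `ρ` is a quotient by `Hn 4 v`; if this norm vanishes then `v = 0` and so does the
    -- monomial.
    rcases (Hn_nonneg 4 v).eq_or_lt with h0 | h0
    · have hz : v = fun _ => 0 := funext (eq_zero_of_Hn hv (by norm_num) h0.symm)
      have : (fun x => dmono F L' v x * 𝒟 k v x) = fun _ => 0 := by
        ext x; rw [hz]; simp [iteratedDeriv_fun_const_zero]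
      rw [this, l2_zero]
      exact mul_nonneg (by positivity) (Hn_nonneg _ _)
    · obtain ⟨ρ, hρ, hρs, hk⟩ := exists_ratio hv h0 hs4
      have hb : ∀ x, |dmono F L' v x| ≤
          C * ((2 * Hn 4 v) ^ L'.card * ρ ^ (L'.map fun k => k - 3).sum) := fun x => by
        rw [dmono, abs_mul]
        exact mul_le_mul (hC _) (abs_prod_le hv h0.le hρ hk L' hL' x) (abs_nonneg _) hC0
      have h5 := l2_bdd_mul_le (hv.mem k) hb
      have hρ0 : 0 ≤ ρ := by linarith
      calc _ ≤ _ := h5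
        _ ≤ C * ((2 * Hn 4 v) ^ L'.card * ρ ^ (L'.map fun k => k - 3).sum) *
            (Hn 4 v * ρ ^ (k - 4)) := mul_le_mul_of_nonneg_left (hk k hk2) (by positivity)
        _ = C * (2 * Hn 4 v) ^ L'.card *
            (Hn 4 v * ρ ^ (k - 4 + (L'.map fun k => k - 3).sum)) := by rw [pow_add]; ring
        _ ≤ C * (2 * |B|) ^ L'.card * (Hn 4 v * ρ ^ (s - 4)) := by
            gcongr
            · exact hB.trans (le_abs_self B)
        _ = _ := by rw [hρs]
  | add h h' ih ih' =>
    obtain ⟨C, h0, hC⟩ := ih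
    obtain ⟨D, h0', hD⟩ := ih'
    refine ⟨C + D, by positivity, fun v hv hB => ?_⟩
    refine (l2_add_le (h.hInf hv).mem0 (h'.hInf hv).mem0).trans ?_
    rw [add_mul]; exact add_le_add (hC v hv hB) (hD v hv hB)

lemma DP.lipschitz_hs {n m : ℕ} {r : (ℝ → ℝ) → ℝ → ℝ} (h : DP 1 n m r) (j : ℕ) (B : ℝ) :
    ∃ C, 0 ≤ C ∧ ∀ v w, HInf v → HInf w → Hn (m + j + 1) v ≤ B → Hn (m + j + 1) w ≤ B →
      hs j (fun x => r v x - r w x) ≤ C * Hn (m + j) (fun x => v x - w x) := by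
  obtain ⟨r', hr', h'⟩ := h.exists_iter j
  obtain ⟨C, h0, hC⟩ := hr'.lipschitz B
  refine ⟨C, h0, fun v w hv hw hBv hBw => ?_⟩
  rw [hs, iter_sub (h.hInf hv).smooth (h.hInf hw).smooth, h' v hv.smooth, h' w hw.smooth]
  exact (hC v w hv hw hBv hBw).2

/-! ### The nonlinear operator and the structure of its derivatives -/

/-- The operator `a(v) v_x + κ(v) v_xxx + 2 κ'(v) v_x v_xx + ½ κ''(v) v_x³`. -/
def Nop (κ a : ℝ → ℝ) (v : ℝ → ℝ) (x : ℝ) : ℝ :=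
  κ (v x) * 𝒟 3 v x + 2 * (deriv κ (v x) * (𝒟 1 v x * 𝒟 2 v x)) +
    1 / 2 * (deriv (deriv κ) (v x) * 𝒟 1 v x ^ 3) + a (v x) * 𝒟 1 v x

section

variable {κ a : ℝ → ℝ} (hκ : BInf κ) (ha : BInf a)

include hκ ha

lemma DP_Nop : DP 1 3 3 (Nop κ a) := by
  have d1 : DP 1 1 1 fun v x => 𝒟 1 v x * 1 := DP.one.cons (k := 1) le_rfl le_rfl (by omega)
  have d2 : DP 1 2 2 fun v x => 𝒟 2 v x * 1 := DP.one.cons (k := 2) (by norm_num) le_rfl (by omega)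
  have d3 : DP 1 3 3 fun v x => 𝒟 3 v x * 1 := DP.one.cons (k := 3) (by norm_num) le_rfl (by omega)
  have d12 := d2.cons (k := 1) (m' := 3) (by norm_num) (by norm_num) (by norm_num)
  have d111 := (d1.cons (k := 1) (m' := 3) (by norm_num) (by norm_num) (by norm_num)).cons
    (k := 1) (m' := 3) (by norm_num) (by norm_num) (by norm_num)
  have h := (((d3.coef_mul hκ).add (((d12.coef_mul hκ.deriv).const_mul 2).weaken
    (e' := 1) (n' := 3) (m' := 3) (by omega) (by omega) (by omega))).add
    (((d111.coef_mul hκ.deriv.deriv).const_mul (1 / 2)).weaken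
    (e' := 1) (n' := 3) (m' := 3) (by omega) (by omega) (by omega))).add
    ((d1.coef_mul ha).weaken (e' := 1) (n' := 3) (m' := 3) (by omega) (by omega) (by omega))
  refine cast (congrArg _ ?_) h
  ext v x; simp only [Nop]; ring

/-- Every differentiation of `κ(v) ∂^(s+3) v` adds one copy of `κ'(v) v_x ∂^(s+3) v`, so the
coefficient of the second highest term grows by one from its value `2` at `s = 0`. This coefficient
determines the weight. -/
lemma iter_Nop_aux (s : ℕ) : ∃ q, DP 1 (s + 3) (s + 1) q ∧ ∀ v, Smooth v → ∀ x,
    𝒟 s (Nop κ a v) x = κ (v x) * 𝒟 (s + 3) v x +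
      (s + 2) * (deriv κ (v x) * 𝒟 1 v x) * 𝒟 (s + 2) v x + q v x := by
  have d1 : DP 1 1 1 fun v x => 𝒟 1 v x * 1 := DP.one.cons (k := 1) le_rfl le_rfl (by omega)
  have d2 : DP 1 2 2 fun v x => 𝒟 2 v x * 1 := DP.one.cons (k := 2) (by norm_num) le_rfl (by omega)
  induction s with
  | zero =>
    have d111 := (d1.cons (k := 1) (m' := 1) le_rfl le_rfl le_rfl).cons
      (k := 1) (m' := 1) le_rfl le_rfl le_rfl
    refine ⟨_, (((d111.coef_mul hκ.deriv.deriv).const_mul (1 / 2)).weaken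
      (e' := 1) (n' := 0 + 3) (m' := 0 + 1) (by omega) (by omega) (by omega)).add
      ((d1.coef_mul ha).weaken le_rfl (by omega) (by omega)), fun v hv x => ?_⟩
    simp [Nop]; ring
  | succ s ih =>
    obtain ⟨q, hq, h⟩ := ih
    obtain ⟨q', hq', hqd⟩ := hq.exists_deriv
    have d11 := d1.cons (k := 1) (m' := 2) (by norm_num) (by norm_num) (by norm_num)
    have hb := ((d11.coef_mul hκ.deriv.deriv).weaken (e' := 0) (n' := 2) (m' := 2) (by omega)
      (by omega) (by omega)).add ((d2.coef_mul hκ.deriv).weaken (by omega) (by omega) (by omega))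
    refine ⟨fun v x => q' v x + (s + 2 : ℝ) * (𝒟 (s + 2) v x *
      (deriv (deriv κ) (v x) * (𝒟 1 v x * (𝒟 1 v x * 1)) + deriv κ (v x) * (𝒟 2 v x * 1))),
      (hq'.weaken le_rfl (by omega) (by omega)).add (DP.const_mul ?_ _), fun v hv x => ?_⟩
    · exact (hb.cons (k := s + 2) (m' := s + 2) (by omega) le_rfl (by omega)).weaken (by omega)
        (by omega) le_rfl
    · rw [iteratedDeriv_succ]
      have hv0 : HasDerivAt v (𝒟 1 v x) x := by simpa using smooth_hasDerivAt hv 0 x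
      have hκ0 : ∀ F : ℝ → ℝ, BInf F → HasDerivAt (fun y => F (v y)) (deriv F (v x) * 𝒟 1 v x) x :=
        fun F hF => (hF.smooth.differentiable (by simp) (v x)).hasDerivAt.comp x hv0
      have e : 𝒟 s (Nop κ a v) = _ := funext (h v hv)
      rw [e]
      have hd := (((hκ0 κ hκ).mul (smooth_hasDerivAt hv (s + 3) x)).add
        ((((hκ0 _ hκ.deriv).mul (smooth_hasDerivAt hv 1 x)).const_mul (s + 2 : ℝ)).mul
          (smooth_hasDerivAt hv (s + 2) x))).add (hqd v hv x)
      refine hd.deriv.trans ?_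
      simp only [Pi.mul_apply]
      push_cast
      ring_nf

end

/-- A factor of order `s + 1` leaves total order at most `2` for its cofactor. These terms are
isolated because the norm of `H^s` does not control `∂^(s+1) v`; they are integrated by parts later,
which costs a derivative of `b`, still within reach of `H^4`. -/
lemma DP.split_top {s : ℕ} (_ : 2 ≤ s) {q : (ℝ → ℝ) → ℝ → ℝ} (h : DP 1 (s + 3) (s + 1) q) :
    ∃ b r, DP 0 2 2 b ∧ DP 1 (s + 3) s r ∧ ∀ v x, q v x = b v x * 𝒟 (s + 1) v x + r v x := by
  induction h with
  | zero => exact ⟨_, _, .zero, .zero, fun v x => by simp⟩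
  | @mono F L hF h1 h2 h3 =>
    by_cases hL : s + 1 ∈ L
    · obtain ⟨L', rfl⟩ := Multiset.exists_cons_of_mem hL
      simp only [Multiset.sum_cons] at h3
      refine ⟨dmono F L', _, .mono hF (by simp) (fun j hj => ?_) (by omega), .zero, fun v x => ?_⟩
      · have h4 := Multiset.le_sum_of_mem hj
        exact ⟨(h2 j (Multiset.mem_cons_of_mem hj)).1, by omega⟩
      · rw [dmono_cons]; ring
    · refine ⟨_, dmono F L, .zero, .mono hF h1 (fun j hj => ?_) h3, fun v x => by ring⟩
      have h4 := h2 j hj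
      have : j ≠ s + 1 := fun h => hL (h ▸ hj)
      omega
  | add _ _ ih ih' =>
    obtain ⟨b, r, hb, hr, h⟩ := ih
    obtain ⟨b', r', hb', hr', h'⟩ := ih'
    exact ⟨_, _, hb.add hb', hr.add hr', fun v x => by simp only [h, h']; ring⟩

lemma iter_Nop {κ a : ℝ → ℝ} (hκ : BInf κ) (ha : BInf a) {s : ℕ} (hs : 2 ≤ s) :
    ∃ b r, DP 0 2 2 b ∧ DP 1 (s + 3) s r ∧ ∀ v, Smooth v → ∀ x,
    𝒟 s (Nop κ a v) x = κ (v x) * 𝒟 (s + 3) v x +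
      (s + 2) * (deriv κ (v x) * 𝒟 1 v x) * 𝒟 (s + 2) v x + b v x * 𝒟 (s + 1) v x + r v x := by
  obtain ⟨q, hq, h⟩ := iter_Nop_aux hκ ha s
  obtain ⟨b, r, hb, hr, h'⟩ := hq.split_top hs
  exact ⟨b, r, hb, hr, fun v hv x => by rw [h v hv, h']; ring⟩

/-! ### Integral inequalities -/

open scoped ENNReal

lemma sq_lintegral_le (ν : Measure ℝ) {h : ℝ → ℝ≥0∞} (hh : Measurable h) :
    (∫⁻ z, h z ∂ν) ^ 2 ≤ ν univ * ∫⁻ z, h z ^ 2 ∂ν := by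
  have hpq : (2 : ℝ).HolderConjugate 2 := Real.HolderConjugate.two_two
  have h1 := ENNReal.lintegral_mul_le_Lp_mul_Lq ν hpq (f := fun _ => 1) (g := h)
    aemeasurable_const hh.aemeasurable
  simp only [Pi.mul_apply, one_mul, ENNReal.one_rpow, lintegral_const] at h1
  have h2 := pow_le_pow_left' h1 2
  refine h2.trans (le_of_eq ?_)
  rw [mul_pow, ← ENNReal.rpow_natCast, ← ENNReal.rpow_natCast, ← ENNReal.rpow_mul,
    ← ENNReal.rpow_mul]
  norm_num

/-- Cauchy–Schwarz in `z` and Tonelli. This is weaker than Minkowski's inequality but suffices for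
bounds that are uniform in `z`. -/
lemma lintegral_minkowski (ν : Measure ℝ) [IsFiniteMeasure ν] {h : ℝ → ℝ → ℝ≥0∞}
    (hh : Measurable (Function.uncurry h)) {b : ℝ≥0∞} (hb : ∀ᵐ z ∂ν, ∫⁻ x, h x z ^ 2 ≤ b) :
    ∫⁻ x, (∫⁻ z, h x z ∂ν) ^ 2 ≤ ν univ ^ 2 * b := by
  calc ∫⁻ x, (∫⁻ z, h x z ∂ν) ^ 2 ≤ ∫⁻ x, ν univ * ∫⁻ z, h x z ^ 2 ∂ν :=
        lintegral_mono fun x => sq_lintegral_le ν (hh.comp measurable_prodMk_left)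
    _ = ν univ * ∫⁻ x, ∫⁻ z, h x z ^ 2 ∂ν := lintegral_const_mul' _ _ (measure_ne_top _ _)
    _ = ν univ * ∫⁻ z, (∫⁻ x, h x z ^ 2) ∂ν := by
        rw [lintegral_lintegral_swap (f := fun x z => h x z ^ 2) (hh.pow_const 2).aemeasurable]
    _ ≤ ν univ * ∫⁻ z, b ∂ν := by gcongr 1; exact lintegral_mono_ae hb
    _ = ν univ ^ 2 * b := by rw [lintegral_const]; ring

lemma eLpNorm_two_eq (f : ℝ → ℝ) : eLpNorm f 2 volume = (∫⁻ x, ‖f x‖ₑ ^ 2) ^ (1 / 2 : ℝ) := by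
  rw [eLpNorm_eq_lintegral_rpow_enorm_toReal (by norm_num) (by norm_num)]
  norm_num

lemma lintegral_sq_eq {f : ℝ → ℝ} (hf : MemLp f 2 volume) :
    ∫⁻ x, ‖f x‖ₑ ^ 2 = ENNReal.ofReal (l2 f ^ 2) := by
  have h := eLpNorm_two_eq f
  rw [ENNReal.ofReal_pow (l2_nonneg f), l2, ENNReal.ofReal_toReal hf.2.ne, h,
    ← ENNReal.rpow_natCast, ← ENNReal.rpow_mul]
  norm_num

lemma memLp_of_lintegral_sq_le {f : ℝ → ℝ} (hf : AEStronglyMeasurable f volume) {B : ℝ}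
    (hB : 0 ≤ B) (h : ∫⁻ x, ‖f x‖ₑ ^ 2 ≤ ENNReal.ofReal (B ^ 2)) :
    MemLp f 2 volume ∧ l2 f ≤ B := by
  have h1 : eLpNorm f 2 volume ≤ ENNReal.ofReal B := by
    rw [eLpNorm_two_eq]
    calc _ ≤ (ENNReal.ofReal (B ^ 2)) ^ (1 / 2 : ℝ) := ENNReal.rpow_le_rpow h (by norm_num)
      _ = ENNReal.ofReal B := by
        rw [ENNReal.ofReal_pow hB, ← ENNReal.rpow_natCast, ← ENNReal.rpow_mul]; norm_num
  exact ⟨⟨hf, h1.trans_lt ENNReal.ofReal_lt_top⟩, ENNReal.toReal_le_of_le_ofReal hB h1⟩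

/-! ### Convolutions -/

/-- The convolution `K * f`. -/
def conv (K f : ℝ → ℝ) (x : ℝ) : ℝ := ∫ y, K (x - y) * f y

lemma conv_comm (K f : ℝ → ℝ) (x : ℝ) : conv K f x = ∫ z, K z * f (x - z) := by
  rw [conv, ← integral_sub_left_eq_self (fun z => K z * f (x - z)) volume x]
  simp

lemma conv_congr {K f g : ℝ → ℝ} (h : f =ᵐ[volume] g) : conv K f = conv K g := by
  ext x
  exact integral_congr_ae (h.mono fun y hy => by simp [hy])

/-- The measure with density `|K|`. -/
def absMeasure (K : ℝ → ℝ) : Measure ℝ := volume.withDensity fun z => ‖K z‖ₑ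

lemma absMeasure_univ {K : ℝ → ℝ} (hK : Integrable K volume) :
    absMeasure K univ = ENNReal.ofReal (∫ z, |K z|) := by
  rw [absMeasure, withDensity_apply _ MeasurableSet.univ, Measure.restrict_univ,
    ofReal_integral_eq_lintegral_ofReal hK.abs (ae_of_all _ fun _ => abs_nonneg _)]
  refine lintegral_congr fun z => ?_
  rw [← Real.norm_eq_abs, ofReal_norm]

lemma isFiniteMeasure_absMeasure {K : ℝ → ℝ} (hK : Integrable K volume) :
    IsFiniteMeasure (absMeasure K) :=
  ⟨by rw [absMeasure_univ hK]; exact ENNReal.ofReal_lt_top⟩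

/-- Minkowski's inequality for the integral of a family of functions against an `L¹` density. -/
lemma memLp_integral_of_forall {K : ℝ → ℝ} (hK : Integrable K volume) (hKc : Measurable K)
    {g : ℝ → ℝ → ℝ} (hg : Measurable (Function.uncurry g)) {B : ℝ} (hB : 0 ≤ B)
    (h : ∀ z, K z ≠ 0 → ∫⁻ x, ‖g x z‖ₑ ^ 2 ≤ ENNReal.ofReal (B ^ 2)) :
    MemLp (fun x => ∫ z, K z * g x z) 2 volume ∧
      l2 (fun x => ∫ z, K z * g x z) ≤ (∫ z, |K z|) * B := by
  have := isFiniteMeasure_absMeasure hK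
  have hK0 : 0 ≤ ∫ z, |K z| := integral_nonneg fun _ => abs_nonneg _
  refine memLp_of_lintegral_sq_le ?_ (by positivity) ?_
  · have : Measurable fun p : ℝ × ℝ => K p.2 * g p.1 p.2 := (hKc.comp measurable_snd).mul hg
    exact (this.aestronglyMeasurable (μ := volume.prod volume)).integral_prod_right'
  · have h1 := lintegral_minkowski (absMeasure K) (h := fun x z => ‖g x z‖ₑ) hg.enorm
      (b := ENNReal.ofReal (B ^ 2)) (by
        rw [absMeasure, ae_withDensity_iff hKc.enorm]
        exact ae_of_all _ fun z hz => h z (by simpa using hz))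
    rw [absMeasure_univ hK, ← ENNReal.ofReal_pow hK0, ← ENNReal.ofReal_mul (by positivity),
      ← mul_pow] at h1
    refine le_trans (lintegral_mono fun x => ?_) h1
    gcongr
    refine (enorm_integral_le_lintegral_enorm _).trans (le_of_eq ?_)
    have hgx : Measurable fun z => ‖g x z‖ₑ := hg.enorm.comp measurable_prodMk_left
    rw [absMeasure, lintegral_withDensity_eq_lintegral_mul _ hKc.enorm hgx]
    refine lintegral_congr fun z => ?_
    simp [enorm_mul]

/-- Young's inequality `L¹ * L² ⊆ L²`. -/
lemma memLp_conv {K f : ℝ → ℝ} (hK : Integrable K volume) (hKc : Measurable K)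
    (hf : MemLp f 2 volume) :
    MemLp (conv K f) 2 volume ∧ l2 (conv K f) ≤ (∫ z, |K z|) * l2 f := by
  obtain ⟨g, hg, hfg⟩ := hf.1
  have hgL : MemLp g 2 volume := (memLp_congr_ae hfg).1 hf
  rw [conv_congr hfg, l2_congr hfg]
  have e : conv K g = fun x => ∫ z, K z * g (x - z) := funext fun x => conv_comm K g x
  rw [e]
  refine memLp_integral_of_forall hK hKc (g := fun x z => g (x - z))
    (hg.measurable.comp (measurable_fst.sub measurable_snd)) (l2_nonneg _) fun z _ => ?_
  rw [lintegral_sub_right_eq_self (fun x => ‖g x‖ₑ ^ 2) z, lintegral_sq_eq hgL]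

/-- The difference is an average over `θ ∈ (0, 1]` of translates of `z f'`, each of the same `L²`
norm. -/
lemma l2_sub_translate_le {f : ℝ → ℝ} (hf : HInf f) (z : ℝ) :
    ∫⁻ x, ‖f (x - z) - f x‖ₑ ^ 2 ≤ ENNReal.ofReal ((|z| * hs 1 f) ^ 2) := by
  set ν : Measure ℝ := volume.restrict (Ioc 0 1)
  have hc := (hf.iter 1).continuous
  have hν : ν univ = 1 := by simp [ν]
  have hfin : IsFiniteMeasure ν := ⟨by rw [hν]; exact ENNReal.one_lt_top⟩
  have hm : Measurable (Function.uncurry fun x θ => ‖z * 𝒟 1 f (x - θ * z)‖ₑ) := by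
    have : Continuous fun p : ℝ × ℝ => z * 𝒟 1 f (p.1 - p.2 * z) := by fun_prop
    exact this.measurable.enorm
  have h1 := lintegral_minkowski ν (h := fun x θ => ‖z * 𝒟 1 f (x - θ * z)‖ₑ) hm
    (b := ENNReal.ofReal ((|z| * hs 1 f) ^ 2)) (ae_of_all _ fun θ => by
      rw [lintegral_sub_right_eq_self (fun x => ‖z * 𝒟 1 f x‖ₑ ^ 2) (θ * z),
        lintegral_sq_eq ((hf.mem 1).const_mul z), l2_const_mul, hs])
  rw [hν, one_pow, one_mul] at h1
  refine le_trans (lintegral_mono fun x => ?_) h1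
  gcongr
  have hd : ∀ θ ∈ uIcc (0 : ℝ) 1, HasDerivAt (fun θ => f (x - θ * z))
      (𝒟 1 f (x - θ * z) * (-z)) θ := fun θ _ => by
    have h2 : HasDerivAt (fun θ : ℝ => x - θ * z) (-z) θ := by
      simpa using ((hasDerivAt_id θ).mul_const z).const_sub x
    exact (hf.hasDerivAt0 (x - θ * z)).comp θ h2
  have hint : IntervalIntegrable (fun θ => 𝒟 1 f (x - θ * z) * (-z)) volume 0 1 := by
    apply Continuous.intervalIntegrable; fun_prop
  have h3 := intervalIntegral.integral_eq_sub_of_hasDerivAt hd hint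
  simp only [one_mul, zero_mul, sub_zero] at h3
  rw [← h3, intervalIntegral.integral_of_le zero_le_one]
  refine (enorm_integral_le_lintegral_enorm _).trans (le_of_eq ?_)
  refine lintegral_congr fun θ => ?_
  simp [enorm_mul, mul_comm]

section L1Kernel

variable {K f : ℝ → ℝ} (hK : Integrable K volume) (hKc : Measurable K)

include hK hKc

lemma integrable_kernel_mul (hf : HInf f) (x : ℝ) :
    Integrable (fun z => K z * f (x - z)) volume := by
  obtain ⟨C, _, hC⟩ := hf.bInf.bdd0
  refine Integrable.mono' (hK.abs.mul_const C) ?_ (ae_of_all _ fun z => ?_)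
  · have := hf.continuous
    exact hKc.aestronglyMeasurable.mul (by fun_prop)
  · simpa [abs_mul] using mul_le_mul_of_nonneg_left (hC (x - z)) (abs_nonneg (K z))

lemma hasDerivAt_conv (hf : HInf f) (x : ℝ) :
    HasDerivAt (conv K f) (conv K (𝒟 1 f) x) x := by
  obtain ⟨C, _, hC⟩ := (hf.iter 1).bInf.bdd0
  have e : conv K f = fun x => ∫ z, K z * f (x - z) := funext fun x => conv_comm K f x
  rw [e, conv_comm]
  refine (hasDerivAt_integral_of_dominated_loc_of_deriv_le (F := fun x z => K z * f (x - z))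
    (F' := fun x z => K z * 𝒟 1 f (x - z)) (bound := fun z => |K z| * C) (s := univ) univ_mem
    (Eventually.of_forall fun y => (integrable_kernel_mul hK hKc hf y).1)
    (integrable_kernel_mul hK hKc hf x) (integrable_kernel_mul hK hKc (hf.iter 1) x).1
    (ae_of_all _ fun z y _ => ?_) (hK.abs.mul_const C) (ae_of_all _ fun z y _ => ?_)).2
  · simpa [abs_mul] using mul_le_mul_of_nonneg_left (hC (y - z)) (abs_nonneg (K z))
  · have h2 : HasDerivAt (fun y : ℝ => y - z) 1 y := (hasDerivAt_id y).sub_const z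
    have := ((hf.hasDerivAt0 (y - z)).comp y h2).const_mul (K z)
    simpa using this

lemma iter_conv (hf : HInf f) (k : ℕ) : 𝒟 k (conv K f) = conv K (𝒟 k f) := by
  induction k with
  | zero => simp
  | succ k ih =>
    rw [iteratedDeriv_succ, ih]
    ext x
    rw [(hasDerivAt_conv hK hKc (hf.iter k) x).deriv, iteratedDeriv_comp_iteratedDeriv, add_comm]

lemma HInf.conv (hf : HInf f) : HInf (conv K f) := by
  refine ⟨contDiff_of_differentiable_iteratedDeriv fun m _ => ?_, fun k => ?_⟩
  · rw [iter_conv hK hKc hf]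
    exact fun x => (hasDerivAt_conv hK hKc (hf.iter m) x).differentiableAt
  · rw [iter_conv hK hKc hf]; exact (memLp_conv hK hKc (hf.mem k)).1

lemma hs_conv_le (hf : HInf f) (k : ℕ) : hs k (QKdV.conv K f) ≤ (∫ z, |K z|) * hs k f := by
  rw [hs, iter_conv hK hKc hf]; exact (memLp_conv hK hKc (hf.mem k)).2

end L1Kernel

lemma conv_const_mul (K f : ℝ → ℝ) (c : ℝ) :
    conv K (fun x => c * f x) = fun x => c * conv K f x := by
  ext x
  simp only [conv, ← integral_const_mul]
  congr 1; ext y; ring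

lemma conv_sub {K f g : ℝ → ℝ} (hK : MemLp K 2 volume) (hf : MemLp f 2 volume)
    (hg : MemLp g 2 volume) : conv K (fun x => f x - g x) = fun x => conv K f x - conv K g x := by
  ext x
  have h1 : MemLp (fun y => K (x - y)) 2 volume :=
    hK.comp_measurePreserving (Measure.measurePreserving_sub_left volume x)
  simp only [conv, mul_sub]
  exact integral_sub (integrable_mul h1 hf) (integrable_mul h1 hg)

lemma abs_conv_le {K f : ℝ → ℝ} (hK : MemLp K 2 volume) (hf : MemLp f 2 volume) (x : ℝ) :
    |conv K f x| ≤ l2 K * l2 f := by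
  have hp := Measure.measurePreserving_sub_left (volume : Measure ℝ) x
  have h1 : MemLp (fun y => K (x - y)) 2 volume := hK.comp_measurePreserving hp
  have h2 : l2 (fun y => K (x - y)) = l2 K := by
    rw [l2, l2]; exact congrArg _ (eLpNorm_comp_measurePreserving hK.1 hp)
  rw [← h2]
  exact abs_integral_mul_le h1 hf

/-- An even `L¹ ∩ L²` kernel defines a symmetric operator. -/
lemma integral_conv_mul {K f g : ℝ → ℝ} (hK : Integrable K volume) (hKc : Measurable K)
    (hK2 : MemLp K 2 volume) (hKe : ∀ x, K (-x) = K x)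
    (hf : MemLp f 2 volume) (hg : MemLp g 2 volume) :
    ∫ x, conv K f x * g x = ∫ x, f x * conv K g x := by
  have h1 : ∀ x, MemLp (fun y => K (x - y)) 2 volume := fun x =>
    hK2.comp_measurePreserving (Measure.measurePreserving_sub_left volume x)
  have hint : Integrable (Function.uncurry fun x y => K (x - y) * f y * g x)
      (volume.prod volume) := by
    refine (integrable_prod_iff ?_).2 ⟨ae_of_all _ fun x => ?_, ?_⟩
    · exact ((hKc.comp (measurable_fst.sub measurable_snd)).aestronglyMeasurable.mul
        hf.1.comp_snd).mul hg.1.comp_fst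
    · exact (integrable_mul (h1 x) hf).mul_const (g x)
    -- Fubini is justified by Young's inequality for `|K|` and `|f|`.
    · have := integrable_mul (memLp_conv hK.abs hKc.norm hf.abs).1 hg.abs
      refine this.congr (ae_of_all _ fun x => ?_)
      simp only [Function.uncurry, conv, norm_mul, Real.norm_eq_abs, Pi.abs_apply,
        integral_mul_const]
  calc ∫ x, conv K f x * g x = ∫ x, ∫ y, K (x - y) * f y * g x := by
        simp only [conv, integral_mul_const]
    _ = ∫ y, ∫ x, K (x - y) * f y * g x := integral_integral_swap hint
    _ = ∫ x, f x * conv K g x := by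
        congr 1; ext y
        rw [conv, ← integral_const_mul]
        congr 1; ext x
        rw [← hKe (x - y)]; ring_nf

/-! ### Smoothing operators -/

/-- Smoothing kernels at scale `δ`. -/
structure IsSmoothing (j : ℝ → ℝ) (δ : ℝ) : Prop where
  smooth : Smooth j
  compact : HasCompactSupport j
  nonneg : ∀ x, 0 ≤ j x
  even : ∀ x, j (-x) = j x
  integral : ∫ x, j x = 1
  supp : ∀ x, j x ≠ 0 → |x| ≤ δ

lemma exists_smoothing {δ : ℝ} (hδ : 0 < δ) : ∃ j, IsSmoothing j δ := by
  let φ : ContDiffBump (0 : ℝ) := ⟨δ / 2, δ, by positivity, by linarith⟩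
  refine ⟨φ.normed volume, φ.contDiff_normed, φ.hasCompactSupport_normed, φ.nonneg_normed,
    φ.normed_neg, φ.integral_normed, fun x hx => ?_⟩
  have : x ∈ Function.support (φ.normed volume) := hx
  rw [φ.support_normed_eq] at this
  have h2 : |x| < δ := by simpa using this
  exact h2.le

namespace IsSmoothing

variable {j f : ℝ → ℝ} {δ : ℝ} (hj : IsSmoothing j δ)

include hj

lemma integrable : Integrable j volume :=
  hj.smooth.continuous.integrable_of_hasCompactSupport hj.compact

lemma measurable : Measurable j := hj.smooth.continuous.measurable

lemma mem (k : ℕ) : MemLp (𝒟 k j) 2 volume := by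
  refine (smooth_iter hj.smooth k).continuous.memLp_of_hasCompactSupport ?_
  rw [iteratedDeriv_eq_iterate]
  induction k with
  | zero => exact hj.compact
  | succ k ih => rw [Function.iterate_succ_apply']; exact ih.deriv

lemma hInf : HInf j := ⟨hj.smooth, hj.mem⟩

lemma mem2 : MemLp j 2 volume := hj.hInf.mem0

lemma compact_iter (k : ℕ) : HasCompactSupport (𝒟 k j) := by
  rw [iteratedDeriv_eq_iterate]
  induction k with
  | zero => exact hj.compact
  | succ k ih => rw [Function.iterate_succ_apply']; exact ih.deriv

lemma integrable_iter (k : ℕ) : Integrable (𝒟 k j) volume :=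
  (smooth_iter hj.smooth k).continuous.integrable_of_hasCompactSupport (hj.compact_iter k)

lemma integral_abs : ∫ x, |j x| = 1 := by
  simp only [abs_of_nonneg (hj.nonneg _), hj.integral]

/-- All derivatives fall on the compactly supported kernel, so smoothing is bounded from `L²` to
every `H^k`. This is what turns the smoothed equation into an ordinary differential equation in
`L²`. -/
lemma iter_conv_left (hf : MemLp f 2 volume) (k : ℕ) : 𝒟 k (conv j f) = conv (𝒟 k j) f := by
  induction k with
  | zero => simp
  | succ k ih =>
    have hloc : LocallyIntegrable f volume := hf.locallyIntegrable (by norm_num)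
    have e : ∀ K : ℝ → ℝ, conv K f =
        convolution f K (ContinuousLinearMap.mul ℝ ℝ) volume := fun K => by
      ext x; simp only [conv, convolution, ContinuousLinearMap.mul_apply', mul_comm]
    rw [iteratedDeriv_succ, ih, e, e]
    ext x
    rw [iteratedDeriv_succ]
    exact ((hj.compact_iter k).hasDerivAt_convolution_right _ hloc
      (smooth_le (n := 1) (smooth_iter hj.smooth k)) x).deriv

lemma hInf_conv (hf : MemLp f 2 volume) : HInf (conv j f) := by
  have hloc : LocallyIntegrable f volume := hf.locallyIntegrable (by norm_num)
  refine ⟨?_, fun k => ?_⟩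
  · have e : conv j f = convolution f j (ContinuousLinearMap.mul ℝ ℝ) volume := by
      ext x; simp only [conv, convolution, ContinuousLinearMap.mul_apply', mul_comm]
    rw [e]
    exact hj.compact.contDiff_convolution_right _ hloc hj.smooth
  · rw [hj.iter_conv_left hf]
    exact (memLp_conv (hj.integrable_iter k) (smooth_iter hj.smooth k).continuous.measurable hf).1

lemma hs_conv_le_l2 (hf : MemLp f 2 volume) (k : ℕ) :
    hs k (conv j f) ≤ (∫ x, |𝒟 k j x|) * l2 f := by
  rw [hs, hj.iter_conv_left hf]
  exact (memLp_conv (hj.integrable_iter k) (smooth_iter hj.smooth k).continuous.measurable hf).2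

lemma hs_conv_le (hf : HInf f) (k : ℕ) : hs k (conv j f) ≤ hs k f := by
  have := QKdV.hs_conv_le hj.integrable hj.measurable hf k
  rwa [hj.integral_abs, one_mul] at this

lemma Hn_conv_le (hf : HInf f) (k : ℕ) : Hn k (conv j f) ≤ Hn k f :=
  Real.sqrt_le_sqrt (Finset.sum_le_sum fun l _ =>
    pow_le_pow_left₀ (hs_nonneg _ _) (hj.hs_conv_le hf l) 2)

lemma conv_hInf (hf : HInf f) : HInf (conv j f) := hf.conv hj.integrable hj.measurable

lemma iter_conv (hf : HInf f) (k : ℕ) : 𝒟 k (conv j f) = conv j (𝒟 k f) :=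
  QKdV.iter_conv hj.integrable hj.measurable hf k

/-- The difference is an average of `f (x - z) - f x` over `|z| ≤ δ`, to which `l2_sub_translate_le`
applies. -/
lemma l2_conv_sub_le (hδ : 0 ≤ δ) (hf : HInf f) :
    l2 (fun x => conv j f x - f x) ≤ δ * hs 1 f := by
  have e : (fun x => conv j f x - f x) = fun x => ∫ z, j z * (f (x - z) - f x) := by
    ext x
    simp only [mul_sub]
    rw [integral_sub (integrable_kernel_mul hj.integrable hj.measurable hf x)
      (hj.integrable.mul_const _), integral_mul_const, hj.integral, one_mul, conv_comm]
  have hc := hf.continuous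
  have h := memLp_integral_of_forall hj.integrable hj.measurable
    (g := fun x z => f (x - z) - f x) (B := δ * hs 1 f) (by
      have : Continuous fun p : ℝ × ℝ => f (p.1 - p.2) - f p.1 := by fun_prop
      exact this.measurable) (mul_nonneg hδ (hs_nonneg _ _)) fun z hz => by
      refine (l2_sub_translate_le hf z).trans (ENNReal.ofReal_le_ofReal ?_)
      have := mul_le_mul_of_nonneg_right (hj.supp z hz) (hs_nonneg 1 f)
      exact pow_le_pow_left₀ (mul_nonneg (abs_nonneg _) (hs_nonneg _ _)) this 2
  rw [e]
  simpa [hj.integral_abs] using h.2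

lemma hs_conv_sub_le (hδ : 0 ≤ δ) (hf : HInf f) (k : ℕ) :
    hs k (fun x => conv j f x - f x) ≤ δ * hs (k + 1) f := by
  rw [hs, iter_sub (hj.conv_hInf hf).smooth hf.smooth, hj.iter_conv hf]
  have := hj.l2_conv_sub_le hδ (hf.iter k)
  rwa [hs_iter, add_comm 1 k] at this

lemma integral_conv_mul {g : ℝ → ℝ} (hf : MemLp f 2 volume) (hg : MemLp g 2 volume) :
    ∫ x, conv j f x * g x = ∫ x, f x * conv j g x :=
  QKdV.integral_conv_mul hj.integrable hj.measurable hj.mem2 hj.even hf hg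

end IsSmoothing

/-! ### Limits -/

/-- A sequence that is Cauchy in all `H^k` converges in all `H^k`, with the same rates. -/
lemma exists_hInf_limit {f : ℕ → ℝ → ℝ} (hf : ∀ n, HInf (f n))
    (hc : ∀ k : ℕ, ∀ ε > 0, ∃ N, ∀ m ≥ N, ∀ n ≥ N, hs k (fun x => f m x - f n x) ≤ ε) :
    ∃ g, HInf g ∧ (∀ k x, Tendsto (fun n => 𝒟 k (f n) x) atTop (𝓝 (𝒟 k g x))) ∧
      ∀ (k n : ℕ) (ε : ℝ), 0 ≤ ε → (∀ᶠ m in atTop, hs k (fun x => f n x - f m x) ≤ ε) →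
        hs k (fun x => f n x - g x) ≤ ε := by
  -- The embedding into bounded functions costs one derivative, which is free here since all orders
  -- are assumed Cauchy.
  have hu : ∀ k, UniformCauchySeqOn (fun n => 𝒟 k (f n)) atTop univ := by
    intro k
    rw [Metric.uniformCauchySeqOn_iff]
    intro ε hε
    obtain ⟨N1, h1⟩ := hc k (ε / 3) (by positivity)
    obtain ⟨N2, h2⟩ := hc (k + 1) (ε / 3) (by positivity)
    refine ⟨max N1 N2, fun m hm n hn x _ => ?_⟩
    have h3 := abs_iter_le_hs ((hf m).sub (hf n)) k x
    rw [iter_sub (hf m).smooth (hf n).smooth] at h3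
    have h4 := h1 m (le_of_max_le_left hm) n (le_of_max_le_left hn)
    have h5 := h2 m (le_of_max_le_right hm) n (le_of_max_le_right hn)
    rw [Real.dist_eq]; linarith
  have hlim : ∀ k x, ∃ y, Tendsto (fun n => 𝒟 k (f n) x) atTop (𝓝 y) := fun k x =>
    cauchySeq_tendsto_of_complete ((hu k).cauchySeq (mem_univ x))
  choose G hG using hlim
  have hunif : ∀ k, TendstoUniformly (fun n => 𝒟 k (f n)) (G k) atTop := fun k => by
    rw [← tendstoUniformlyOn_univ]
    exact (hu k).tendstoUniformlyOn_of_tendsto fun x _ => hG k x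
  have hder : ∀ k x, HasDerivAt (G k) (G (k + 1) x) x := fun k x =>
    hasDerivAt_of_tendstoUniformly (hunif (k + 1))
      (Eventually.of_forall fun n x => (hf n).hasDerivAt k x) (hG k) x
  have hiter : ∀ k, 𝒟 k (G 0) = G k := by
    intro k
    induction k with
    | zero => simp
    | succ k ih => rw [iteratedDeriv_succ, ih]; ext x; exact (hder k x).deriv
  have hsm : Smooth (G 0) := contDiff_of_differentiable_iteratedDeriv fun m _ => by
    rw [hiter]; exact fun x => (hder m x).differentiableAt
  -- Fatou's lemma turns pointwise convergence into bounds for the `L²` distance to the limit, with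
  -- the same constant as for the sequence.
  have hbound : ∀ (k n : ℕ) (ε : ℝ), 0 ≤ ε →
      (∀ᶠ m in atTop, hs k (fun x => f n x - f m x) ≤ ε) →
      eLpNorm (fun x => 𝒟 k (f n) x - G k x) 2 volume ≤ ENNReal.ofReal ε := by
    intro k n ε hε h
    have h1 := Lp.eLpNorm_lim_le_liminf_eLpNorm (p := 2) (μ := volume)
      (f := fun m x => 𝒟 k (f n) x - 𝒟 k (f m) x)
      (fun m => (((hf n).mem k).sub ((hf m).mem k)).1) (fun x => 𝒟 k (f n) x - G k x)
      (ae_of_all _ fun x => tendsto_const_nhds.sub (hG k x))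
    refine h1.trans ?_
    refine (Filter.liminf_le_liminf (v := fun _ => ENNReal.ofReal ε) ?_).trans
      (le_of_eq (liminf_const _))
    filter_upwards [h] with m hm
    rw [hs, iter_sub (hf n).smooth (hf m).smooth, l2] at hm
    exact (ENNReal.le_ofReal_iff_toReal_le (((hf n).mem k).sub ((hf m).mem k)).2.ne hε).2 hm
  have hmem : ∀ k, MemLp (G k) 2 volume := by
    intro k
    obtain ⟨N, hN⟩ := hc k 1 one_pos
    have h1 := hbound k N 1 zero_le_one
      ((eventually_ge_atTop N).mono fun m hm => hN N le_rfl m hm)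
    have h2 : MemLp (fun x => 𝒟 k (f N) x - G k x) 2 volume := by
      refine ⟨?_, h1.trans_lt ENNReal.ofReal_lt_top⟩
      refine ((hf N).iter k).continuous.aestronglyMeasurable.sub ?_
      rw [← hiter]; exact (smooth_iter hsm k).continuous.aestronglyMeasurable
    have h3 := ((hf N).mem k).sub h2
    refine (memLp_congr_ae (ae_of_all _ fun x => ?_)).1 h3
    simp
  have hGH : HInf (G 0) := ⟨hsm, fun k => by rw [hiter]; exact hmem k⟩
  refine ⟨G 0, hGH, fun k x => by rw [hiter]; exact hG k x, fun k n ε hε h => ?_⟩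
  rw [hs, iter_sub (hf n).smooth hsm, hiter]
  exact ENNReal.toReal_le_of_le_ofReal hε (hbound k n ε hε h)

/-! ### Calculus in `L²` -/

open Classical in
/-- The class in `L²(ℝ)` of a square integrable function. -/
def toL2 (f : ℝ → ℝ) : Lp ℝ 2 (volume : Measure ℝ) :=
  if h : MemLp f 2 volume then h.toLp f else 0

lemma toL2_eq {f : ℝ → ℝ} (hf : MemLp f 2 volume) : toL2 f = hf.toLp f := dif_pos hf

lemma norm_toL2 {f : ℝ → ℝ} (hf : MemLp f 2 volume) : ‖toL2 f‖ = l2 f := by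
  rw [toL2_eq hf, l2_eq_norm hf]

lemma inner_toL2 {f g : ℝ → ℝ} (hf : MemLp f 2 volume) (hg : MemLp g 2 volume) :
    inner ℝ (toL2 f) (toL2 g) = ∫ x, f x * g x := by
  rw [toL2_eq hf, toL2_eq hg, real_inner_comm, integral_mul_eq_inner hf hg]

lemma toL2_sub {f g : ℝ → ℝ} (hf : MemLp f 2 volume) (hg : MemLp g 2 volume) :
    toL2 (fun x => f x - g x) = toL2 f - toL2 g := by
  rw [toL2_eq hf, toL2_eq hg, toL2_eq (f := fun x => f x - g x) (hf.sub hg)]; rfl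

lemma toL2_const_mul {f : ℝ → ℝ} (hf : MemLp f 2 volume) (c : ℝ) :
    toL2 (fun x => c * f x) = c • toL2 f := by
  rw [toL2_eq hf, toL2_eq (f := fun x => c * f x) (hf.const_mul c)]; rfl

lemma toL2_coe (f : Lp ℝ 2 (volume : Measure ℝ)) : toL2 f = f := by
  rw [toL2_eq (Lp.memLp f), Lp.toLp_coeFn]

lemma hasDerivWithinAt_toL2_iff {A : ℝ → ℝ → ℝ} {A' : ℝ → ℝ} {S : Set ℝ} {t : ℝ}
    (hA : ∀ τ ∈ S, MemLp (A τ) 2 volume) (ht : t ∈ S) (hA' : MemLp A' 2 volume) :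
    HasDerivWithinAt (fun τ => toL2 (A τ)) (toL2 A') S t ↔ ∀ c > 0, ∀ᶠ τ in 𝓝[S] t,
      l2 (fun x => A τ x - A t x - (τ - t) * A' x) ≤ c * |τ - t| := by
  rw [hasDerivWithinAt_iff_isLittleO, Asymptotics.isLittleO_iff]
  refine forall₂_congr fun c _ => ?_
  have : ∀ τ ∈ S, ‖toL2 (A τ) - toL2 (A t) - (τ - t) • toL2 A'‖ =
      l2 (fun x => A τ x - A t x - (τ - t) * A' x) := fun τ hτ => by
    have h1 : MemLp (fun x => A τ x - A t x) 2 volume := (hA τ hτ).sub (hA t ht)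
    have h2 := hA'.const_mul (τ - t)
    rw [← toL2_sub (hA τ hτ) (hA t ht), ← toL2_const_mul hA', ← toL2_sub h1 h2,
      norm_toL2 (f := fun x => A τ x - A t x - (τ - t) * A' x) (h1.sub h2)]
  constructor <;> intro h <;> filter_upwards [h, self_mem_nhdsWithin] with τ h1 h2
  · rw [← this τ h2]; simpa using h1
  · rw [this τ h2]; simpa using h1

/-! ### Differentiability in time with values in all `H^k` -/

/-- `g` is the time derivative of `u` on `[0, T]`, with convergence of the difference quotients in
all `H^k`. -/
structure IsC1 (T : ℝ) (u g : ℝ → ℝ → ℝ) : Prop where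
  left : ∀ t ∈ Icc 0 T, HInf (u t)
  right : ∀ t ∈ Icc 0 T, HInf (g t)
  deriv : ∀ k : ℕ, ∀ t ∈ Icc 0 T, ∀ c > 0, ∀ᶠ τ in 𝓝[Icc 0 T] t,
    hs k (fun x => u τ x - u t x - (τ - t) * g t x) ≤ c * |τ - t|

/-- Continuity in time with values in all `H^k`. -/
def IsC0 (T : ℝ) (u : ℝ → ℝ → ℝ) : Prop :=
  ∀ k : ℕ, ∀ t ∈ Icc 0 T, Tendsto (fun τ => hs k (fun x => u τ x - u t x)) (𝓝[Icc 0 T] t) (𝓝 0)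

namespace IsC1

variable {T : ℝ} {u g w h : ℝ → ℝ → ℝ}

lemma toL2_hasDeriv (hu : IsC1 T u g) (k : ℕ) {t : ℝ} (ht : t ∈ Icc 0 T) :
    HasDerivWithinAt (fun τ => toL2 (𝒟 k (u τ))) (toL2 (𝒟 k (g t))) (Icc 0 T) t := by
  refine (hasDerivWithinAt_toL2_iff (fun τ hτ => (hu.left τ hτ).mem k) ht
    ((hu.right t ht).mem k)).2 fun c hc => ?_
  filter_upwards [hu.deriv k t ht c hc, self_mem_nhdsWithin] with τ h1 h2
  rw [hs, iter_sub ((hu.left τ h2).sub (hu.left t ht)).smooth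
    ((hu.right t ht).const_mul _).smooth, iter_sub (hu.left τ h2).smooth (hu.left t ht).smooth,
    iter_const_mul] at h1
  exact h1

lemma sub (hu : IsC1 T u g) (hw : IsC1 T w h) :
    IsC1 T (fun t x => u t x - w t x) (fun t x => g t x - h t x) where
  left t ht := (hu.left t ht).sub (hw.left t ht)
  right t ht := (hu.right t ht).sub (hw.right t ht)
  deriv k t ht c hc := by
    filter_upwards [hu.deriv k t ht (c / 2) (by positivity), hw.deriv k t ht (c / 2) (by positivity),
      self_mem_nhdsWithin] with τ h1 h2 h3
    have e : (fun x => u τ x - w τ x - (u t x - w t x) - (τ - t) * (g t x - h t x)) = fun x =>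
        (u τ x - u t x - (τ - t) * g t x) - (w τ x - w t x - (τ - t) * h t x) := by
      ext x; ring
    rw [e]
    refine (hs_sub_le k (((hu.left τ h3).sub (hu.left t ht)).sub ((hu.right t ht).const_mul _))
      (((hw.left τ h3).sub (hw.left t ht)).sub ((hw.right t ht).const_mul _))).trans ?_
    linarith

lemma hasDeriv_apply (hu : IsC1 T u g) {t : ℝ} (ht : t ∈ Icc 0 T) (x : ℝ) :
    HasDerivWithinAt (fun τ => u τ x) (g t x) (Icc 0 T) t := by
  rw [hasDerivWithinAt_iff_isLittleO, Asymptotics.isLittleO_iff]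
  intro c hc
  filter_upwards [hu.deriv 0 t ht (c / 2) (by positivity), hu.deriv 1 t ht (c / 2) (by positivity),
    self_mem_nhdsWithin] with τ h0 h1 hτ
  have h2 := abs_le_hs (((hu.left τ hτ).sub (hu.left t ht)).sub ((hu.right t ht).const_mul (τ - t))) x
  rw [Real.norm_eq_abs, Real.norm_eq_abs, smul_eq_mul]
  linarith

lemma hs_sq_hasDeriv (hu : IsC1 T u g) (k : ℕ) {t : ℝ} (ht : t ∈ Icc 0 T) :
    HasDerivWithinAt (fun τ => hs k (u τ) ^ 2) (2 * ∫ x, 𝒟 k (u t) x * 𝒟 k (g t) x) (Icc 0 T) t := by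
  have h1 := (hu.toL2_hasDeriv k ht).inner ℝ (hu.toL2_hasDeriv k ht)
  rw [real_inner_comm, ← two_mul, real_inner_comm,
    inner_toL2 ((hu.left t ht).mem k) ((hu.right t ht).mem k)] at h1
  refine h1.congr_of_mem (fun τ hτ => ?_) ht
  rw [real_inner_self_eq_norm_sq, norm_toL2 ((hu.left τ hτ).mem k), hs]

lemma isC0 (hu : IsC1 T u g) : IsC0 T u := by
  intro k t ht
  have h1 := (hu.toL2_hasDeriv k ht).continuousWithinAt
  have h2 := (tendsto_iff_norm_sub_tendsto_zero.1 h1)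
  refine h2.congr' ?_
  filter_upwards [self_mem_nhdsWithin] with τ hτ
  rw [← toL2_sub ((hu.left τ hτ).mem k) ((hu.left t ht).mem k), norm_toL2, hs,
    iter_sub (hu.left τ hτ).smooth (hu.left t ht).smooth]
  exact ((hu.left τ hτ).mem k).sub ((hu.left t ht).mem k)

end IsC1

namespace IsC0

variable {T : ℝ} {u w : ℝ → ℝ → ℝ}

lemma continuousOn_hs (hu : IsC0 T u) (hH : ∀ t ∈ Icc 0 T, HInf (u t)) (k : ℕ) :
    ContinuousOn (fun t => hs k (u t)) (Icc 0 T) := by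
  intro t ht
  refine tendsto_iff_norm_sub_tendsto_zero.2 ?_
  refine squeeze_zero' (Eventually.of_forall fun _ => norm_nonneg _) ?_ (hu k t ht)
  filter_upwards [self_mem_nhdsWithin] with τ hτ
  exact abs_hs_sub_le k (hH τ hτ) (hH t ht)

lemma continuousOn_Hn (hu : IsC0 T u) (hH : ∀ t ∈ Icc 0 T, HInf (u t)) (k : ℕ) :
    ContinuousOn (fun t => Hn k (u t)) (Icc 0 T) := by
  unfold Hn
  exact (continuousOn_finsetSum _ fun l _ => (hu.continuousOn_hs hH l).pow 2).sqrt

lemma exists_bound (hu : IsC0 T u) (hH : ∀ t ∈ Icc 0 T, HInf (u t)) (k : ℕ) :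
    ∃ B, ∀ t ∈ Icc 0 T, Hn k (u t) ≤ B := by
  obtain ⟨B, hB⟩ := isCompact_Icc.exists_bound_of_continuousOn (hu.continuousOn_Hn hH k)
  exact ⟨B, fun t ht => (le_abs_self _).trans (hB t ht)⟩

lemma continuousOn_apply (hu : IsC0 T u) (hH : ∀ t ∈ Icc 0 T, HInf (u t)) (k : ℕ) (x : ℝ) :
    ContinuousOn (fun t => 𝒟 k (u t) x) (Icc 0 T) := by
  intro t ht
  refine tendsto_iff_norm_sub_tendsto_zero.2 ?_
  have h1 := (hu k t ht).add (hu (k + 1) t ht)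
  rw [add_zero] at h1
  refine squeeze_zero' (Eventually.of_forall fun _ => norm_nonneg _) ?_ h1
  filter_upwards [self_mem_nhdsWithin] with τ hτ
  have := abs_iter_le_hs ((hH τ hτ).sub (hH t ht)) k x
  rwa [iter_sub (hH τ hτ).smooth (hH t ht).smooth] at this

end IsC0

/-- Composition with a differential polynomial preserves continuity in time. -/
lemma DP.isC0 {n m : ℕ} {r : (ℝ → ℝ) → ℝ → ℝ} (hr : DP 1 n m r) {T : ℝ} {u : ℝ → ℝ → ℝ}
    (hu : IsC0 T u) (hH : ∀ t ∈ Icc 0 T, HInf (u t)) : IsC0 T (fun t => r (u t)) := by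
  intro k t ht
  obtain ⟨B, hB⟩ := hu.exists_bound hH (m + k + 1)
  obtain ⟨C, hC0, hC⟩ := hr.lipschitz_hs k B
  have h1 : Tendsto (fun τ => C * Hn (m + k) (fun x => u τ x - u t x)) (𝓝[Icc 0 T] t) (𝓝 0) := by
    have h2 : Tendsto (fun τ => ∑ l ∈ Finset.range (m + k + 1), hs l (fun x => u τ x - u t x) ^ 2)
        (𝓝[Icc 0 T] t) (𝓝 (∑ l ∈ Finset.range (m + k + 1), (0 : ℝ) ^ 2)) :=
      tendsto_finsetSum _ fun l _ => (hu l t ht).pow 2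
    simpa [Hn] using h2.sqrt.const_mul C
  refine squeeze_zero' (Eventually.of_forall fun _ => hs_nonneg _ _) ?_ h1
  filter_upwards [self_mem_nhdsWithin] with τ hτ
  exact hC _ _ (hH τ hτ) (hH t ht) (hB τ hτ) (hB t ht)

/-! ### From pointwise to norm derivatives -/

section Regularity

variable {T : ℝ} {u g : ℝ → ℝ → ℝ} (hu : ∀ t ∈ Icc 0 T, HInf (u t))
  (hg : ∀ t ∈ Icc 0 T, HInf (g t)) (hc : IsC0 T g)
  (hd : ∀ t ∈ Icc 0 T, ∀ x, HasDerivWithinAt (fun τ => u τ x) (g t x) (Icc 0 T) t)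

-- Clamping the time to `[0, T]` gives an integrand that is continuous on all of `ℝ`, so the
-- differentiation of parameter integrals needs no one-sided care.
include hg hc in
lemma continuous_clamp (hT : 0 ≤ T) (k : ℕ) (x : ℝ) :
    Continuous fun s => 𝒟 k (g (projIcc 0 T hT s)) x := by
  have h1 := (hc.continuousOn_apply hg k x).domRestrict
  exact h1.comp (continuous_projIcc (h := hT))

-- The case `k = 0` is the fundamental theorem of calculus in time. Higher orders follow by
-- differentiating both sides in `x`, so the time derivative of `∂ᵏu` need not be known beforehand.
include hu hg hc hd in
lemma iter_sub_eq_integral (hT : 0 ≤ T) {t τ : ℝ} (ht : t ∈ Icc 0 T) (hτ : τ ∈ Icc 0 T) (k : ℕ)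
    (x : ℝ) : 𝒟 k (u τ) x - 𝒟 k (u t) x = ∫ s in t..τ, 𝒟 k (g (projIcc 0 T hT s)) x := by
  have hsub : uIcc t τ ⊆ Icc 0 T := uIcc_subset_Icc ht hτ
  induction k generalizing x with
  | zero =>
    have h2 : ∀ s ∈ uIcc t τ, (g (projIcc 0 T hT s)) x = g s x := fun s hs => by
      rw [projIcc_of_mem hT (hsub hs)]
    simp only [iteratedDeriv_zero]
    rw [intervalIntegral.integral_congr h2]
    have hcont : ContinuousOn (fun s => u s x) (uIcc t τ) := fun s hs =>
      (hd s (hsub hs) x).continuousWithinAt.mono hsub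
    have hint : IntervalIntegrable (fun s => g s x) volume t τ := by
      refine ContinuousOn.intervalIntegrable ?_
      simpa using (hc.continuousOn_apply hg 0 x).mono hsub
    refine (intervalIntegral.integral_eq_sub_of_hasDeriv_right hcont (fun s hs => ?_) hint).symm
    have hs1 : s ∈ Icc 0 T := hsub ⟨hs.1.le, hs.2.le⟩
    have hs2 : s < T := by
      have := hs.2
      have h3 : max t τ ≤ T := max_le ht.2 hτ.2
      linarith
    refine ((hd s hs1 x).mono_of_mem_nhdsWithin ?_)
    exact mem_of_superset (Ioo_mem_nhdsGT hs2) fun y hy => ⟨hs1.1.trans hy.1.le, hy.2.le⟩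
  | succ k ih =>
    obtain ⟨B, hB⟩ := hc.exists_bound hg (k + 2)
    have h1 : HasDerivAt (fun y => 𝒟 k (u τ) y - 𝒟 k (u t) y)
        (𝒟 (k + 1) (u τ) x - 𝒟 (k + 1) (u t) x) x :=
      ((hu τ hτ).hasDerivAt k x).sub ((hu t ht).hasDerivAt k x)
    have h2 := (intervalIntegral.hasDerivAt_integral_of_dominated_loc_of_deriv_le (𝕜 := ℝ)
      (μ := volume) (a := t) (b := τ) (F := fun y s => 𝒟 k (g (projIcc 0 T hT s)) y)
      (F' := fun y s => 𝒟 (k + 1) (g (projIcc 0 T hT s)) y) (bound := fun _ => 2 * B)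
      (x₀ := x) (s := univ) univ_mem
      (Eventually.of_forall fun y => (continuous_clamp hg hc hT k y).aestronglyMeasurable)
      ((continuous_clamp hg hc hT k x).intervalIntegrable _ _)
      (continuous_clamp hg hc hT (k + 1) x).aestronglyMeasurable
      (ae_of_all _ fun s _ y _ => ?_) intervalIntegrable_const
      (ae_of_all _ fun s _ y _ => (hg _ (projIcc 0 T hT s).2).hasDerivAt k y)).2
    · refine h1.unique (h2.congr_of_eventuallyEq (Eventually.of_forall fun y => ?_))
      exact ih y
    · have h3 := abs_iter_le_Hn (hg _ (projIcc 0 T hT s).2) (show k + 1 + 1 ≤ k + 2 by omega) y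
      have h4 := hB _ (projIcc 0 T hT s).2
      rw [Real.norm_eq_abs]; linarith

include hu hg hc hd in
/-- A pointwise time derivative that is continuous in all `H^k` is a derivative in all `H^k`. -/
lemma isC1_of_pointwise : IsC1 T u g where
  left := hu
  right := hg
  deriv k t ht c hpos := by
    have hT : 0 ≤ T := ht.1.trans ht.2
    have h0 : ∀ᶠ τ in 𝓝[Icc 0 T] t, hs k (fun x => g τ x - g t x) < c := by
      exact (hc k t ht).eventually_lt_const hpos
    rw [eventually_nhdsWithin_iff] at h0 ⊢
    obtain ⟨r, hr, hball⟩ := Metric.eventually_nhds_iff_ball.1 h0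
    refine Metric.eventually_nhds_iff_ball.2 ⟨r, hr, fun τ hτr hτ => ?_⟩
    have hsub : uIcc t τ ⊆ Icc 0 T := uIcc_subset_Icc ht hτ
    -- The time integral is written as an integral against the density `1` on the interval between
    -- `t` and `τ`, of mass `|τ - t|`; `memLp_integral_of_forall` then bounds its `L²` norm by this
    -- mass times a uniform bound of the integrand.
    set K : ℝ → ℝ := (uIoc t τ).indicator fun _ => 1 with hK
    have hKm : Measurable K := measurable_const.indicator measurableSet_uIoc
    have hKi : Integrable K volume := by
      rw [hK, integrable_indicator_iff measurableSet_uIoc]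
      exact (intervalIntegrable_const (c := (1 : ℝ))).def'
    have hKint : ∫ z, |K z| = |τ - t| := by
      have e : (fun z => |K z|) = K := by
        ext z; exact abs_of_nonneg (indicator_nonneg (fun _ _ => zero_le_one) z)
      rw [e, hK, integral_indicator measurableSet_uIoc]
      rw [setIntegral_const, smul_eq_mul, mul_one, uIoc, measureReal_def, Real.volume_Ioc,
        max_sub_min_eq_abs, ENNReal.toReal_ofReal (abs_nonneg _)]
    set G : ℝ → ℝ → ℝ := fun x s => 𝒟 k (g (projIcc 0 T hT s)) x - 𝒟 k (g t) x with hG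
    have hGm : Measurable (Function.uncurry G) := by
      refine measurable_uncurry_of_continuous_of_measurable (fun s => ?_) fun x => ?_
      · exact ((hg _ (projIcc 0 T hT s).2).iter k).continuous.sub ((hg t ht).iter k).continuous
      · exact ((continuous_clamp hg hc hT k x).sub continuous_const).measurable
    have h1 := (memLp_integral_of_forall hKi hKm hGm hpos.le fun s hsK => by
      have hs1 : s ∈ uIoc t τ := by
        by_contra h; exact hsK (indicator_of_notMem h _)
      have hs2 : s ∈ Icc 0 T := hsub (uIoc_subset_uIcc hs1)
      have hs3 : s ∈ Metric.ball t r := by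
        rw [Metric.mem_ball, Real.dist_eq] at hτr ⊢
        exact (abs_sub_left_of_mem_uIcc (uIoc_subset_uIcc hs1)).trans_lt hτr
      have hs4 := hball s hs3 hs2
      have hmem := ((hg s hs2).mem k).sub ((hg t ht).mem k)
      simp only [hG, projIcc_of_mem hT hs2]
      rw [lintegral_sq_eq (f := fun x => 𝒟 k (g s) x - 𝒟 k (g t) x) hmem]
      refine ENNReal.ofReal_le_ofReal (pow_le_pow_left₀ (l2_nonneg _) ?_ 2)
      rw [hs, iter_sub (hg s hs2).smooth (hg t ht).smooth] at hs4
      exact hs4.le).2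
    rw [hKint, mul_comm] at h1
    refine le_trans (le_of_eq ?_) h1
    rw [hs, iter_sub ((hu τ hτ).sub (hu t ht)).smooth ((hg t ht).const_mul _).smooth,
      iter_sub (hu τ hτ).smooth (hu t ht).smooth, iter_const_mul]
    have e2 : ∀ x, 𝒟 k (u τ) x - 𝒟 k (u t) x - (τ - t) * 𝒟 k (g t) x = ∫ s in t..τ, G x s := by
      intro x
      rw [iter_sub_eq_integral hu hg hc hd hT ht hτ k x, hG,
        intervalIntegral.integral_sub ((continuous_clamp hg hc hT k x).intervalIntegrable _ _)
        intervalIntegrable_const]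
      simp
    have e3 : ∀ x, ∫ z, K z * G x z = ∫ z in uIoc t τ, G x z := fun x => by
      rw [← integral_indicator measurableSet_uIoc]
      congr 1; ext z
      by_cases hz : z ∈ uIoc t τ <;> simp [hK, hz]
    simp only [e2, e3]
    rcases le_total t τ with h | h
    · simp only [intervalIntegral.integral_of_le h, uIoc_of_le h]
    · simp only [intervalIntegral.integral_of_ge h, uIoc_of_ge h]
      exact l2_neg _

end Regularity

/-! ### Gronwall's inequality -/

/-- The function `E e^(-Ct) - K t` is nonincreasing, since `e^(-Ct) ≤ 1` and `K ≥ 0`. -/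
lemma gronwall {E E' : ℝ → ℝ} {T C K : ℝ} (hK : 0 ≤ K) (hC : 0 ≤ C)
    (hE : ∀ t ∈ Icc 0 T, HasDerivWithinAt E (E' t) (Icc 0 T) t)
    (h : ∀ t ∈ Icc 0 T, E' t ≤ C * E t + K) {t : ℝ} (ht : t ∈ Icc 0 T) :
    E t ≤ (E 0 + K * t) * Real.exp (C * t) := by
  set F : ℝ → ℝ := fun t => E t * Real.exp (-(C * t)) - K * t with hF
  have hd : ∀ s ∈ Icc 0 T, HasDerivWithinAt F (E' s * Real.exp (-(C * s)) +
      E s * (Real.exp (-(C * s)) * (-C)) - K) (Icc 0 T) s := fun s hs => by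
    have h1 : HasDerivAt (fun s => Real.exp (-(C * s))) (Real.exp (-(C * s)) * (-C)) s := by
      have : HasDerivAt (fun s => -(C * s)) (-C) s := by
        simpa using ((hasDerivAt_id s).const_mul C).fun_neg
      exact this.exp
    have h2 : HasDerivAt (fun s => K * s) K s := by simpa using (hasDerivAt_id s).const_mul K
    exact ((hE s hs).mul h1.hasDerivWithinAt).sub h2.hasDerivWithinAt
  have hanti : AntitoneOn F (Icc 0 T) := by
    refine antitoneOn_of_hasDerivWithinAt_nonpos (convex_Icc 0 T)
      (fun s hs => (hd s hs).continuousWithinAt)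
      (fun s hs => (hd s (interior_subset hs)).mono interior_subset) fun s hs => ?_
    have hs' := interior_subset hs
    have h3 := h s hs'
    have h4 : Real.exp (-(C * s)) ≤ 1 :=
      Real.exp_le_one_iff.2 (by have := mul_nonneg hC hs'.1; linarith)
    have h5 := Real.exp_pos (-(C * s))
    nlinarith
  have h6 := hanti ⟨le_rfl, ht.1.trans ht.2⟩ ht ht.1
  simp only [hF, mul_zero, neg_zero, Real.exp_zero, mul_one, sub_zero] at h6
  have h7 := Real.exp_pos (C * t)
  have h8 : E t * Real.exp (-(C * t)) ≤ E 0 + K * t := by linarith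
  have h9 := mul_le_mul_of_nonneg_right h8 h7.le
  rwa [mul_assoc, ← Real.exp_add, neg_add_cancel, Real.exp_zero, mul_one] at h9

/-! ### Derivatives of weighted energies -/

lemma BInf.taylor {φ : ℝ → ℝ} (hφ : BInf φ) :
    ∃ C, 0 ≤ C ∧ ∀ x y, |φ y - φ x - 𝒟 1 φ x * (y - x)| ≤ C * (y - x) ^ 2 := by
  obtain ⟨C, hC0, hC⟩ := (hφ.iter 1).lipschitz
  refine ⟨C, hC0, fun x y => ?_⟩
  have h := (convex_uIcc x y).norm_image_sub_le_of_norm_hasDerivWithin_le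
    (f := fun s => φ s - 𝒟 1 φ x * s) (f' := fun s => 𝒟 1 φ s - 𝒟 1 φ x) (C := C * |y - x|)
    (fun s _ => ?_) (fun s hs => ?_) left_mem_uIcc right_mem_uIcc
  · simp only [Real.norm_eq_abs] at h
    rw [← sq_abs (y - x), pow_two, ← mul_assoc]
    convert h using 2; ring
  · have h1 : HasDerivAt (fun s => 𝒟 1 φ x * s) (𝒟 1 φ x) s := by
      simpa using (hasDerivAt_id s).const_mul (𝒟 1 φ x)
    exact ((hφ.hasDerivAt0 s).sub h1).hasDerivWithinAt
  · refine (hC s x).trans (mul_le_mul_of_nonneg_left (abs_sub_left_of_mem_uIcc hs) hC0)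

lemma weighted_remainder_le {L C D' D M W q Δ h₁ h₂ : ℝ} (hL : 0 ≤ L) (hC : 0 ≤ C) (hD : 0 ≤ D)
    (hM : 0 ≤ M) (hW : 0 ≤ W) (hΔ : 0 ≤ Δ) (h1 : h₁ ≤ M * Δ)
    (h2 : h₂ ≤ q * Δ) (h3 : Δ ≤ q) :
    L * (M * Δ) * h₁ + C * (M * Δ) ^ 2 * W + D' * (2 * q * Δ) * W + D * h₂ ≤
      (L * M * M + C * M ^ 2 * W + 2 * D' * W + D) * (q * Δ) := by
  have a0 : Δ * Δ ≤ q * Δ := mul_le_mul_of_nonneg_right h3 hΔ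
  have a1 : L * (M * Δ) * h₁ ≤ L * M * M * (q * Δ) := by
    calc L * (M * Δ) * h₁ ≤ L * (M * Δ) * (M * Δ) := mul_le_mul_of_nonneg_left h1 (by positivity)
      _ = L * M * M * (Δ * Δ) := by ring
      _ ≤ _ := mul_le_mul_of_nonneg_left a0 (by positivity)
  have a2 : C * (M * Δ) ^ 2 * W ≤ C * M ^ 2 * W * (q * Δ) := by
    calc C * (M * Δ) ^ 2 * W = C * M ^ 2 * W * (Δ * Δ) := by ring
      _ ≤ _ := mul_le_mul_of_nonneg_left a0 (by positivity)
  have a3 : D * h₂ ≤ D * (q * Δ) := mul_le_mul_of_nonneg_left h2 hD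
  calc _ ≤ L * M * M * (q * Δ) + C * M ^ 2 * W * (q * Δ) + D' * (2 * q * Δ) * W + D * (q * Δ) := by
        linarith
    _ = _ := by ring

/-- The integral is the `L²` product of the curves `φ(u) ∂ˢu` and `∂ˢu`. Only the first needs an
argument: its difference quotient is controlled by a Taylor expansion of `φ`. -/
lemma IsC1.weighted_hasDeriv {T : ℝ} {u g : ℝ → ℝ → ℝ} (hu : IsC1 T u g) {φ : ℝ → ℝ}
    (hφ : BInf φ) (s : ℕ) {t : ℝ} (ht : t ∈ Icc 0 T) :
    HasDerivWithinAt (fun τ => ∫ x, φ (u τ x) * 𝒟 s (u τ) x * 𝒟 s (u τ) x)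
      (∫ x, (𝒟 1 φ (u t x) * g t x * 𝒟 s (u t) x + 2 * (φ (u t x) * 𝒟 s (g t) x)) * 𝒟 s (u t) x)
      (Icc 0 T) t := by
  have hφu : ∀ τ ∈ Icc 0 T, BInf fun x => φ (u τ x) := fun τ hτ => hφ.comp (hu.left τ hτ).bInf
  have hφu' : BInf fun x => 𝒟 1 φ (u t x) := (hφ.iter 1).comp (hu.left t ht).bInf
  have hA : ∀ τ ∈ Icc 0 T, HInf (fun x => φ (u τ x) * 𝒟 s (u τ) x) := fun τ hτ =>
    (hφu τ hτ).mul_hInf ((hu.left τ hτ).iter s)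
  have hA1 : HInf (fun x => 𝒟 1 φ (u t x) * g t x * 𝒟 s (u t) x) :=
    (hφu'.mul_hInf (hu.right t ht)).mul ((hu.left t ht).iter s)
  have hA2 : HInf (fun x => φ (u t x) * 𝒟 s (g t) x) :=
    (hφu t ht).mul_hInf ((hu.right t ht).iter s)
  have hA' := hA1.add hA2
  have hderA : HasDerivWithinAt (fun τ => toL2 (fun x => φ (u τ x) * 𝒟 s (u τ) x))
      (toL2 (fun x => 𝒟 1 φ (u t x) * g t x * 𝒟 s (u t) x + φ (u t x) * 𝒟 s (g t) x))
      (Icc 0 T) t := by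
    refine (hasDerivWithinAt_toL2_iff (fun τ hτ => (hA τ hτ).mem0) ht hA'.mem0).2 fun c hc => ?_
    obtain ⟨L, hL0, hL⟩ := hφ.lipschitz
    obtain ⟨C, hC0, hC⟩ := hφ.taylor
    obtain ⟨D, hD0, hD⟩ := hφ.bdd0
    obtain ⟨D', hD0', hD'⟩ := (hφ.iter 1).bdd0
    set W := hs s (u t)
    have hW : 0 ≤ W := hs_nonneg _ _
    -- Relative to `|τ - t|`, `M` bounds both the supremum of `u τ - u t` and the `L²` norm of its
    -- `s`-th derivative. Below, `A` adds up the coefficients of the four remainders, plus one for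
    -- positivity.
    set M := 3 + hs 0 (g t) + hs 1 (g t) + hs s (g t)
    have hg0 := hs_nonneg 0 (g t)
    have hg1 := hs_nonneg 1 (g t)
    have hgs := hs_nonneg s (g t)
    have hM : 0 ≤ M := by positivity
    set A := L * M * M + C * M ^ 2 * W + 2 * D' * W + D + 1
    have hA0 : 0 < A := by positivity
    have hc1 : 0 < min 1 (c / (2 * A)) := by positivity
    have hball : ∀ᶠ τ in 𝓝[Icc 0 T] t, |τ - t| ≤ c / (2 * A) := by
      refine eventually_nhdsWithin_of_eventually_nhds ?_
      exact (Metric.eventually_nhds_iff_ball.2 ⟨c / (2 * A), by positivity, fun y hy => by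
        rw [Metric.mem_ball, Real.dist_eq] at hy; exact hy.le⟩)
    filter_upwards [hu.deriv 0 t ht _ hc1, hu.deriv 1 t ht _ hc1, hu.deriv s t ht _ hc1, hball,
      self_mem_nhdsWithin] with τ h0 h1 h2 h3 hτ
    have hm1 := min_le_left 1 (c / (2 * A))
    have hm2 := min_le_right 1 (c / (2 * A))
    have hΔ := abs_nonneg (τ - t)
    have hdH := (hu.left τ hτ).sub (hu.left t ht)
    have heH := hdH.sub ((hu.right t ht).const_mul (τ - t))
    set d := fun x => u τ x - u t x
    set e := fun x => u τ x - u t x - (τ - t) * g t x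
    have hde : ∀ k, hs k d ≤ hs k e + |τ - t| * hs k (g t) := fun k => by
      have := hs_add_le k heH ((hu.right t ht).const_mul (τ - t))
      rw [hs_const_mul] at this
      refine le_trans (le_of_eq ?_) this
      congr 1; ext x; simp only [d]; ring
    have hd0 := hde 0
    have hd1 := hde 1
    have hds := hde s
    have hsup : ∀ x, |d x| ≤ M * |τ - t| := fun x => by
      have := abs_le_hs hdH x
      calc |d x| ≤ hs 0 d + hs 1 d := this
        _ ≤ (1 * |τ - t| + |τ - t| * hs 0 (g t)) + (1 * |τ - t| + |τ - t| * hs 1 (g t)) :=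
          add_le_add (hd0.trans (by gcongr; exact h0.trans (by gcongr)))
            (hd1.trans (by gcongr; exact h1.trans (by gcongr)))
        _ ≤ M * |τ - t| := by
          have := mul_nonneg hgs hΔ
          simp only [M]; linarith
    have hsupe : ∀ x, |e x| ≤ 2 * (c / (2 * A)) * |τ - t| := fun x => by
      refine (abs_le_hs heH x).trans ?_
      rw [mul_assoc, two_mul]
      exact add_le_add (h0.trans (by gcongr)) (h1.trans (by gcongr))
    have hdsM : hs s d ≤ M * |τ - t| := by
      calc hs s d ≤ 1 * |τ - t| + |τ - t| * hs s (g t) :=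
            hds.trans (by gcongr; exact h2.trans (by gcongr))
        _ ≤ M * |τ - t| := by
          have := mul_nonneg hg0 hΔ
          have := mul_nonneg hg1 hΔ
          simp only [M]; linarith
    have hdi : 𝒟 s d = fun x => 𝒟 s (u τ) x - 𝒟 s (u t) x :=
      iter_sub (hu.left τ hτ).smooth (hu.left t ht).smooth s
    have hei : 𝒟 s e = fun x => 𝒟 s (u τ) x - 𝒟 s (u t) x - (τ - t) * 𝒟 s (g t) x := by
      have := iter_sub hdH.smooth ((hu.right t ht).const_mul (τ - t)).smooth s
      rw [hdi, iter_const_mul] at this; exact this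
    have hwt := (hu.left t ht).mem s
    have hcφ : ∀ τ ∈ Icc 0 T, Continuous fun x => φ (u τ x) := fun τ hτ => (hφu τ hτ).smooth.continuous
    have hct := (hu.left t ht).continuous
    have hcτ := (hu.left τ hτ).continuous
    have hcg := (hu.right t ht).continuous
    have hcφ' := hφu'.smooth.continuous
    have b1 : ∀ x, |φ (u τ x) - φ (u t x)| ≤ L * (M * |τ - t|) := fun x =>
      (hL _ _).trans (mul_le_mul_of_nonneg_left (hsup x) hL0)
    have b2 : ∀ x, |φ (u τ x) - φ (u t x) - 𝒟 1 φ (u t x) * (u τ x - u t x)| ≤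
        C * (M * |τ - t|) ^ 2 := fun x => by
      refine (hC _ _).trans (mul_le_mul_of_nonneg_left ?_ hC0)
      rw [← sq_abs (u τ x - u t x)]
      exact pow_le_pow_left₀ (abs_nonneg _) (hsup x) 2
    have b3 : ∀ x, |𝒟 1 φ (u t x) * e x| ≤ D' * (2 * (c / (2 * A)) * |τ - t|) := fun x => by
      rw [abs_mul]; exact mul_le_mul (hD' _) (hsupe x) (abs_nonneg _) hD0'
    have m1 := memLp_bdd_mul ((hcφ τ hτ).sub (hcφ t ht)).aestronglyMeasurable (hdH.mem s) b1
    have m2 := memLp_bdd_mul (((hcφ τ hτ).sub (hcφ t ht)).sub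
      (hcφ'.mul (hcτ.sub hct))).aestronglyMeasurable hwt b2
    have m3 := memLp_bdd_mul (hcφ'.mul heH.continuous).aestronglyMeasurable hwt b3
    have m4 := memLp_bdd_mul (hcφ t ht).aestronglyMeasurable (heH.mem s) fun x => hD (u t x)
    have l1 := l2_bdd_mul_le (hdH.mem s) b1
    have l2' := l2_bdd_mul_le hwt b2
    have l3 := l2_bdd_mul_le hwt b3
    have l4 := l2_bdd_mul_le (b := fun x => φ (u t x)) (heH.mem s) fun x => hD (u t x)
    -- Four remainders: the increment of `φ` against the increment of `∂ˢu`, the Taylor remainder of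
    -- `φ`, the linearization error of `u` inside `φ`, and that of `∂ˢu`.
    have hsplit : (fun x => φ (u τ x) * 𝒟 s (u τ) x - φ (u t x) * 𝒟 s (u t) x - (τ - t) *
        (𝒟 1 φ (u t x) * g t x * 𝒟 s (u t) x + φ (u t x) * 𝒟 s (g t) x)) = fun x =>
        (φ (u τ x) - φ (u t x)) * 𝒟 s d x + (φ (u τ x) - φ (u t x) -
          𝒟 1 φ (u t x) * (u τ x - u t x)) * 𝒟 s (u t) x +
        𝒟 1 φ (u t x) * e x * 𝒟 s (u t) x + φ (u t x) * 𝒟 s e x := by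
      ext x; rw [hdi, hei]; simp only [e]; ring
    rw [hsplit]
    have t1 := l2_add_le ((m1.add m2).add m3) m4
    have t2 := l2_add_le (m1.add m2) m3
    have t3 := l2_add_le m1 m2
    have hfin : L * (M * |τ - t|) * hs s d + C * (M * |τ - t|) ^ 2 * W +
        D' * (2 * (c / (2 * A)) * |τ - t|) * W + D * hs s e ≤ c * |τ - t| := by
      have hq : 0 ≤ c / (2 * A) := by positivity
      have hqA : 2 * (A * (c / (2 * A))) = c := by field_simp
      have h5 := weighted_remainder_le (D' := D') hL0 hC0 hD0 hM hW hΔ hdsM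
        (h2.trans (mul_le_mul_of_nonneg_right hm2 hΔ)) h3
      refine h5.trans ?_
      rw [← mul_assoc]
      refine mul_le_mul_of_nonneg_right ?_ hΔ
      have h6 : 0 ≤ A * (c / (2 * A)) := by positivity
      have h7 : (L * M * M + C * M ^ 2 * W + 2 * D' * W + D) * (c / (2 * A)) ≤ A * (c / (2 * A)) :=
        mul_le_mul_of_nonneg_right (by simp only [A]; linarith) hq
      linarith
    have l1' := l1
    change _ ≤ L * (M * |τ - t|) * hs s d at l1'
    change _ ≤ D * hs s e at l4
    refine t1.trans (le_trans ?_ hfin)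
    refine add_le_add (t2.trans (add_le_add (t3.trans (add_le_add l1' l2')) l3)) l4
  have h1 := hderA.inner ℝ (hu.toL2_hasDeriv s ht)
  have hval : inner ℝ (toL2 (fun x => φ (u t x) * 𝒟 s (u t) x)) (toL2 (𝒟 s (g t))) +
      inner ℝ (toL2 (fun x => 𝒟 1 φ (u t x) * g t x * 𝒟 s (u t) x + φ (u t x) * 𝒟 s (g t) x))
        (toL2 (𝒟 s (u t))) = ∫ x, (𝒟 1 φ (u t x) * g t x * 𝒟 s (u t) x +
          2 * (φ (u t x) * 𝒟 s (g t) x)) * 𝒟 s (u t) x := by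
    rw [inner_toL2 (hA t ht).mem0 ((hu.right t ht).mem s), inner_toL2 hA'.mem0
      ((hu.left t ht).mem s), ← integral_add (integrable_mul (hA t ht).mem0 ((hu.right t ht).mem s))
      (integrable_mul hA'.mem0 ((hu.left t ht).mem s))]
    congr 1; ext x; ring
  rw [hval] at h1
  refine h1.congr_of_mem (fun τ hτ => ?_) ht
  rw [inner_toL2 (hA τ hτ).mem0 ((hu.left τ hτ).mem s)]

/-! ### Parabolic energy estimates -/

/-- The scalar product of `L² ∩ H^k` given by `⟨f, g⟩ + ⟨∂ᵏ f, ∂ᵏ g⟩`. -/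
def pair (k : ℕ) (f g : ℝ → ℝ) : ℝ := (∫ x, f x * g x) + ∫ x, 𝒟 k f x * 𝒟 k g x

/-- The square of the norm attached to `pair`. -/
def eng (k : ℕ) (f : ℝ → ℝ) : ℝ := hs 0 f ^ 2 + hs k f ^ 2

lemma eng_nonneg (k : ℕ) (f : ℝ → ℝ) : 0 ≤ eng k f := by unfold eng; positivity

lemma abs_pair_le (k : ℕ) {f g : ℝ → ℝ} (hf : HInf f) (hg : HInf g) :
    |pair k f g| ≤ hs 0 f * hs 0 g + hs k f * hs k g := by
  refine (abs_add_le _ _).trans (add_le_add ?_ (abs_integral_mul_le (hf.mem k) (hg.mem k)))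
  rw [hs_zero, hs_zero]; exact abs_integral_mul_le hf.mem0 hg.mem0

lemma pair_add (k : ℕ) {f g h : ℝ → ℝ} (hf : HInf f) (hg : HInf g) (hh : HInf h) :
    pair k f (fun x => g x + h x) = pair k f g + pair k f h := by
  simp only [pair, iter_add hg.smooth hh.smooth, mul_add]
  rw [integral_add (integrable_mul hf.mem0 hg.mem0) (integrable_mul hf.mem0 hh.mem0),
    integral_add (integrable_mul (hf.mem k) (hg.mem k)) (integrable_mul (hf.mem k) (hh.mem k))]
  ring

lemma pair_const_mul (k : ℕ) (f g : ℝ → ℝ) (c : ℝ) :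
    pair k f (fun x => c * g x) = c * pair k f g := by
  simp only [pair, iter_const_mul, mul_left_comm _ c, integral_const_mul]; ring

lemma pair_conv (k : ℕ) {j f g : ℝ → ℝ} {δ : ℝ} (hj : IsSmoothing j δ) (hf : HInf f) (hg : HInf g) :
    pair k f (conv j g) = pair k (conv j f) g := by
  rw [pair, pair, hj.iter_conv hf, hj.iter_conv hg, hj.integral_conv_mul hf.mem0 hg.mem0,
    hj.integral_conv_mul (hf.mem k) (hg.mem k)]

lemma IsC1.eng_hasDeriv {T : ℝ} {u g : ℝ → ℝ → ℝ} (hu : IsC1 T u g) (k : ℕ) {t : ℝ}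
    (ht : t ∈ Icc 0 T) :
    HasDerivWithinAt (fun τ => eng k (u τ)) (2 * pair k (u t) (g t)) (Icc 0 T) t := by
  have := (hu.hs_sq_hasDeriv 0 ht).add (hu.hs_sq_hasDeriv k ht)
  rw [← mul_add] at this
  simp only [iteratedDeriv_zero] at this
  exact this

/-- Absorption of a term with `k + 2` and `k + 1` derivatives by the parabolic dissipation. -/
lemma absorb {c C : ℝ} (hc : 0 < c) (k : ℕ) : ∃ C', 0 ≤ C' ∧ ∀ f, HInf f →
    2 * C * hs (k + 2) f * Hn (k + 1) f - 2 * c * hs (k + 2) f ^ 2 ≤ C' * eng k f := by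
  set P := C ^ 2 / c * (k + 2) with hP
  have hP0 : 0 ≤ P := by positivity
  refine ⟨P + P ^ 2 / (4 * c), by positivity, fun f hf => ?_⟩
  set X := hs (k + 2) f
  set H := Hn (k + 1) f
  have h1 : H ^ 2 ≤ (k + 2) * (hs 0 f ^ 2 + hs (k + 1) f ^ 2) := by
    have := Hn_sq_le hf (k + 1)
    push_cast at this
    rwa [add_assoc, one_add_one_eq_two] at this
  have h2 : hs (k + 1) f ^ 2 ≤ hs k f * X := hs_logconvex hf k
  have h3 : 2 * C * X * H ≤ c * X ^ 2 + C ^ 2 / c * H ^ 2 := by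
    have : 0 ≤ (c * X - C * H) ^ 2 / c := by positivity
    have e : (c * X - C * H) ^ 2 / c = c * X ^ 2 - 2 * C * X * H + C ^ 2 / c * H ^ 2 := by
      field_simp; ring
    linarith
  have h4 : C ^ 2 / c * H ^ 2 ≤ P * (hs 0 f ^ 2 + hs k f * X) := by
    calc C ^ 2 / c * H ^ 2 ≤ C ^ 2 / c * ((k + 2) * (hs 0 f ^ 2 + hs k f * X)) := by
          gcongr; exact h1.trans (by gcongr)
      _ = _ := by rw [hP]; ring
  have h5 : P * (hs k f * X) ≤ c * X ^ 2 + P ^ 2 / (4 * c) * hs k f ^ 2 := by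
    have : 0 ≤ (2 * c * X - P * hs k f) ^ 2 / (4 * c) := by positivity
    have e : (2 * c * X - P * hs k f) ^ 2 / (4 * c) =
        c * X ^ 2 - P * (hs k f * X) + P ^ 2 / (4 * c) * hs k f ^ 2 := by
      field_simp; ring
    linarith
  have h6 : 0 ≤ P * hs k f ^ 2 := by positivity
  have h7 : 0 ≤ P ^ 2 / (4 * c) * hs 0 f ^ 2 := by positivity
  simp only [eng]
  linarith

lemma integral_mul_iter_four {f : ℝ → ℝ} (hf : HInf f) : ∫ x, f x * 𝒟 4 f x = hs 2 f ^ 2 := by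
  have := integral_mul_iter hf (hf.iter 2) 2
  rw [iteratedDeriv_comp_iteratedDeriv] at this
  rw [this, hs, l2_sq (hf.mem 2)]
  simp only [pow_two]; norm_num

/-- Moving two derivatives from the nonlinear term `n` to `f` leaves `k` derivatives of `n` against
`∂^(k+4) f`, which the dissipation controls. A loss of three derivatives in `n` is therefore
admissible, and `absorb` closes the estimate. -/
lemma parabolic_energy {c C : ℝ} (hc : 0 < c) (hC : 0 ≤ C) (k : ℕ) : ∃ C', 0 ≤ C' ∧ ∀ f n, HInf f →
    HInf n → hs 0 n ≤ C * Hn (k + 2) f → hs k n ≤ C * Hn (k + 3) f →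
    2 * pair (k + 2) f (fun x => - n x - c * 𝒟 4 f x) ≤ C' * eng (k + 2) f := by
  obtain ⟨C', hC0, hC'⟩ := absorb (c := c) (C := C) hc (k + 2)
  refine ⟨C' + 2 * C * (k + 3), by positivity, fun f n hf hn h0 hk => ?_⟩
  have e : (fun x => - n x - c * 𝒟 4 f x) = fun x => (-1) * n x + (-c) * 𝒟 4 f x := by
    ext x; ring
  rw [e, pair_add _ hf (hn.const_mul _) ((hf.iter 4).const_mul _), pair_const_mul, pair_const_mul]
  have e1 : ∫ x, 𝒟 (k + 2) f x * 𝒟 (k + 2) n x = ∫ x, 𝒟 (k + 4) f x * 𝒟 k n x := by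
    have := integral_mul_iter (hf.iter (k + 2)) (hn.iter k) 2
    rw [iteratedDeriv_comp_iteratedDeriv, iteratedDeriv_comp_iteratedDeriv] at this
    rw [add_comm 2 k, show 2 + (k + 2) = k + 4 by ring] at this
    simpa using this
  have e3 : ∫ x, 𝒟 (k + 2) f x * 𝒟 (k + 2) (𝒟 4 f) x = hs (k + 4) f ^ 2 := by
    have := integral_mul_iter (hf.iter (k + 2)) (hf.iter (k + 4)) 2
    rw [iteratedDeriv_comp_iteratedDeriv, iteratedDeriv_comp_iteratedDeriv] at this
    rw [iteratedDeriv_comp_iteratedDeriv, show k + 2 + 4 = 2 + (k + 4) by ring, this,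
      show 2 + (k + 2) = k + 4 by ring, hs, l2_sq (hf.mem (k + 4))]
    simp only [pow_two]; norm_num
  have h1 := abs_integral_mul_le hf.mem0 hn.mem0
  have h2 := abs_integral_mul_le (hf.mem (k + 4)) (hn.mem k)
  have h3 := hC' f hf
  rw [pair, pair, e1, integral_mul_iter_four hf, e3]
  have h4 : l2 f * l2 n ≤ C * (k + 3) * eng (k + 2) f := by
    rw [← hs_zero, ← hs_zero]
    have h5 := Hn_sq_le hf (k + 2)
    push_cast at h5
    have h6 := hs_le_Hn (Nat.zero_le (k + 2)) f
    calc hs 0 f * hs 0 n ≤ Hn (k + 2) f * (C * Hn (k + 2) f) :=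
          mul_le_mul h6 h0 (hs_nonneg _ _) (Hn_nonneg _ _)
      _ = C * Hn (k + 2) f ^ 2 := by ring
      _ ≤ C * ((k + 2 + 1) * (hs 0 f ^ 2 + hs (k + 2) f ^ 2)) := by gcongr
      _ = _ := by rw [eng]; ring
  have h5 : l2 (𝒟 (k + 4) f) * l2 (𝒟 k n) ≤ C * hs (k + 4) f * Hn (k + 3) f := by
    calc l2 (𝒟 (k + 4) f) * l2 (𝒟 k n) ≤ hs (k + 4) f * (C * Hn (k + 3) f) :=
          mul_le_mul_of_nonneg_left hk (l2_nonneg _)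
      _ = _ := by ring
  have h6 := (abs_le.1 h1).1
  have h7 := (abs_le.1 h2).1
  have h8 := mul_nonneg hc.le (sq_nonneg (hs 2 f))
  rw [show k + 2 + 2 = k + 4 by ring, show k + 2 + 1 = k + 3 by ring] at h3
  linarith

/-! ### The parabolic right-hand side: energy inequalities and uniqueness at fixed `ε`. -/

section Operator

variable {κ a : ℝ → ℝ} (hκ : BInf κ) (ha : BInf a) {c : ℝ}

/-- The right-hand side of the regularized equation. -/
def Fop (κ a : ℝ → ℝ) (c : ℝ) (v : ℝ → ℝ) (x : ℝ) : ℝ := - Nop κ a v x - c * 𝒟 4 v x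

include hκ ha

lemma DP_Fop : DP 1 4 4 (Fop κ a c) := by
  have d4 : DP 1 4 4 fun v x => 𝒟 4 v x * 1 := DP.one.cons (k := 4) (by norm_num) le_rfl (by omega)
  have h := (((DP_Nop hκ ha).const_mul (-1)).weaken (e' := 1) (n' := 4) (m' := 4) le_rfl (by omega)
    (by omega)).add (d4.const_mul (-c))
  refine cast (congrArg _ ?_) h
  ext v x; simp only [Fop]; ring

/-- The tame estimate at level `k + 5` bounds `∂^(k+2)` of the nonlinear term in exactly the norm
that `parabolic_energy` admits. The constant needs a bound in `H^4` only but depends on `c`; it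
serves existence, not uniformity in `ε`. -/
lemma Fop_energy (hc : 0 < c) (k : ℕ) (B : ℝ) : ∃ C, 0 ≤ C ∧ ∀ f, HInf f → Hn 4 f ≤ B →
    2 * pair (k + 4) f (Fop κ a c f) ≤ C * eng (k + 4) f := by
  obtain ⟨r, hr, h⟩ := (DP_Nop hκ ha).exists_iter (k + 2)
  obtain ⟨C1, h1, hC1⟩ := ((DP_Nop hκ ha).weaken (n' := 4 + 3) le_rfl (by omega) le_rfl).tame le_rfl
    (by norm_num) B
  obtain ⟨C2, h2, hC2⟩ := (hr.weaken (n' := (k + 5) + 3) le_rfl (by omega) le_rfl).tame (by omega)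
    (by omega) B
  obtain ⟨C, hC0, hC⟩ := parabolic_energy hc (add_nonneg h1 h2) (k + 2)
  refine ⟨C, hC0, fun f hf hB => hC f (Nop κ a f) hf ((DP_Nop hκ ha).hInf hf) ?_ ?_⟩
  · rw [hs_zero]
    refine (hC1 f hf hB).trans (mul_le_mul (by linarith) (Hn_mono (by omega) f) (Hn_nonneg _ _)
      (by positivity))
  · rw [hs, h f hf.smooth]
    exact (hC2 f hf hB).trans (mul_le_mul_of_nonneg_right (by linarith) (Hn_nonneg _ _))

/-- The same scheme for differences, with Lipschitz bounds in place of tame ones. The level `4` is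
that of the norm inside the cutoff, whose increments will have to be controlled too. -/
lemma Fop_sub_energy (hc : 0 < c) (B : ℝ) : ∃ C, 0 ≤ C ∧ ∀ v w, HInf v → HInf w → Hn 6 v ≤ B →
    Hn 6 w ≤ B → 2 * pair 4 (fun x => v x - w x) (fun x => Fop κ a c v x - Fop κ a c w x) ≤
      C * eng 4 (fun x => v x - w x) := by
  obtain ⟨C1, h1, hC1⟩ := (DP_Nop hκ ha).lipschitz_hs 0 B
  obtain ⟨C2, h2, hC2⟩ := (DP_Nop hκ ha).lipschitz_hs 2 B
  obtain ⟨C, hC0, hC⟩ := parabolic_energy hc (add_nonneg h1 h2) 2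
  refine ⟨C, hC0, fun v w hv hw hBv hBw => ?_⟩
  have hd := hv.sub hw
  have hn := ((DP_Nop hκ ha).hInf hv).sub ((DP_Nop hκ ha).hInf hw)
  have e : (fun x => Fop κ a c v x - Fop κ a c w x) = fun x =>
      -(Nop κ a v x - Nop κ a w x) - c * 𝒟 4 (fun x => v x - w x) x := by
    ext x; rw [iter_sub hv.smooth hw.smooth]; simp only [Fop]; ring
  rw [e]
  refine hC _ (fun x => Nop κ a v x - Nop κ a w x) hd hn ?_ ?_
  · refine (hC1 v w hv hw ((Hn_mono (by norm_num) v).trans hBv)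
      ((Hn_mono (by norm_num) w).trans hBw)).trans ?_
    exact mul_le_mul (by linarith) (Hn_mono (by norm_num) _) (Hn_nonneg _ _) (by positivity)
  · refine (hC2 v w hv hw hBv hBw).trans ?_
    exact mul_le_mul_of_nonneg_right (by linarith) (Hn_nonneg _ _)

/-- Uniqueness for the regularized equation. -/
lemma eq_of_isC1_Fop (hc : 0 < c) {T : ℝ} {v w : ℝ → ℝ → ℝ}
    (hv : IsC1 T v fun t => Fop κ a c (v t)) (hw : IsC1 T w fun t => Fop κ a c (w t))
    (h0 : v 0 = w 0) {t : ℝ} (ht : t ∈ Icc 0 T) : v t = w t := by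
  obtain ⟨B1, hB1⟩ := hv.isC0.exists_bound hv.left 6
  obtain ⟨B2, hB2⟩ := hw.isC0.exists_bound hw.left 6
  obtain ⟨C, hC0, hC⟩ := Fop_sub_energy hκ ha hc (max B1 B2)
  have h1 := gronwall (K := 0) le_rfl hC0 (fun t ht => (hv.sub hw).eng_hasDeriv 4 ht) (fun t ht => by
    rw [add_zero]
    exact hC _ _ (hv.left t ht) (hw.left t ht) ((hB1 t ht).trans (le_max_left _ _))
      ((hB2 t ht).trans (le_max_right _ _))) ht
  have h2 : eng 4 (fun x => v 0 x - w 0 x) = 0 := by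
    have : (fun x => v 0 x - w 0 x) = fun x => 0 * v 0 x := by ext x; rw [h0]; ring
    rw [this, eng, hs_const_mul, hs_const_mul]; simp
  rw [h2] at h1
  simp only [zero_mul, add_zero] at h1
  have hd := (hv.left t ht).sub (hw.left t ht)
  have h3 : Hn 4 (fun x => v t x - w t x) ^ 2 ≤ 0 := by
    refine (Hn_sq_le hd 4).trans ?_
    rw [eng] at h1
    push_cast; linarith
  have h4 : Hn 4 (fun x => v t x - w t x) = 0 := by
    have := Hn_nonneg 4 (fun x => v t x - w t x); nlinarith
  ext x
  have := eq_zero_of_Hn hd (by norm_num) h4 x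
  linarith

end Operator

/-! ### The truncated operator -/

/-- A Lipschitz cutoff of `s` at scale `M ^ 2`. -/
def cut (M s : ℝ) : ℝ := max 0 (min 1 (2 - s / M ^ 2))

lemma cut_nonneg (M s : ℝ) : 0 ≤ cut M s := le_max_left _ _

lemma cut_le_one (M s : ℝ) : cut M s ≤ 1 := max_le zero_le_one (min_le_left _ _)

lemma abs_cut_le_one (M s : ℝ) : |cut M s| ≤ 1 := by
  rw [abs_of_nonneg (cut_nonneg M s)]; exact cut_le_one M s

lemma cut_eq_one {M s : ℝ} (hM : 0 < M) (h : s ≤ M ^ 2) : cut M s = 1 := by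
  have : s / M ^ 2 ≤ 1 := (div_le_one (by positivity)).2 h
  rw [cut, min_eq_left (by linarith), max_eq_right zero_le_one]

/-- The cutoff vanishes already from `2 M²` on; the cruder threshold `(2 M)²` reads directly as a
norm above `2 M`. -/
lemma cut_eq_zero {M s : ℝ} (hM : 0 < M) (h : (2 * M) ^ 2 < s) : cut M s = 0 := by
  have : 2 ≤ s / M ^ 2 := (le_div_iff₀ (by positivity)).2 (by nlinarith)
  exact max_eq_left ((min_le_right _ _).trans (by linarith))

lemma abs_cut_sub_le {M : ℝ} (s s' : ℝ) : |cut M s - cut M s'| ≤ |s - s'| / M ^ 2 := by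
  have h1 := abs_max_sub_max_le_max 0 (min 1 (2 - s / M ^ 2)) 0 (min 1 (2 - s' / M ^ 2))
  have h2 := abs_min_sub_min_le_max 1 (2 - s / M ^ 2) 1 (2 - s' / M ^ 2)
  simp only [sub_self, abs_zero, abs_nonneg, sup_of_le_right] at h1 h2
  refine (h1.trans h2).trans (le_of_eq ?_)
  rw [show 2 - s / M ^ 2 - (2 - s' / M ^ 2) = (s' - s) / M ^ 2 by ring, abs_div,
    abs_of_nonneg (sq_nonneg M), abs_sub_comm]

lemma abs_Hn_sq_sub_le {f g : ℝ → ℝ} (hf : HInf f) (hg : HInf g) {k : ℕ} {B : ℝ}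
    (hBf : Hn k f ≤ B) (hBg : Hn k g ≤ B) :
    |Hn k f ^ 2 - Hn k g ^ 2| ≤ (k + 1) * (2 * B) * Hn k (fun x => f x - g x) := by
  rw [Hn_sq, Hn_sq, ← Finset.sum_sub_distrib]
  refine (Finset.abs_sum_le_sum_abs _ _).trans ?_
  have : ∀ l ∈ Finset.range (k + 1), |hs l f ^ 2 - hs l g ^ 2| ≤
      2 * B * Hn k (fun x => f x - g x) := fun l hl => by
    have hl' : l ≤ k := by simp at hl; omega
    rw [sq_sub_sq, abs_mul, abs_of_nonneg (add_nonneg (hs_nonneg _ _) (hs_nonneg _ _))]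
    have h1 := (hs_le_Hn hl' f).trans hBf
    have h2 := (hs_le_Hn hl' g).trans hBg
    exact mul_le_mul (by linarith) ((abs_hs_sub_le l hf hg).trans (hs_le_Hn hl' _)) (abs_nonneg _)
      (by linarith [Hn_nonneg k f])
  refine (Finset.sum_le_sum this).trans (le_of_eq ?_)
  simp; ring

/-- The right-hand side of the regularized equation, switched off where the norm of `H^4` is
large. -/
def cutF (κ a : ℝ → ℝ) (c M : ℝ) (v : ℝ → ℝ) (x : ℝ) : ℝ :=
  cut M (Hn 4 v ^ 2) * Fop κ a c v x

lemma DP.apply_zero {n m : ℕ} {r : (ℝ → ℝ) → ℝ → ℝ} (h : DP 1 n m r) (x : ℝ) :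
    r (fun _ => 0) x = 0 := by
  induction h with
  | zero => rfl
  | @mono F L hF h1 h2 h3 =>
    obtain ⟨k, hk⟩ : ∃ k, k ∈ L := Multiset.card_pos_iff_exists_mem.1 h1
    obtain ⟨L, rfl⟩ := Multiset.exists_cons_of_mem hk
    rw [dmono_cons]; simp [iteratedDeriv_fun_const_zero]
  | add _ _ ih ih' => simp only [ih, ih', add_zero]

lemma hs_zero_fun (k : ℕ) : hs k (fun _ => 0) = 0 := by
  have := hs_const_mul k 0 (fun _ => 0)
  simpa using this

lemma Hn_zero_fun (k : ℕ) : Hn k (fun _ => 0) = 0 := by simp [Hn, hs_zero_fun]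

lemma Hn_sub_conv_le {j f : ℝ → ℝ} {δ : ℝ} (hj : IsSmoothing j δ) (hδ : 0 ≤ δ) (hf : HInf f)
    (k : ℕ) : Hn k (fun x => conv j f x - f x) ≤ (k + 1) * (δ * Hn (k + 1) f) :=
  Hn_le_of_hs_le (mul_nonneg hδ (Hn_nonneg _ _)) fun l hl =>
    (hj.hs_conv_sub_le hδ hf l).trans
      (mul_le_mul_of_nonneg_left (hs_le_Hn (by omega) f) hδ)

section Truncated

variable {κ a : ℝ → ℝ} (hκ : BInf κ) (ha : BInf a) {c M : ℝ}

include hκ ha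

lemma hInf_cutF {v : ℝ → ℝ} (hv : HInf v) : HInf (cutF κ a c M v) :=
  ((DP_Fop hκ ha).hInf hv).const_mul _

/-- The increment of the operator is multiplied by a scalar of size at most one, and the increment
of the scalar, Lipschitz in the norm of `H^4`, by the bounded function `Fop κ a c w`. -/
lemma cutF_lipschitz (k : ℕ) {B : ℝ} (hB : 0 ≤ B) : ∃ C, 0 ≤ C ∧ ∀ v w, HInf v → HInf w →
    Hn (k + 5) v ≤ B → Hn (k + 5) w ≤ B →
    hs k (fun x => cutF κ a c M v x - cutF κ a c M w x) ≤ C * Hn (k + 4) (fun x => v x - w x) := by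
  obtain ⟨C, hC0, hC⟩ := (DP_Fop hκ ha (c := c)).lipschitz_hs k B
  have h54 : 4 + k + 1 = k + 5 := by ring
  rw [h54, show 4 + k = k + 4 by ring] at hC
  set D := (4 + 1 : ℝ) * (2 * B) / M ^ 2
  refine ⟨C + D * (C * B), by positivity, fun v w hv hw hBv hBw => ?_⟩
  have hFv := (DP_Fop hκ ha (c := c)).hInf hv
  have hFw := (DP_Fop hκ ha (c := c)).hInf hw
  have e : (fun x => cutF κ a c M v x - cutF κ a c M w x) = fun x =>
      cut M (Hn 4 v ^ 2) * (Fop κ a c v x - Fop κ a c w x) +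
        (cut M (Hn 4 v ^ 2) - cut M (Hn 4 w ^ 2)) * Fop κ a c w x := by
    ext x; simp only [cutF]; ring
  rw [e]
  refine (hs_add_le k ((hFv.sub hFw).const_mul _) (hFw.const_mul _)).trans ?_
  rw [hs_const_mul, hs_const_mul, add_mul]
  set H := Hn (k + 4) (fun x => v x - w x)
  have hH : 0 ≤ H := Hn_nonneg _ _
  have h1 : hs k (Fop κ a c w) ≤ C * B := by
    have h := hC w (fun _ => 0) hw HInf.zero hBw (by rw [Hn_zero_fun]; exact hB)
    simp only [(DP_Fop hκ ha (c := c)).apply_zero, sub_zero] at h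
    exact h.trans (mul_le_mul_of_nonneg_left ((Hn_mono (by omega) w).trans hBw) hC0)
  have h2 : |cut M (Hn 4 v ^ 2) - cut M (Hn 4 w ^ 2)| ≤ D * H := by
    refine (abs_cut_sub_le _ _).trans ?_
    have h3 := abs_Hn_sq_sub_le hv hw ((Hn_mono (show 4 ≤ k + 5 by omega) v).trans hBv)
      ((Hn_mono (show 4 ≤ k + 5 by omega) w).trans hBw)
    have h4 : Hn 4 (fun x => v x - w x) ≤ H := Hn_mono (by omega) _
    simp only [D]
    rw [div_mul_eq_mul_div]
    refine div_le_div_of_nonneg_right (h3.trans ?_) (sq_nonneg M)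
    exact mul_le_mul_of_nonneg_left h4 (by positivity)
  refine add_le_add ?_ ?_
  · refine (mul_le_mul (abs_cut_le_one _ _) (hC v w hv hw hBv hBw) (hs_nonneg _ _)
      zero_le_one).trans (by rw [one_mul])
  · refine (mul_le_mul h2 h1 (hs_nonneg _ _) (by positivity)).trans (le_of_eq (by ring))

lemma cutF_bound (k : ℕ) {B : ℝ} (hB : 0 ≤ B) : ∃ C, 0 ≤ C ∧ ∀ v, HInf v → Hn (k + 5) v ≤ B →
    hs k (cutF κ a c M v) ≤ C := by
  obtain ⟨C, hC0, hC⟩ := cutF_lipschitz hκ ha (c := c) (M := M) k hB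
  refine ⟨C * B, by positivity, fun v hv hBv => ?_⟩
  have h := hC v (fun _ => 0) hv HInf.zero hBv (by rw [Hn_zero_fun]; exact hB)
  simp only [cutF, (DP_Fop hκ ha (c := c)).apply_zero, mul_zero, sub_zero] at h
  exact h.trans (mul_le_mul_of_nonneg_left ((Hn_mono (by omega) v).trans hBv) hC0)

/-- The error made by smoothing the truncated operator. -/
lemma cutF_smoothing (k : ℕ) {B : ℝ} (hB : 0 ≤ B) : ∃ C, 0 ≤ C ∧ ∀ j δ u, IsSmoothing j δ → 0 ≤ δ →
    HInf u → Hn (k + 6) u ≤ B →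
    hs k (fun x => conv j (cutF κ a c M (conv j u)) x - cutF κ a c M u x) ≤ C * δ := by
  obtain ⟨C1, h1, hC1⟩ := cutF_lipschitz hκ ha (c := c) (M := M) k hB
  obtain ⟨C2, h2, hC2⟩ := cutF_bound hκ ha (c := c) (M := M) (k + 1) hB
  refine ⟨C2 + C1 * ((k + 5) * B), by positivity, fun j δ u hj hδ hu hBu => ?_⟩
  have hJ := hj.conv_hInf hu
  have hFJ := hInf_cutF hκ ha (c := c) (M := M) hJ
  have hJB := hj.Hn_conv_le hu (k + 6)
  -- The outer smoothing is removed first and then the inner one; each costs a factor `δ` and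
  -- additional derivatives, which are bounded.
  refine (hs_sub_le_hs_sub_add k (hj.conv_hInf hFJ) hFJ (hInf_cutF hκ ha hu)).trans ?_
  rw [add_mul]
  refine add_le_add ?_ ?_
  · refine (hj.hs_conv_sub_le hδ hFJ k).trans ?_
    rw [mul_comm]
    exact mul_le_mul_of_nonneg_right (hC2 _ hJ (hJB.trans hBu)) hδ
  · refine (hC1 _ _ hJ hu ((Hn_mono (by omega) _).trans (hJB.trans hBu))
      ((Hn_mono (by omega) u).trans hBu)).trans ?_
    have h3 := Hn_sub_conv_le hj hδ hu (k + 4)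
    have h4 : Hn (k + 4 + 1) u ≤ B := (Hn_mono (by omega) u).trans hBu
    rw [mul_assoc]
    refine mul_le_mul_of_nonneg_left (h3.trans ?_) h1
    push_cast
    calc (k + 4 + 1 : ℝ) * (δ * Hn (k + 4 + 1) u) ≤ (k + 4 + 1 : ℝ) * (δ * B) := by gcongr
      _ = _ := by ring

end Truncated

/-! ### Existence for the truncated problem -/

lemma hs_sq_le_mul {f : ℝ → ℝ} (hf : HInf f) (k : ℕ) : hs k f ^ 2 ≤ hs 0 f * hs (k + k) f := by
  have h := integral_mul_iter hf (hf.iter k) k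
  rw [iteratedDeriv_comp_iteratedDeriv] at h
  have h1 := abs_integral_mul_le hf.mem0 (hf.mem (k + k))
  have h2 : hs k f ^ 2 = ∫ x, 𝒟 k f x * 𝒟 k f x := by
    rw [hs, l2_sq (hf.mem k)]; simp only [pow_two]
  rw [h, ← h2, abs_mul, abs_pow, abs_neg, abs_one, one_pow, one_mul, abs_of_nonneg (sq_nonneg _)] at h1
  rwa [hs_zero]

/-- Passage to the limit in derivatives that converge uniformly. -/
lemma hasDerivWithinAt_of_uniform_limit {f f' : ℕ → ℝ → ℝ} {F G : ℝ → ℝ} {S : Set ℝ}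
    (hS : Convex ℝ S) (hf : ∀ n, ∀ t ∈ S, HasDerivWithinAt (f n) (f' n t) S t)
    (hlim : ∀ t ∈ S, Tendsto (fun n => f n t) atTop (𝓝 (F t)))
    (hunif : ∀ ε > 0, ∀ᶠ n in atTop, ∀ t ∈ S, |f' n t - G t| ≤ ε)
    (hG : ContinuousOn G S) {t : ℝ} (ht : t ∈ S) : HasDerivWithinAt F (G t) S t := by
  rw [hasDerivWithinAt_iff_isLittleO, Asymptotics.isLittleO_iff]
  intro c hc
  have h1 := Metric.continuousWithinAt_iff.1 (hG t ht) (c / 2) (by positivity)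
  obtain ⟨r, hr, h1⟩ := h1
  have h2 : Metric.ball t r ∈ 𝓝[S] t := mem_nhdsWithin_of_mem_nhds (Metric.ball_mem_nhds t hr)
  filter_upwards [h2, self_mem_nhdsWithin] with τ hτ hτS
  have hlim' : Tendsto (fun n => ‖f n τ - f n t - (τ - t) • G t‖) atTop
      (𝓝 ‖F τ - F t - (τ - t) • G t‖) :=
    (((hlim τ hτS).sub (hlim t ht)).sub tendsto_const_nhds).norm
  refine le_of_tendsto hlim' ?_
  filter_upwards [hunif (c / 2) (by positivity)] with n hn
  have hconv : Convex ℝ (S ∩ Metric.ball t r) := hS.inter (convex_ball t r)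
  have h3 := hconv.norm_image_sub_le_of_norm_hasDerivWithin_le (f := fun s => f n s - s * G t)
    (f' := fun s => f' n s - 1 * G t) (C := c) (x := t) (y := τ) (fun s hs => by
      have h4 : HasDerivWithinAt (fun s => s * G t) (1 * G t) (S ∩ Metric.ball t r) s :=
        ((hasDerivAt_id s).mul_const (G t)).hasDerivWithinAt
      exact ((hf n s hs.1).mono inter_subset_left).sub h4) (fun s hs => by
      have h5 := hn s hs.1
      have h6 := h1 hs.1 hs.2
      rw [Real.dist_eq] at h6
      rw [Real.norm_eq_abs]
      have h7 := abs_add_le (f' n s - G s) (G s - G t)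
      rw [sub_add_sub_cancel] at h7
      rw [one_mul]; linarith) ⟨ht, Metric.mem_ball_self hr⟩ ⟨hτS, hτ⟩
  refine le_trans (le_of_eq ?_) h3
  congr 1; simp only [smul_eq_mul]; ring

section Truncated

variable {κ a : ℝ → ℝ} (hκ : BInf κ) (ha : BInf a) {c M : ℝ}

include hκ ha

/-- Where the cutoff is active the norm of `H^4` is at most `2 M`, which bounds the fourth order
operator in `L²`. This global bound excludes blow-up in the smoothed problem. -/
lemma l2_cutF_le (hM : 0 < M) : ∃ L, 0 ≤ L ∧ ∀ f, HInf f → l2 (cutF κ a c M f) ≤ L := by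
  obtain ⟨C, hC0, hC⟩ := ((DP_Fop hκ ha (c := c)).weaken (n' := 4 + 3) le_rfl (by omega) le_rfl).tame
    le_rfl le_rfl (2 * M)
  refine ⟨C * (2 * M), by positivity, fun f hf => ?_⟩
  have e : l2 (cutF κ a c M f) = |cut M (Hn 4 f ^ 2)| * l2 (Fop κ a c f) := l2_const_mul _ _
  rw [e]
  by_cases h : (2 * M) ^ 2 < Hn 4 f ^ 2
  · rw [cut_eq_zero hM h, abs_zero, zero_mul]; positivity
  · have h1 : Hn 4 f ≤ 2 * M := by
      by_contra! h2
      exact h (pow_lt_pow_left₀ h2 (by positivity) two_ne_zero)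
    have h2 := (hC f hf h1).trans (mul_le_mul_of_nonneg_left h1 hC0)
    exact (mul_le_mul (abs_cut_le_one _ _) h2 (l2_nonneg _) zero_le_one).trans (by rw [one_mul])

/-- The smoothed truncated problem is an ordinary differential equation in `L²`. -/
lemma exists_isC1_smoothed (hM : 0 < M) {j : ℝ → ℝ} {δ : ℝ} (hj : IsSmoothing j δ) {u₀ : ℝ → ℝ}
    (hu₀ : HInf u₀) {T : ℝ} (hT : 0 ≤ T) : ∃ u : ℝ → ℝ → ℝ, u 0 = u₀ ∧
      IsC1 T u fun t => conv j (cutF κ a c M (conv j (u t))) := by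
  -- Orders up to `5` are needed because the Lipschitz bound in `L²` assumes a bound in `H^5`.
  set A : ℝ := ∑ k ∈ Finset.range 6, ∫ x, |𝒟 k j x|
  have hI : ∀ k, 0 ≤ ∫ x, |𝒟 k j x| := fun k => integral_nonneg fun _ => abs_nonneg _
  have hA0 : 0 ≤ A := Finset.sum_nonneg fun k _ => hI k
  have hA : ∀ k ≤ 5, ∫ x, |𝒟 k j x| ≤ A := fun k hk =>
    Finset.single_le_sum (f := fun k => ∫ x, |𝒟 k j x|) (fun k _ => hI k)
      (Finset.mem_range.2 (by omega))
  -- The unknown is `y ∈ L²` with `u = u₀ + j * y`. Then `y` starts at `0` and solves `y' = f y`,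
  -- while `u` is automatically smooth and convergence in `L²` of difference quotients of `y` gives
  -- convergence in all `H^k` for `u`.
  let U : Lp ℝ 2 (volume : Measure ℝ) → ℝ → ℝ := fun y x => u₀ x + conv j y x
  have hcI : ∀ y : Lp ℝ 2 (volume : Measure ℝ), HInf (conv j y) := fun y => hj.hInf_conv (Lp.memLp y)
  have hU : ∀ y, HInf (U y) := fun y => hu₀.add (hcI y)
  have hl2 : ∀ y : Lp ℝ 2 (volume : Measure ℝ), l2 y = ‖y‖ := fun y => by
    rw [← norm_toL2 (Lp.memLp y), toL2_coe]
  have hUsub : ∀ y z, (fun x => U y x - U z x) = conv j ((y - z : Lp ℝ 2 (volume : Measure ℝ))) := by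
    intro y z
    have h1 : ⇑(y - z) =ᵐ[volume] fun x => y x - z x := Lp.coeFn_sub y z
    rw [conv_congr h1, conv_sub hj.mem2 (Lp.memLp y) (Lp.memLp z)]
    ext x; simp only [U]; ring
  have hUlip : ∀ y z, ∀ k ≤ 5, hs k (fun x => U y x - U z x) ≤ A * ‖y - z‖ := fun y z k hk => by
    rw [hUsub, ← hl2]
    exact (hj.hs_conv_le_l2 (Lp.memLp _) k).trans
      (mul_le_mul_of_nonneg_right (hA k hk) (l2_nonneg _))
  let f : Lp ℝ 2 (volume : Measure ℝ) → Lp ℝ 2 (volume : Measure ℝ) := fun y =>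
    toL2 (cutF κ a c M (conv j (U y)))
  have hF : ∀ y, HInf (cutF κ a c M (conv j (U y))) := fun y => hInf_cutF hκ ha (hj.conv_hInf (hU y))
  obtain ⟨L, hL0, hL⟩ := l2_cutF_le hκ ha (c := c) hM
  -- The speed is at most `L` everywhere, so the ball of radius `L T` is not left before time `T`,
  -- and Picard–Lindelöf applies on all of `[0, T]` at once.
  set r := L * T with hr
  have hr0 : 0 ≤ r := by positivity
  set B := 6 * (Hn 5 u₀ + A * r) with hB
  have hB0 : 0 ≤ B := by have := Hn_nonneg 5 u₀; positivity
  have hUB : ∀ y ∈ Metric.closedBall (0 : Lp ℝ 2 (volume : Measure ℝ)) r,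
      Hn 5 (conv j (U y)) ≤ B := fun y hy => by
    rw [mem_closedBall_zero_iff] at hy
    have h1 : ∀ k ≤ 5, hs k (U y) ≤ Hn 5 u₀ + A * r := fun k hk => by
      refine (hs_add_le k hu₀ (hcI y)).trans (add_le_add (hs_le_Hn hk u₀) ?_)
      refine (hj.hs_conv_le_l2 (Lp.memLp _) k).trans ?_
      rw [hl2]
      exact mul_le_mul (hA k hk) hy (norm_nonneg _) hA0
    refine (hj.Hn_conv_le (hU y) 5).trans ?_
    have := Hn_le_of_hs_le (by have := Hn_nonneg 5 u₀; positivity) h1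
    norm_num at this
    linarith
  obtain ⟨C, hC0, hC⟩ := cutF_lipschitz hκ ha (c := c) (M := M) 0 hB0
  have hlip : LipschitzOnWith (Real.toNNReal (C * (5 * A))) f
      (Metric.closedBall 0 (Real.toNNReal r : ℝ)) := by
    rw [Real.coe_toNNReal r hr0]
    refine LipschitzOnWith.of_dist_le_mul fun y hy z hz => ?_
    rw [Real.coe_toNNReal _ (by positivity), dist_eq_norm, dist_eq_norm]
    simp only [f]
    rw [← toL2_sub (hF y).mem0 (hF z).mem0, norm_toL2 (by exact (hF y).mem0.sub (hF z).mem0)]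
    have h1 := hC _ _ (hj.conv_hInf (hU y)) (hj.conv_hInf (hU z)) (hUB y hy) (hUB z hz)
    rw [hs_zero] at h1
    refine h1.trans ?_
    rw [mul_assoc]
    refine mul_le_mul_of_nonneg_left ?_ hC0
    rw [← conv_sub hj.mem2 (hU y).mem0 (hU z).mem0]
    refine (hj.Hn_conv_le ((hU y).sub (hU z)) 4).trans ?_
    have h2 := Hn_le_of_hs_le (mul_nonneg hA0 (norm_nonneg (y - z)))
      fun k (hk : k ≤ 4) => hUlip y z k (by omega)
    norm_num at h2
    linarith
  have hbd : ∀ y ∈ Metric.closedBall (0 : Lp ℝ 2 (volume : Measure ℝ)) (Real.toNNReal r : ℝ),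
      ‖f y‖ ≤ Real.toNNReal L := fun y _ => by
    rw [Real.coe_toNNReal L hL0]
    simp only [f]
    rw [norm_toL2 (hF y).mem0]
    exact hL _ (hj.conv_hInf (hU y))
  have hPL : IsPicardLindelof (fun _ => f) (⟨0, le_rfl, hT⟩ : Icc 0 T) 0 (Real.toNNReal r) 0
      (Real.toNNReal L) (Real.toNNReal (C * (5 * A))) := by
    refine IsPicardLindelof.of_time_independent hbd hlip ?_
    simp only [sub_zero, sub_self, max_eq_left hT, NNReal.coe_zero]
    rw [Real.coe_toNNReal L hL0, Real.coe_toNNReal r hr0]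
  obtain ⟨y, hy0, hy⟩ := hPL.exists_eq_forall_mem_Icc_hasDerivWithinAt₀
  refine ⟨fun t => U (y t), ?_, fun t _ => hU _, fun t _ => hj.conv_hInf (hF _),
    fun k t ht b hb => ?_⟩
  · have h0 : y 0 = 0 := hy0
    have h1 : ⇑(0 : Lp ℝ 2 (volume : Measure ℝ)) =ᵐ[volume] fun _ => (0 : ℝ) := Lp.coeFn_zero _ _ _
    ext x
    simp only [U, h0]
    rw [conv_congr h1]
    simp [conv]
  · have h1 := hy t ht
    rw [hasDerivWithinAt_iff_isLittleO, Asymptotics.isLittleO_iff] at h1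
    have hb' : 0 < b / ((∫ x, |𝒟 k j x|) + 1) := div_pos hb (by linarith [hI k])
    filter_upwards [h1 hb'] with τ hτ
    have e : (fun x => U (y τ) x - U (y t) x - (τ - t) * conv j (cutF κ a c M (conv j (U (y t)))) x) =
        conv j ((y τ - y t - (τ - t) • f (y t) : Lp ℝ 2 (volume : Measure ℝ))) := by
      have h2 : ⇑(y τ - y t - (τ - t) • f (y t)) =ᵐ[volume] fun x =>
          (y τ - y t) x - (τ - t) * cutF κ a c M (conv j (U (y t))) x := by
        have h3 : ⇑(f (y t)) =ᵐ[volume] cutF κ a c M (conv j (U (y t))) := by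
          simp only [f]; rw [toL2_eq (hF _).mem0]; exact MemLp.coeFn_toLp _
        filter_upwards [Lp.coeFn_sub (y τ - y t) ((τ - t) • f (y t)),
          Lp.coeFn_smul (τ - t) (f (y t)), h3] with x h4 h5 h6
        rw [h4, Pi.sub_apply, h5, Pi.smul_apply, h6, smul_eq_mul]
      rw [conv_congr h2, conv_sub hj.mem2 (Lp.memLp _) ((hF _).mem0.const_mul _), conv_const_mul,
        ← hUsub]
    rw [e]
    refine (hj.hs_conv_le_l2 (Lp.memLp _) k).trans ?_
    rw [hl2]
    calc _ ≤ ((∫ x, |𝒟 k j x|) + 1) * (b / ((∫ x, |𝒟 k j x|) + 1) * ‖τ - t‖) :=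
          mul_le_mul (by linarith) hτ (norm_nonneg _) (by linarith [hI k])
      _ = b * |τ - t| := by
          have := hI k
          rw [Real.norm_eq_abs]; field_simp

/-- Bounds for the smoothed truncated problem, uniform in the smoothing. -/
lemma smoothed_bound (hc : 0 < c) (hM : 0 < M) (T : ℝ) (k : ℕ) (u₀ : ℝ → ℝ) :
    ∃ B, 0 ≤ B ∧ ∀ j δ u, IsSmoothing j δ → u 0 = u₀ →
      IsC1 T u (fun t => conv j (cutF κ a c M (conv j (u t)))) → ∀ t ∈ Icc 0 T, Hn k (u t) ≤ B := by
  obtain ⟨C, hC0, hC⟩ := Fop_energy hκ ha hc k (2 * M)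
  set E := eng (k + 4) u₀ * Real.exp (C * |T|) with hE
  have hE0 : 0 ≤ E := mul_nonneg (eng_nonneg _ _) (Real.exp_pos _).le
  refine ⟨√(((k + 4 : ℕ) + 1) * E), Real.sqrt_nonneg _, fun j δ u hj h0 hu t ht => ?_⟩
  have key : ∀ t ∈ Icc 0 T, 2 * pair (k + 4) (u t) (conv j (cutF κ a c M (conv j (u t)))) ≤
      C * eng (k + 4) (u t) + 0 := fun t ht => by
    have hw := hj.conv_hInf (hu.left t ht)
    -- The kernel is even, so the outer smoothing moves to the other factor, and the operator is
    -- tested against the very function it acts on. This makes the estimate independent of the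
    -- smoothing.
    rw [pair_conv _ hj (hu.left t ht) (hInf_cutF hκ ha hw), add_zero]
    have e : pair (k + 4) (conv j (u t)) (cutF κ a c M (conv j (u t))) =
        cut M (Hn 4 (conv j (u t)) ^ 2) * pair (k + 4) (conv j (u t)) (Fop κ a c (conv j (u t))) :=
      pair_const_mul _ _ _ _
    rw [e]
    by_cases h : (2 * M) ^ 2 < Hn 4 (conv j (u t)) ^ 2
    · rw [cut_eq_zero hM h, zero_mul, mul_zero]; exact mul_nonneg hC0 (eng_nonneg _ _)
    · have h1 : Hn 4 (conv j (u t)) ≤ 2 * M := by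
        by_contra! h2
        exact h (pow_lt_pow_left₀ h2 (by positivity) two_ne_zero)
      have h2 := hC _ hw h1
      have h3 : eng (k + 4) (conv j (u t)) ≤ eng (k + 4) (u t) :=
        add_le_add (pow_le_pow_left₀ (hs_nonneg _ _) (hj.hs_conv_le (hu.left t ht) 0) 2)
          (pow_le_pow_left₀ (hs_nonneg _ _) (hj.hs_conv_le (hu.left t ht) (k + 4)) 2)
      have h4 : C * eng (k + 4) (conv j (u t)) ≤ C * eng (k + 4) (u t) :=
        mul_le_mul_of_nonneg_left h3 hC0
      have h5 := mul_nonneg hC0 (eng_nonneg (k + 4) (conv j (u t)))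
      calc _ = cut M (Hn 4 (conv j (u t)) ^ 2) *
            (2 * pair (k + 4) (conv j (u t)) (Fop κ a c (conv j (u t)))) := by ring
        _ ≤ cut M (Hn 4 (conv j (u t)) ^ 2) * (C * eng (k + 4) (conv j (u t))) :=
            mul_le_mul_of_nonneg_left h2 (cut_nonneg _ _)
        _ ≤ 1 * (C * eng (k + 4) (conv j (u t))) :=
            mul_le_mul_of_nonneg_right (cut_le_one _ _) h5
        _ ≤ _ := by linarith
  have h1 := gronwall le_rfl hC0 (fun t ht => hu.eng_hasDeriv (k + 4) ht) key ht
  rw [zero_mul, add_zero, h0] at h1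
  have h2 : eng (k + 4) (u t) ≤ E := by
    refine h1.trans (mul_le_mul_of_nonneg_left (Real.exp_le_exp.2 ?_) (eng_nonneg _ _))
    exact mul_le_mul_of_nonneg_left (ht.2.trans (le_abs_self T)) hC0
  refine (Hn_mono (show k ≤ k + 4 by omega) _).trans (Real.le_sqrt_of_sq_le ?_)
  refine (Hn_sq_le (hu.left t ht) (k + 4)).trans ?_
  exact mul_le_mul_of_nonneg_left h2 (by positivity)

/-- The first part is the parabolic estimate for differences times a factor in `[0, 1]`. The second
is the increment of the cutoff times a fourth order operator measured in `H^4`, hence the bound in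
`H^9`. -/
lemma cutF_sub_energy (hc : 0 < c) {B : ℝ} (hB : 0 ≤ B) : ∃ C, 0 ≤ C ∧ ∀ v w, HInf v → HInf w →
    Hn 9 v ≤ B → Hn 9 w ≤ B →
    2 * pair 4 (fun x => v x - w x) (fun x => cutF κ a c M v x - cutF κ a c M w x) ≤
      C * eng 4 (fun x => v x - w x) := by
  obtain ⟨C1, h1, hC1⟩ := Fop_sub_energy hκ ha hc B
  obtain ⟨C2, h2, hC2⟩ := (DP_Fop hκ ha (c := c)).lipschitz_hs 0 B
  obtain ⟨C3, h3, hC3⟩ := (DP_Fop hκ ha (c := c)).lipschitz_hs 4 B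
  set D := (4 + 1 : ℝ) * (2 * B) / M ^ 2
  set P := (C2 + C3) * B
  refine ⟨C1 + 2 * (D * P) * 10, by positivity, fun v w hv hw hBv hBw => ?_⟩
  have hFv := (DP_Fop hκ ha (c := c)).hInf hv
  have hFw := (DP_Fop hκ ha (c := c)).hInf hw
  have e : (fun x => cutF κ a c M v x - cutF κ a c M w x) = fun x =>
      cut M (Hn 4 v ^ 2) * (Fop κ a c v x - Fop κ a c w x) +
        (cut M (Hn 4 v ^ 2) - cut M (Hn 4 w ^ 2)) * Fop κ a c w x := by
    ext x; simp only [cutF]; ring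
  have hd := hv.sub hw
  rw [e, pair_add _ hd ((hFv.sub hFw).const_mul _) (hFw.const_mul _), pair_const_mul,
    pair_const_mul]
  set d := fun x => v x - w x with hdd
  have mono : ∀ f, ∀ k ≤ 9, Hn 9 f ≤ B → Hn k f ≤ B := fun f k hk h => (Hn_mono hk f).trans h
  have hz : Hn 9 (fun _ => (0 : ℝ)) ≤ B := by rw [Hn_zero_fun]; exact hB
  have b0 : hs 0 (Fop κ a c w) ≤ P := by
    have h := hC2 w (fun _ => 0) hw HInf.zero (mono _ _ (by norm_num) hBw)
      (mono _ _ (by norm_num) hz)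
    simp only [(DP_Fop hκ ha (c := c)).apply_zero, sub_zero] at h
    refine h.trans (mul_le_mul (by linarith) (mono _ _ (by norm_num) hBw) (Hn_nonneg _ _)
      (by linarith))
  have b4 : hs 4 (Fop κ a c w) ≤ P := by
    have h := hC3 w (fun _ => 0) hw HInf.zero (mono _ _ (by norm_num) hBw)
      (mono _ _ (by norm_num) hz)
    simp only [(DP_Fop hκ ha (c := c)).apply_zero, sub_zero] at h
    refine h.trans (mul_le_mul (by linarith) (mono _ _ (by norm_num) hBw) (Hn_nonneg _ _)
      (by linarith))
  have hP : 0 ≤ P := by positivity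
  have hH := Hn_nonneg 4 d
  have h4 : |cut M (Hn 4 v ^ 2) - cut M (Hn 4 w ^ 2)| ≤ D * Hn 4 d := by
    refine (abs_cut_sub_le _ _).trans ?_
    have := abs_Hn_sq_sub_le hv hw (mono v 4 (by norm_num) hBv) (mono w 4 (by norm_num) hBw)
    simp only [D]
    rw [div_mul_eq_mul_div]
    exact div_le_div_of_nonneg_right this (sq_nonneg M)
  have h5 : |pair 4 d (Fop κ a c w)| ≤ 2 * (Hn 4 d * P) := by
    refine (abs_pair_le 4 hd hFw).trans ?_
    have := mul_le_mul (hs_le_Hn (Nat.zero_le 4) d) b0 (hs_nonneg _ _) hH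
    have := mul_le_mul (hs_le_Hn (le_refl 4) d) b4 (hs_nonneg _ _) hH
    linarith
  have h6 : (cut M (Hn 4 v ^ 2) - cut M (Hn 4 w ^ 2)) * pair 4 d (Fop κ a c w) ≤
      (D * Hn 4 d) * (2 * (Hn 4 d * P)) := by
    refine (le_abs_self _).trans ?_
    rw [abs_mul]
    exact mul_le_mul h4 h5 (abs_nonneg _) (by positivity)
  have h7 : Hn 4 d ^ 2 ≤ 5 * eng 4 d := by
    have := Hn_sq_le hd 4
    norm_num at this
    exact this
  have h8 := hC1 v w hv hw (mono v 6 (by norm_num) hBv) (mono w 6 (by norm_num) hBw)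
  have h9 := mul_nonneg h1 (eng_nonneg 4 d)
  have h10 : cut M (Hn 4 v ^ 2) * (2 * pair 4 d fun x => Fop κ a c v x - Fop κ a c w x) ≤
      C1 * eng 4 d :=
    (mul_le_mul_of_nonneg_left h8 (cut_nonneg _ _)).trans
      ((mul_le_mul_of_nonneg_right (cut_le_one _ _) h9).trans (by rw [one_mul]))
  have h11 : D * P * Hn 4 d ^ 2 ≤ D * P * (5 * eng 4 d) :=
    mul_le_mul_of_nonneg_left h7 (by positivity)
  nlinarith

/-- Two smoothings of the truncated problem have close solutions. -/
lemma smoothed_sub_le (hc : 0 < c) (hM : 0 < M) (u₀ : ℝ → ℝ) (T : ℝ) :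
    ∃ K, 0 ≤ K ∧ ∀ j₁ δ₁ u j₂ δ₂ w, IsSmoothing j₁ δ₁ → 0 ≤ δ₁ → IsSmoothing j₂ δ₂ → 0 ≤ δ₂ →
      u 0 = u₀ → w 0 = u₀ → IsC1 T u (fun t => conv j₁ (cutF κ a c M (conv j₁ (u t)))) →
      IsC1 T w (fun t => conv j₂ (cutF κ a c M (conv j₂ (w t)))) → ∀ t ∈ Icc 0 T,
        hs 0 (fun x => u t x - w t x) ^ 2 ≤ K * (δ₁ + δ₂) := by
  obtain ⟨B, hB0, hB⟩ := smoothed_bound hκ ha hc hM T 10 u₀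
  obtain ⟨C, hC0, hC⟩ := cutF_sub_energy hκ ha (M := M) hc hB0
  obtain ⟨C1, h1, hC1⟩ := cutF_smoothing hκ ha (c := c) (M := M) 0 hB0
  obtain ⟨C2, h2, hC2⟩ := cutF_smoothing hκ ha (c := c) (M := M) 4 hB0
  refine ⟨4 * B * (C1 + C2) * |T| * Real.exp (C * |T|), by positivity,
    fun j₁ δ₁ u j₂ δ₂ w hj₁ hδ₁ hj₂ hδ₂ hu0 hw0 hu hw t ht => ?_⟩
  have bu := hB j₁ δ₁ u hj₁ hu0 hu
  have bw := hB j₂ δ₂ w hj₂ hw0 hw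
  have key : ∀ t ∈ Icc 0 T, 2 * pair 4 (fun x => u t x - w t x) (fun x =>
      conv j₁ (cutF κ a c M (conv j₁ (u t))) x - conv j₂ (cutF κ a c M (conv j₂ (w t))) x) ≤
      C * eng 4 (fun x => u t x - w t x) + 4 * B * (C1 + C2) * (δ₁ + δ₂) := fun t ht => by
    have iu := hu.left t ht
    have iw := hw.left t ht
    have gu := hu.right t ht
    have gw := hw.right t ht
    have fu := hInf_cutF hκ ha (c := c) (M := M) iu
    have fw := hInf_cutF hκ ha (c := c) (M := M) iw
    have hd := iu.sub iw
    -- Both smoothed operators are compared with the unsmoothed one; the bounds in `H^10` make the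
    -- errors of order `δ₁` and `δ₂` at the level `H^4`.
    have e : (fun x => conv j₁ (cutF κ a c M (conv j₁ (u t))) x -
        conv j₂ (cutF κ a c M (conv j₂ (w t))) x) = fun x =>
        (cutF κ a c M (u t) x - cutF κ a c M (w t) x) +
        ((conv j₁ (cutF κ a c M (conv j₁ (u t))) x - cutF κ a c M (u t) x) -
        (conv j₂ (cutF κ a c M (conv j₂ (w t))) x - cutF κ a c M (w t) x)) := by
      ext x; ring
    have hr := (gu.sub fu).sub (gw.sub fw)
    rw [e, pair_add 4 hd (fu.sub fw) hr, mul_add]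
    refine add_le_add (hC _ _ iu iw ((Hn_mono (by norm_num) _).trans (bu t ht))
      ((Hn_mono (by norm_num) _).trans (bw t ht))) ?_
    have hsd : ∀ k ≤ 4, hs k (fun x => u t x - w t x) ≤ 2 * B := fun k hk => by
      have h3 := (hs_le_Hn (show k ≤ 10 by omega) _).trans (bu t ht)
      have h4 := (hs_le_Hn (show k ≤ 10 by omega) _).trans (bw t ht)
      linarith [hs_sub_le k iu iw]
    have r0 := hs_sub_le 0 (gu.sub fu) (gw.sub fw)
    have r4 := hs_sub_le 4 (gu.sub fu) (gw.sub fw)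
    have s1 := hC1 j₁ δ₁ (u t) hj₁ hδ₁ iu ((Hn_mono (by norm_num) _).trans (bu t ht))
    have s2 := hC1 j₂ δ₂ (w t) hj₂ hδ₂ iw ((Hn_mono (by norm_num) _).trans (bw t ht))
    have s3 := hC2 j₁ δ₁ (u t) hj₁ hδ₁ iu (bu t ht)
    have s4 := hC2 j₂ δ₂ (w t) hj₂ hδ₂ iw (bw t ht)
    have p := (le_abs_self _).trans (abs_pair_le 4 hd hr)
    have q0 := mul_le_mul (hsd 0 (by norm_num)) (r0.trans (add_le_add s1 s2)) (hs_nonneg _ _)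
      (by positivity)
    have q4 := mul_le_mul (hsd 4 le_rfl) (r4.trans (add_le_add s3 s4)) (hs_nonneg _ _)
      (by positivity)
    linarith
  have hT : 0 ≤ T := ht.1.trans ht.2
  have h3 := gronwall (by positivity) hC0 (fun t ht => (hu.sub hw).eng_hasDeriv 4 ht) key ht
  have h4 : eng 4 (fun x => u 0 x - w 0 x) = 0 := by
    have : (fun x => u 0 x - w 0 x) = fun _ => 0 := by ext x; rw [hu0, hw0, sub_self]
    rw [this, eng, hs_zero_fun, hs_zero_fun]; simp
  rw [h4, zero_add] at h3
  have h5 : hs 0 (fun x => u t x - w t x) ^ 2 ≤ eng 4 (fun x => u t x - w t x) :=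
    le_add_of_nonneg_right (sq_nonneg _)
  refine h5.trans (h3.trans ?_)
  calc _ ≤ 4 * B * (C1 + C2) * (δ₁ + δ₂) * T * Real.exp (C * T) := by
        gcongr <;> exact ht.2
    _ = _ := by rw [abs_of_nonneg hT]; ring

lemma isC0_cutF {T : ℝ} {u : ℝ → ℝ → ℝ} (hu : IsC0 T u) (hH : ∀ t ∈ Icc 0 T, HInf (u t)) :
    IsC0 T (fun t => cutF κ a c M (u t)) := by
  intro k t ht
  obtain ⟨B, hB⟩ := hu.exists_bound hH (k + 5)
  have hB0 : 0 ≤ B := (Hn_nonneg _ _).trans (hB t ht)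
  obtain ⟨C, hC0, hC⟩ := cutF_lipschitz hκ ha (c := c) (M := M) k hB0
  have h1 : Tendsto (fun τ => C * Hn (k + 4) (fun x => u τ x - u t x)) (𝓝[Icc 0 T] t) (𝓝 0) := by
    have h2 : Tendsto (fun τ => ∑ l ∈ Finset.range (k + 4 + 1), hs l (fun x => u τ x - u t x) ^ 2)
        (𝓝[Icc 0 T] t) (𝓝 (∑ l ∈ Finset.range (k + 4 + 1), (0 : ℝ) ^ 2)) :=
      tendsto_finsetSum _ fun l _ => (hu l t ht).pow 2
    simpa [Hn] using h2.sqrt.const_mul C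
  refine squeeze_zero' (Eventually.of_forall fun _ => hs_nonneg _ _) ?_ h1
  filter_upwards [self_mem_nhdsWithin] with τ hτ
  exact hC _ _ (hH τ hτ) (hH t ht) (hB τ hτ) (hB t ht)

lemma exists_isC1_cutF (hc : 0 < c) (hM : 0 < M) {u₀ : ℝ → ℝ} (hu₀ : HInf u₀) {T : ℝ}
    (hT : 0 ≤ T) : ∃ v : ℝ → ℝ → ℝ, v 0 = u₀ ∧ IsC1 T v fun t => cutF κ a c M (v t) := by
  have hδ : ∀ n : ℕ, (0 : ℝ) < 1 / (n + 1) := fun n => by positivity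
  choose j hj using fun n => exists_smoothing (hδ n)
  choose u hu0 hu using fun n => exists_isC1_smoothed hκ ha (c := c) hM (hj n) hu₀ hT
  choose B hB0 hB using fun k => smoothed_bound hκ ha hc hM T k u₀
  have hBu : ∀ k n, ∀ t ∈ Icc 0 T, Hn k (u n t) ≤ B k := fun k n =>
    hB k _ _ _ (hj n) (hu0 n) (hu n)
  obtain ⟨K, hK0, hK⟩ := smoothed_sub_le hκ ha hc hM u₀ T
  have htend : Tendsto (fun n : ℕ => (1 : ℝ) / (n + 1)) atTop (𝓝 0) :=
    tendsto_one_div_add_atTop_nhds_zero_nat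
  have hcau : ∀ k : ℕ, ∀ ε > 0, ∃ N, ∀ m ≥ N, ∀ n ≥ N, ∀ t ∈ Icc 0 T,
      hs k (fun x => u m t x - u n t x) ≤ ε := by
    intro k ε hε
    -- Convergence in `L²` is interpolated with the bound `P` in `H^(2k)`: the square of the `H^k`
    -- seminorm is at most `(ε²/P) P`. The threshold below asks each index for half of `(ε²/P)²`.
    set P := 2 * B (k + k) + 1
    have hP : 0 < P := by have := hB0 (k + k); positivity
    have hlim : Tendsto (fun n : ℕ => K * ((1 : ℝ) / (n + 1))) atTop (𝓝 0) := by
      simpa using htend.const_mul K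
    obtain ⟨N, hN⟩ := eventually_atTop.1 (hlim.eventually_lt_const
      (show 0 < (ε ^ 2 / P) ^ 2 / 2 by positivity))
    refine ⟨N, fun m hm n hn t ht => ?_⟩
    have h1 := hK _ _ _ _ _ _ (hj m) (hδ m).le (hj n) (hδ n).le (hu0 m) (hu0 n) (hu m) (hu n) t ht
    have hd := ((hu m).left t ht).sub ((hu n).left t ht)
    have h2 : hs 0 (fun x => u m t x - u n t x) ≤ ε ^ 2 / P := by
      refine le_of_sq_le_sq ?_ (by positivity)
      have := hN m hm
      have := hN n hn
      linarith
    have h3 : hs (k + k) (fun x => u m t x - u n t x) ≤ P := by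
      have h4 := (hs_le_Hn le_rfl _).trans (hBu (k + k) m t ht)
      have h5 := (hs_le_Hn le_rfl _).trans (hBu (k + k) n t ht)
      linarith [hs_sub_le (k + k) ((hu m).left t ht) ((hu n).left t ht)]
    refine le_of_sq_le_sq ((hs_sq_le_mul hd k).trans ?_) hε.le
    calc _ ≤ ε ^ 2 / P * P := mul_le_mul h2 h3 (hs_nonneg _ _) (by positivity)
      _ = ε ^ 2 := by field_simp
  have hex : ∀ t, ∃ g, t ∈ Icc 0 T → HInf g ∧
      (∀ k x, Tendsto (fun n => 𝒟 k (u n t) x) atTop (𝓝 (𝒟 k g x))) ∧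
      ∀ (k n : ℕ) (ε : ℝ), 0 ≤ ε → (∀ᶠ m in atTop, hs k (fun x => u n t x - u m t x) ≤ ε) →
        hs k (fun x => u n t x - g x) ≤ ε := fun t => by
    by_cases ht : t ∈ Icc 0 T
    · obtain ⟨g, hg⟩ := exists_hInf_limit (f := fun n => u n t) (fun n => (hu n).left t ht)
        fun k ε hε => by
          obtain ⟨N, hN⟩ := hcau k ε hε
          exact ⟨N, fun m hm n hn => hN m hm n hn t ht⟩
      exact ⟨g, fun _ => hg⟩
    · exact ⟨0, fun h => absurd h ht⟩
  choose v hv using hex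
  have hvI : ∀ t ∈ Icc 0 T, HInf (v t) := fun t ht => (hv t ht).1
  have huv : ∀ k : ℕ, ∀ ε > 0, ∀ᶠ n in atTop, ∀ t ∈ Icc 0 T,
      hs k (fun x => u n t x - v t x) ≤ ε := fun k ε hε => by
    obtain ⟨N, hN⟩ := hcau k ε hε
    filter_upwards [eventually_ge_atTop N] with n hn t ht
    refine (hv t ht).2.2 k n ε hε.le ?_
    filter_upwards [eventually_ge_atTop N] with m hm
    exact hN n hn m hm t ht
  have hvB : ∀ k, ∀ t ∈ Icc 0 T, Hn k (v t) ≤ (k + 1) * (B k + 1) := fun k t ht => by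
    refine Hn_le_of_hs_le (by linarith [hB0 k]) fun l hl => ?_
    obtain ⟨n, hn⟩ := (huv l 1 one_pos).exists
    have h1 := hs_sub_le l ((hu n).left t ht) (((hu n).left t ht).sub (hvI t ht))
    have h2 := (hs_le_Hn hl _).trans (hBu k n t ht)
    have h3 := hn t ht
    simp only [sub_sub_cancel] at h1
    linarith
  have hv0 : v 0 = u₀ := by
    ext x
    have h1 := (hv 0 ⟨le_rfl, hT⟩).2.1 0 x
    simp only [iteratedDeriv_zero, hu0] at h1
    exact tendsto_nhds_unique h1 tendsto_const_nhds |>.symm ▸ rfl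
  have hvC : IsC0 T v := by
    intro k t ht
    rw [Metric.tendsto_nhds]
    intro ε hε
    obtain ⟨n, hn⟩ := (huv k (ε / 4) (by positivity)).exists
    filter_upwards [((hu n).isC0 k t ht).eventually_lt_const (show 0 < ε / 4 by positivity),
      self_mem_nhdsWithin] with τ h1 hτ
    rw [dist_zero_right, Real.norm_of_nonneg (hs_nonneg _ _)]
    have h2 := hs_sub_le_hs_sub_add k (hvI τ hτ) ((hu n).left τ hτ) (hvI t ht)
    have h3 := hs_sub_le_hs_sub_add k ((hu n).left τ hτ) ((hu n).left t ht) (hvI t ht)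
    have h4 := hn t ht
    have h5 := hn τ hτ
    rw [hs_sub_comm k ((hu n).left τ hτ) (hvI τ hτ)] at h5
    linarith
  have hgI : ∀ t ∈ Icc 0 T, HInf (cutF κ a c M (v t)) := fun t ht => hInf_cutF hκ ha (hvI t ht)
  have hgC : IsC0 T fun t => cutF κ a c M (v t) := isC0_cutF hκ ha hvC hvI
  -- The smoothed right-hand sides converge uniformly in time: half of `ε` is the smoothing error
  -- and half the Lipschitz dependence on `u n - v`.
  have hgun : ∀ k : ℕ, ∀ ε > 0, ∀ᶠ n in atTop, ∀ t ∈ Icc 0 T,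
      hs k (fun x => conv (j n) (cutF κ a c M (conv (j n) (u n t))) x - cutF κ a c M (v t) x) ≤ ε := by
    intro k ε hε
    set Q := B (k + 6) + ((k + 5 : ℕ) + 1) * (B (k + 5) + 1)
    have hQ1 : 0 ≤ ((k + 5 : ℕ) + 1 : ℝ) * (B (k + 5) + 1) := by
      have := hB0 (k + 5); positivity
    have hQ : 0 ≤ Q := add_nonneg (hB0 _) hQ1
    obtain ⟨C1, h1, hC1⟩ := cutF_smoothing hκ ha (c := c) (M := M) k hQ
    obtain ⟨C2, h2, hC2⟩ := cutF_lipschitz hκ ha (c := c) (M := M) k hQ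
    have e1 : ∀ᶠ n : ℕ in atTop, C1 * ((1 : ℝ) / (n + 1)) < ε / 2 := by
      have : Tendsto (fun n : ℕ => C1 * ((1 : ℝ) / (n + 1))) atTop (𝓝 0) := by
        simpa using htend.const_mul C1
      exact this.eventually_lt_const (by positivity)
    set ρ := ε / (2 * (C2 + 1) * (k + 5)) with hρ
    have hρ0 : 0 < ρ := by positivity
    have e2 : ∀ᶠ n : ℕ in atTop, ∀ l ≤ k + 4, ∀ t ∈ Icc 0 T,
        hs l (fun x => u n t x - v t x) ≤ ρ := by
      have := (Finset.eventually_all (Finset.range (k + 4 + 1)) (l := (atTop : Filter ℕ))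
        (p := fun l n => ∀ t ∈ Icc 0 T, hs l (fun x => u n t x - v t x) ≤ ρ)).2
        fun l _ => huv l ρ hρ0
      filter_upwards [this] with n hn l hl
      exact hn l (Finset.mem_range.2 (by omega))
    filter_upwards [e1, e2] with n h3 h4 t ht
    have iu := (hu n).left t ht
    refine (hs_sub_le_hs_sub_add k ((hu n).right t ht)
      (hInf_cutF hκ ha (c := c) (M := M) iu) (hgI t ht)).trans ?_
    have bu : Hn (k + 6) (u n t) ≤ Q := (hBu (k + 6) n t ht).trans (le_add_of_nonneg_right hQ1)
    have b1 := hC1 _ _ _ (hj n) (hδ n).le iu bu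
    have b2 := hC2 _ _ iu (hvI t ht) ((Hn_mono (by omega) _).trans bu)
      ((hvB (k + 5) t ht).trans (le_add_of_nonneg_left (hB0 _)))
    have b3 := Hn_le_of_hs_le hρ0.le fun l hl => h4 l hl t ht
    have b4 : C2 * Hn (k + 4) (fun x => u n t x - v t x) ≤ ε / 2 := by
      calc _ ≤ (C2 + 1) * (((k + 4 : ℕ) + 1) * ρ) :=
            mul_le_mul (by linarith) b3 (Hn_nonneg _ _) (by positivity)
        _ = ε / 2 := by rw [hρ]; push_cast; field_simp; ring
    linarith
  -- The equation for the limit is first obtained at each fixed `x`; continuity of the right-hand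
  -- side in all `H^k` then upgrades it to `IsC1`.
  refine ⟨v, hv0, isC1_of_pointwise hvI hgI hgC fun t ht x => ?_⟩
  have hcont : ContinuousOn (fun t => cutF κ a c M (v t) x) (Icc 0 T) := by
    simpa using hgC.continuousOn_apply hgI 0 x
  refine hasDerivWithinAt_of_uniform_limit (f := fun n τ => u n τ x)
    (f' := fun n τ => conv (j n) (cutF κ a c M (conv (j n) (u n τ))) x) (convex_Icc 0 T)
    (fun n t ht => (hu n).hasDeriv_apply ht x) (fun t ht => ?_) (fun ε hε => ?_) hcont ht
  · simpa using (hv t ht).2.1 0 x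
  · filter_upwards [hgun 0 (ε / 2) (by positivity), hgun 1 (ε / 2) (by positivity)] with n h0 h1 t ht
    have h2 := abs_le_hs (((hu n).right t ht).sub (hgI t ht)) x
    linarith [h0 t ht, h1 t ht]

end Truncated

/-! ### Weighted energy estimates -/

/-- The bilinear form with weight `G`. -/
def tri (G f h : ℝ → ℝ) : ℝ := ∫ x, G x * f x * h x

lemma tri_comm (G f h : ℝ → ℝ) : tri G f h = tri G h f := by
  simp only [tri, mul_right_comm]

section Tri

variable {G f h : ℝ → ℝ} (hG : BInf G)

include hG

lemma integrable_tri (hf : MemLp f 2 volume) (hh : MemLp h 2 volume) :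
    Integrable (fun x => G x * f x * h x) volume := by
  obtain ⟨C, _, hC⟩ := hG.bdd0
  exact integrable_mul (memLp_bdd_mul hG.smooth.continuous.aestronglyMeasurable hf hC) hh

lemma abs_tri_le (hf : MemLp f 2 volume) (hh : MemLp h 2 volume) {C : ℝ} (hC : ∀ x, |G x| ≤ C) :
    |tri G f h| ≤ C * (l2 f * l2 h) := by
  refine (abs_integral_mul_le (memLp_bdd_mul hG.smooth.continuous.aestronglyMeasurable hf hC)
    hh).trans ?_
  rw [← mul_assoc]
  exact mul_le_mul_of_nonneg_right (l2_bdd_mul_le hf hC) (l2_nonneg h)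

lemma tri_deriv (hf : HInf f) (hh : HInf h) :
    tri G f (𝒟 1 h) = - tri (𝒟 1 G) f h - tri G (𝒟 1 f) h := by
  have h1 := integral_mul_deriv (hG.mul_hInf hf) hh
  have h2 : 𝒟 1 (fun x => G x * f x) = fun x => 𝒟 1 G x * f x + G x * 𝒟 1 f x := by
    rw [iteratedDeriv_one]
    ext x
    exact ((hG.hasDerivAt0 x).mul (hf.hasDerivAt0 x)).deriv
  rw [h2] at h1
  rw [tri, h1, tri, tri, neg_sub_left, ← integral_add (integrable_tri hG (hf.mem 1) hh.mem0)
    (integrable_tri (hG.iter 1) hf.mem0 hh.mem0)]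
  congr 2; ext x; ring

lemma tri_self_deriv (hf : HInf f) : tri G f (𝒟 1 f) = - (1 / 2) * tri (𝒟 1 G) f f := by
  have h1 := tri_deriv hG hf hf
  rw [tri_comm G (𝒟 1 f) f] at h1
  linarith

/-- The ratio `2 : 3` is the only one for which the quadratic terms in `∂f` cancel. The condition on
the weight is chosen to produce this combination. -/
lemma tri_dispersive (hf : HInf f) :
    2 * tri G f (𝒟 3 f) + 3 * tri (𝒟 1 G) f (𝒟 2 f) = 1 / 2 * tri (𝒟 3 G) f f := by
  have h1 := tri_deriv hG hf (hf.iter 2)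
  have h2 := tri_self_deriv hG (hf.iter 1)
  have h3 := tri_deriv (hG.iter 1) hf (hf.iter 1)
  have h4 := tri_self_deriv (hG.iter 2) hf
  simp only [iteratedDeriv_comp_iteratedDeriv, Nat.reduceAdd] at h1 h2 h3 h4
  linarith

lemma tri_iter_four (hf : HInf f) :
    tri G f (𝒟 4 f) = tri (𝒟 2 G) f (𝒟 2 f) + 2 * tri (𝒟 1 G) (𝒟 1 f) (𝒟 2 f) +
      tri G (𝒟 2 f) (𝒟 2 f) := by
  have h1 := tri_deriv hG hf (hf.iter 3)
  have h2 := tri_deriv (hG.iter 1) hf (hf.iter 2)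
  have h3 := tri_deriv hG (hf.iter 1) (hf.iter 2)
  simp only [iteratedDeriv_comp_iteratedDeriv, Nat.reduceAdd] at h1 h2 h3
  linarith

end Tri

/-- Absorption of the lower order terms created by the weight. -/
lemma weighted_absorb {P Q φ₀ : ℝ} (hP : 0 ≤ P) (hφ₀ : 0 < φ₀) :
    ∃ K, 0 ≤ K ∧ ∀ X Y Z : ℝ, 0 ≤ X → 0 ≤ Y → 0 ≤ Z → Y ^ 2 ≤ Z * X →
      P * ((Z + Y) * Z) - 2 * φ₀ * X ^ 2 + Q * (Z * X) + Q * (Y * X) ≤ K * Z ^ 2 := by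
  set S := Q + Q ^ 2 / (2 * φ₀) + P / 2 with hS
  refine ⟨3 / 2 * P + S ^ 2 / (4 * φ₀), by positivity, fun X Y Z hX hY hZ h => ?_⟩
  have h1 : Q * (Y * X) ≤ φ₀ / 2 * X ^ 2 + Q ^ 2 / (2 * φ₀) * Y ^ 2 := by
    have : 0 ≤ (φ₀ * X - Q * Y) ^ 2 / (2 * φ₀) := by positivity
    have e : (φ₀ * X - Q * Y) ^ 2 / (2 * φ₀) =
        φ₀ / 2 * X ^ 2 - Q * (Y * X) + Q ^ 2 / (2 * φ₀) * Y ^ 2 := by field_simp; ring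
    linarith
  have h2 : Q ^ 2 / (2 * φ₀) * Y ^ 2 ≤ Q ^ 2 / (2 * φ₀) * (Z * X) :=
    mul_le_mul_of_nonneg_left h (by positivity)
  have h3 : P * (Y * Z) ≤ P * ((Z * X + Z ^ 2) / 2) :=
    mul_le_mul_of_nonneg_left (by nlinarith [sq_nonneg (Y - Z)]) hP
  have h4 : S * (Z * X) ≤ φ₀ * X ^ 2 + S ^ 2 / (4 * φ₀) * Z ^ 2 := by
    have : 0 ≤ (2 * φ₀ * X - S * Z) ^ 2 / (4 * φ₀) := by positivity
    have e : (2 * φ₀ * X - S * Z) ^ 2 / (4 * φ₀) =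
        φ₀ * X ^ 2 - S * (Z * X) + S ^ 2 / (4 * φ₀) * Z ^ 2 := by field_simp; ring
    linarith
  have h5 : S * (Z * X) = Q * (Z * X) + Q ^ 2 / (2 * φ₀) * (Z * X) + P / 2 * (Z * X) := by
    rw [hS]; ring
  have h6 : 0 ≤ φ₀ * X ^ 2 := by positivity
  linarith

/-- Uniform bounds for the derivatives of order at most three of a coefficient. -/
lemma BInf.comp_iter_bound {F : ℝ → ℝ} (hF : BInf F) {i : ℕ} (hi : i ≤ 3) (B : ℝ) :
    ∃ C, 0 ≤ C ∧ ∀ v, HInf v → Hn 4 v ≤ B → ∀ x, |𝒟 i (fun x => F (v x)) x| ≤ C := by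
  obtain ⟨r, hr, h⟩ := (DP.coef hF).exists_iter i
  obtain ⟨C, hC0, hC⟩ := (hr.weaken (m' := 3) le_rfl le_rfl (by omega)).sup_bound B
  exact ⟨C, hC0, fun v hv hB x => by rw [h v hv.smooth]; exact hC v hv hB x⟩

section Weighted

variable {κ a : ℝ → ℝ} (hκ : BInf κ) (ha : BInf a) {φ : ℝ → ℝ} (hφ : BInf φ) {φ₀ : ℝ}
  {s : ℕ} (hs4 : 4 ≤ s)

-- Integration by parts produces the dissipation `-2 ∫ φ(v) (∂^(s+2) v)²`, bounded above by the
-- lower bound of `φ`; the commutators are absorbed in it by `weighted_absorb`. Its factor `c` is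
-- shared by all these terms, so nothing is divided by `c`.
include hφ in
lemma weighted_iter_four (hφ₀ : 0 < φ₀) (hlo : ∀ y, φ₀ ≤ φ y) (s : ℕ) (B : ℝ) :
    ∃ C, 0 ≤ C ∧ ∀ v, HInf v → Hn 4 v ≤ B →
      -(∫ x, (𝒟 1 φ (v x) * 𝒟 4 v x * 𝒟 s v x + 2 * (φ (v x) * 𝒟 (s + 4) v x)) * 𝒟 s v x) ≤
        C * hs s v ^ 2 := by
  obtain ⟨D, hD0, hD⟩ := (hφ.iter 1).bdd0
  obtain ⟨C1, h1, hC1⟩ := hφ.comp_iter_bound (i := 1) (by norm_num) B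
  obtain ⟨C2, h2, hC2⟩ := hφ.comp_iter_bound (i := 2) (by norm_num) B
  obtain ⟨K, hK0, hK⟩ := weighted_absorb (P := D * |B|) (Q := 2 * C2 + 4 * C1) (by positivity) hφ₀
  refine ⟨K, hK0, fun v hv hB => ?_⟩
  have hB0 : 0 ≤ B := (Hn_nonneg 4 v).trans hB
  have hw := hv.iter s
  have hG := hφ.comp hv.bInf
  have hG1 := (hφ.iter 1).comp hv.bInf
  have hk : ∀ k, 𝒟 k (𝒟 s v) = 𝒟 (s + k) v := fun k => by
    rw [iteratedDeriv_comp_iteratedDeriv, add_comm]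
  have e : ∫ x, (𝒟 1 φ (v x) * 𝒟 4 v x * 𝒟 s v x + 2 * (φ (v x) * 𝒟 (s + 4) v x)) * 𝒟 s v x =
      (∫ x, (𝒟 1 φ (v x) * 𝒟 4 v x) * 𝒟 s v x * 𝒟 s v x) +
        2 * tri (fun x => φ (v x)) (𝒟 s v) (𝒟 4 (𝒟 s v)) := by
    rw [tri, ← integral_const_mul, ← integral_add
      (integrable_tri (hG1.mul (hv.iter 4).bInf) hw.mem0 hw.mem0)
      ((integrable_tri hG hw.mem0 (hw.mem 4)).const_mul 2)]
    congr 1; ext x; rw [hk]; ring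
  have b1 : |∫ x, (𝒟 1 φ (v x) * 𝒟 4 v x) * 𝒟 s v x * 𝒟 s v x| ≤
      D * |B| * ((hs s v + hs (s + 1) v) * hs s v) := by
    -- A bound in `H^4` controls `∂⁴v` in `L²` but not its supremum, so one of the two factors `∂ˢv`
    -- takes the supremum norm, at the price of one derivative.
    have hsup : ∀ x, |𝒟 1 φ (v x) * 𝒟 s v x| ≤ D * (hs s v + hs (s + 1) v) := fun x => by
      rw [abs_mul]
      exact mul_le_mul (hD _) (abs_iter_le_hs hv s x) (abs_nonneg _) hD0
    have e1 : ∫ x, (𝒟 1 φ (v x) * 𝒟 4 v x) * 𝒟 s v x * 𝒟 s v x =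
        tri (fun x => 𝒟 1 φ (v x) * 𝒟 s v x) (𝒟 4 v) (𝒟 s v) := by
      rw [tri]; congr 1; ext x; ring
    rw [e1]
    refine (abs_tri_le (hG1.mul hw.bInf) (hv.mem 4) hw.mem0 hsup).trans ?_
    have h3 : l2 (𝒟 4 v) ≤ |B| := ((hs_le_Hn (le_refl 4) v).trans hB).trans (le_abs_self B)
    have h4 := mul_le_mul_of_nonneg_right h3 (l2_nonneg (𝒟 s v))
    refine (mul_le_mul_of_nonneg_left h4
      (mul_nonneg hD0 (add_nonneg (hs_nonneg s v) (hs_nonneg (s + 1) v)))).trans (le_of_eq ?_)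
    rw [hs, hs]; ring
  have b2 : |tri (𝒟 2 fun x => φ (v x)) (𝒟 s v) (𝒟 2 (𝒟 s v))| ≤ C2 * (hs s v * hs (s + 2) v) := by
    have := abs_tri_le (hG.iter 2) hw.mem0 (hw.mem 2) (hC2 v hv hB)
    rwa [hk] at this ⊢
  have b3 : |tri (𝒟 1 fun x => φ (v x)) (𝒟 1 (𝒟 s v)) (𝒟 2 (𝒟 s v))| ≤
      C1 * (hs (s + 1) v * hs (s + 2) v) := by
    have := abs_tri_le (hG.iter 1) (hw.mem 1) (hw.mem 2) (hC1 v hv hB)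
    rwa [hk, hk] at this ⊢
  have b4 : φ₀ * hs (s + 2) v ^ 2 ≤ tri (fun x => φ (v x)) (𝒟 2 (𝒟 s v)) (𝒟 2 (𝒟 s v)) := by
    rw [hk, hs, l2_sq (hv.mem _), tri, ← integral_const_mul]
    have hi := integrable_tri hG (hv.mem (s + 2)) (hv.mem (s + 2))
    refine integral_mono ((hv.mem _).integrable_sq.const_mul _) hi fun x => ?_
    simp only
    rw [mul_assoc, ← pow_two]
    exact mul_le_mul_of_nonneg_right (hlo _) (sq_nonneg _)
  have hfin := hK _ _ _ (hs_nonneg (s + 2) v) (hs_nonneg (s + 1) v) (hs_nonneg s v)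
    (hs_logconvex hv s)
  rw [e, tri_iter_four hG hw]
  have c1 := (abs_le.1 b1).1
  have c2 := (abs_le.1 b2).1
  have c3 := (abs_le.1 b3).1
  have z1 : 0 ≤ C1 * (hs s v * hs (s + 2) v) :=
    mul_nonneg h1 (mul_nonneg (hs_nonneg _ _) (hs_nonneg _ _))
  have z2 : 0 ≤ C2 * (hs (s + 1) v * hs (s + 2) v) :=
    mul_nonneg h2 (mul_nonneg (hs_nonneg _ _) (hs_nonneg _ _))
  linarith

-- By `hrel` the two highest terms form the combination of `tri_dispersive`, leaving `½ ∫ G_xxx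
-- (∂ˢv)²`; the term with `b` is a total derivative up to `b_x`. Every coefficient that remains has
-- order at most three in `v`, so its supremum is controlled by `H^4`.
include hκ ha hφ hs4 in
lemma weighted_Nop (hrel : ∀ y, 3 * 𝒟 1 (fun y => φ y * κ y) y = 2 * (s + 2) * (φ y * deriv κ y))
    (B : ℝ) : ∃ C, 0 ≤ C ∧ ∀ v, HInf v → Hn 4 v ≤ B →
      |∫ x, (𝒟 1 φ (v x) * Nop κ a v x * 𝒟 s v x + 2 * (φ (v x) * 𝒟 s (Nop κ a v) x)) * 𝒟 s v x| ≤
        C * Hn s v ^ 2 := by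
  obtain ⟨b, r, hb, hr, hN⟩ := iter_Nop hκ ha (show 2 ≤ s by omega)
  obtain ⟨D, hD0, hD⟩ := (hφ.iter 1).bdd0
  obtain ⟨D', hD0', hD'⟩ := hφ.bdd0
  obtain ⟨C1, h1, hC1⟩ := (DP_Nop hκ ha).sup_bound B
  obtain ⟨C3, h3, hC3⟩ := (hφ.mul hκ).comp_iter_bound (i := 3) le_rfl B
  obtain ⟨b', hb', hbd⟩ := (hb.coef_mul hφ).exists_iter 1
  obtain ⟨C4, h4, hC4⟩ := hb'.sup_bound B
  obtain ⟨C5, h5, hC5⟩ := hr.tame hs4 le_rfl B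
  refine ⟨D * C1 + 1 / 2 * C3 + C4 + 2 * (D' * C5), by positivity, fun v hv hB => ?_⟩
  have hw := hv.iter s
  have hk : ∀ k, 𝒟 k (𝒟 s v) = 𝒟 (s + k) v := fun k => by
    rw [iteratedDeriv_comp_iteratedDeriv, add_comm]
  have hφv := hφ.comp hv.bInf
  have hG := (hφ.mul hκ).comp hv.bInf
  have hφ1 := ((hφ.iter 1).comp hv.bInf).mul ((DP_Nop hκ ha).hInf hv).bInf
  have hbv := (hb.coef_mul hφ).bInf hv
  have hrv := hr.hInf hv
  have hG1 : ∀ x, 3 * 𝒟 1 (fun x => φ (v x) * κ (v x)) x =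
      2 * (s + 2) * (φ (v x) * (deriv κ (v x) * 𝒟 1 v x)) := fun x => by
    have : HasDerivAt (fun x => φ (v x) * κ (v x)) (𝒟 1 (fun y => φ y * κ y) (v x) * 𝒟 1 v x) x :=
      ((hφ.mul hκ).hasDerivAt0 (v x)).comp x (hv.hasDerivAt0 x)
    rw [iteratedDeriv_one, this.deriv]
    linear_combination 𝒟 1 v x * hrel (v x)
  have e : ∫ x, (𝒟 1 φ (v x) * Nop κ a v x * 𝒟 s v x + 2 * (φ (v x) * 𝒟 s (Nop κ a v) x)) * 𝒟 s v x =
      tri (fun x => 𝒟 1 φ (v x) * Nop κ a v x) (𝒟 s v) (𝒟 s v) +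
      (2 * tri (fun x => φ (v x) * κ (v x)) (𝒟 s v) (𝒟 3 (𝒟 s v)) +
        3 * tri (𝒟 1 fun x => φ (v x) * κ (v x)) (𝒟 s v) (𝒟 2 (𝒟 s v)) +
        2 * tri (fun x => φ (v x) * b v x) (𝒟 s v) (𝒟 1 (𝒟 s v)) +
        2 * tri (fun x => φ (v x)) (𝒟 s v) (r v)) := by
    simp only [tri, ← integral_const_mul]
    have i0 := integrable_tri hφ1 hw.mem0 hw.mem0
    have i1 := (integrable_tri hG hw.mem0 (hw.mem 3)).const_mul 2
    have i2 := (integrable_tri (hG.iter 1) hw.mem0 (hw.mem 2)).const_mul 3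
    have i3 := (integrable_tri hbv hw.mem0 (hw.mem 1)).const_mul 2
    have i4 := (integrable_tri hφv hw.mem0 hrv.mem0).const_mul 2
    have s1 := integral_add i1 i2
    have s2 := integral_add (i1.add i2) i3
    have s3 := integral_add ((i1.add i2).add i3) i4
    have s4 := integral_add i0 (((i1.add i2).add i3).add i4)
    simp only [Pi.add_apply] at s1 s2 s3 s4
    rw [← s1, ← s2, ← s3, ← s4]
    congr 1; ext x
    rw [hN v hv.smooth, hk, hk, hk]
    -- The identity `hG1`, multiplied by `∂ˢv ∂^(s+2) v`, trades the commutator `2 (s+2) φ κ' v_x`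
    -- for `3 G_x`.
    linear_combination (- (𝒟 s v x * 𝒟 (s + 2) v x)) * hG1 x
  have hH : hs s v ≤ Hn s v := hs_le_Hn le_rfl v
  have hs0 := hs_nonneg s v
  have hZ : hs s v * hs s v ≤ Hn s v ^ 2 := by
    rw [pow_two]; exact mul_le_mul hH hH hs0 (hs0.trans hH)
  have g0 := abs_tri_le hφ1 hw.mem0 hw.mem0 (C := D * C1) fun x => by
    rw [abs_mul]; exact mul_le_mul (hD _) (hC1 v hv hB x) (abs_nonneg _) hD0
  have g1 := abs_tri_le (hG.iter 3) hw.mem0 hw.mem0 (hC3 v hv hB)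
  have g2 := abs_tri_le (hbv.iter 1) hw.mem0 hw.mem0 (C := C4) fun x => by
    rw [hbd v hv.smooth]; exact hC4 v hv hB x
  have g3 := abs_tri_le hφv hw.mem0 hrv.mem0 (C := D') fun x => hD' (v x)
  have g4 : l2 (𝒟 s v) * l2 (r v) ≤ C5 * Hn s v ^ 2 := by
    calc l2 (𝒟 s v) * l2 (r v) ≤ Hn s v * (C5 * Hn s v) :=
          mul_le_mul hH (hC5 v hv hB) (l2_nonneg _) (hs0.trans hH)
      _ = _ := by ring
  have g0' := g0.trans (mul_le_mul_of_nonneg_left hZ (by positivity))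
  have g1' := g1.trans (mul_le_mul_of_nonneg_left hZ h3)
  have g2' := g2.trans (mul_le_mul_of_nonneg_left hZ h4)
  have g3' := g3.trans (mul_le_mul_of_nonneg_left g4 hD0')
  rw [e, tri_dispersive hG hw, tri_self_deriv hbv hw]
  rw [abs_le] at g0' g1' g2' g3' ⊢
  constructor <;> linarith [g0'.1, g0'.2, g1'.1, g1'.2, g2'.1, g2'.2, g3'.1, g3'.2]

include hκ ha hφ hs4 in
/-- The weighted energy estimate, uniform in the size `c ≤ 1` of the regularization. -/
lemma weighted_energy (hφ₀ : 0 < φ₀) (hlo : ∀ y, φ₀ ≤ φ y)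
    (hrel : ∀ y, 3 * 𝒟 1 (fun y => φ y * κ y) y = 2 * (s + 2) * (φ y * deriv κ y)) (B : ℝ) :
    ∃ C, 0 ≤ C ∧ ∀ c ∈ Icc (0 : ℝ) 1, ∀ v, HInf v → Hn 4 v ≤ B →
      2 * (∫ x, v x * Fop κ a c v x) +
        (∫ x, (𝒟 1 φ (v x) * Fop κ a c v x * 𝒟 s v x + 2 * (φ (v x) * 𝒟 s (Fop κ a c v) x)) *
          𝒟 s v x) ≤ C * eng s v := by
  obtain ⟨C1, h1, hC1⟩ := weighted_iter_four hφ hφ₀ hlo s B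
  obtain ⟨C2, h2, hC2⟩ := weighted_Nop hκ ha hφ hs4 hrel B
  obtain ⟨C3, h3, hC3⟩ := ((DP_Nop hκ ha).weaken (n' := s + 3) le_rfl (by omega) le_rfl).tame hs4
    (by omega) B
  refine ⟨(2 * C3 + C2 + C1) * (s + 1), by positivity, fun c hc v hv hB => ?_⟩
  have hNv := (DP_Nop hκ ha).hInf hv
  have hw := hv.iter s
  have e1 : ∫ x, v x * Fop κ a c v x = -(∫ x, v x * Nop κ a v x) - c * hs 2 v ^ 2 := by
    rw [← integral_mul_iter_four hv, ← integral_neg, ← integral_const_mul,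
      ← integral_sub (show Integrable (fun x => -(v x * Nop κ a v x)) volume from
        (integrable_mul hv.mem0 hNv.mem0).neg)
      ((integrable_mul hv.mem0 (hv.mem 4)).const_mul c)]
    congr 1; ext x; simp only [Fop]; ring
  have hF : 𝒟 s (Fop κ a c v) = fun x => - 𝒟 s (Nop κ a v) x - c * 𝒟 (s + 4) v x := by
    have : Fop κ a c v = fun x => (-1) * Nop κ a v x - c * 𝒟 4 v x := by
      ext x; simp only [Fop]; ring
    rw [this, iter_sub (hNv.const_mul _).smooth ((hv.iter 4).const_mul _).smooth, iter_const_mul,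
      iter_const_mul, iteratedDeriv_comp_iteratedDeriv]
    ext x; ring
  have hφv := hφ.comp hv.bInf
  have hφ1 := (hφ.iter 1).comp hv.bInf
  have i1 : Integrable (fun x => (𝒟 1 φ (v x) * Nop κ a v x * 𝒟 s v x +
      2 * (φ (v x) * 𝒟 s (Nop κ a v) x)) * 𝒟 s v x) volume := by
    refine integrable_mul ?_ hw.mem0
    exact (((hφ1.mul_hInf hNv).mul hw).add ((hφv.mul_hInf (hNv.iter s)).const_mul 2)).mem0
  have i2 : Integrable (fun x => (𝒟 1 φ (v x) * 𝒟 4 v x * 𝒟 s v x +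
      2 * (φ (v x) * 𝒟 (s + 4) v x)) * 𝒟 s v x) volume := by
    refine integrable_mul ?_ hw.mem0
    exact (((hφ1.mul_hInf (hv.iter 4)).mul hw).add
      ((hφv.mul_hInf (hv.iter (s + 4))).const_mul 2)).mem0
  have i1' := i1.neg
  have i2' := i2.neg.const_mul c
  simp only [Pi.neg_def] at i1' i2'
  have e2 : (∫ x, (𝒟 1 φ (v x) * Fop κ a c v x * 𝒟 s v x +
      2 * (φ (v x) * 𝒟 s (Fop κ a c v) x)) * 𝒟 s v x) =
      -(∫ x, (𝒟 1 φ (v x) * Nop κ a v x * 𝒟 s v x +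
        2 * (φ (v x) * 𝒟 s (Nop κ a v) x)) * 𝒟 s v x) +
      c * -(∫ x, (𝒟 1 φ (v x) * 𝒟 4 v x * 𝒟 s v x +
        2 * (φ (v x) * 𝒟 (s + 4) v x)) * 𝒟 s v x) := by
    rw [← integral_neg, ← integral_neg, ← integral_const_mul, ← integral_add i1' i2']
    congr 1; ext x; rw [hF]; simp only [Fop]; ring
  have hE : Hn s v ^ 2 ≤ (s + 1) * eng s v := Hn_sq_le hv s
  have b1 := hC1 v hv hB
  have b2 := (abs_le.1 (hC2 v hv hB)).1
  have b3 := (abs_le.1 (abs_integral_mul_le hv.mem0 hNv.mem0)).1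
  have b4 : l2 v * l2 (Nop κ a v) ≤ C3 * Hn s v ^ 2 := by
    have : l2 v ≤ Hn s v := by rw [← hs_zero]; exact hs_le_Hn (Nat.zero_le s) v
    calc l2 v * l2 (Nop κ a v) ≤ Hn s v * (C3 * Hn s v) :=
          mul_le_mul this (hC3 v hv hB) (l2_nonneg _) (Hn_nonneg _ _)
      _ = _ := by ring
  have b5 : c * -(∫ x, (𝒟 1 φ (v x) * 𝒟 4 v x * 𝒟 s v x +
        2 * (φ (v x) * 𝒟 (s + 4) v x)) * 𝒟 s v x) ≤ C1 * Hn s v ^ 2 := by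
    have h6 : hs s v ^ 2 ≤ Hn s v ^ 2 := pow_le_pow_left₀ (hs_nonneg _ _) (hs_le_Hn le_rfl v) 2
    have h7 : C1 * hs s v ^ 2 ≤ C1 * Hn s v ^ 2 := mul_le_mul_of_nonneg_left h6 h1
    have h8 : 0 ≤ C1 * Hn s v ^ 2 := by positivity
    calc _ ≤ c * (C1 * Hn s v ^ 2) := mul_le_mul_of_nonneg_left (b1.trans h7) hc.1
      _ ≤ 1 * (C1 * Hn s v ^ 2) := mul_le_mul_of_nonneg_right hc.2 h8
      _ = _ := one_mul _
  have b6 : 0 ≤ c * hs 2 v ^ 2 := mul_nonneg hc.1 (sq_nonneg _)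
  rw [e1, e2]
  calc _ ≤ (2 * C3 + C2 + C1) * Hn s v ^ 2 := by linarith
    _ ≤ (2 * C3 + C2 + C1) * ((s + 1) * eng s v) := mul_le_mul_of_nonneg_left hE (by positivity)
    _ = _ := by ring

include hκ ha hφ hs4 in
/-- Growth of the norm of `H^s` under the truncated equation: the factor at time `0` depends on
the weight only. -/
lemma eng_le_of_isC1_cutF (hφ₀ : 0 < φ₀) (hlo : ∀ y, φ₀ ≤ φ y)
    (hrel : ∀ y, 3 * 𝒟 1 (fun y => φ y * κ y) y = 2 * (s + 2) * (φ y * deriv κ y)) :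
    ∃ K, 0 ≤ K ∧ ∀ M > 0, ∃ C, 0 ≤ C ∧ ∀ c ∈ Icc (0 : ℝ) 1, ∀ T v,
      IsC1 T v (fun t => cutF κ a c M (v t)) → ∀ t ∈ Icc 0 T,
        eng s (v t) ≤ K * eng s (v 0) * Real.exp (C * t) := by
  obtain ⟨D, hD0, hD⟩ := hφ.bdd0
  set μ := min 1 φ₀ with hμ
  have hμ0 : 0 < μ := lt_min one_pos hφ₀
  refine ⟨(1 + D) / μ, by positivity, fun M hM => ?_⟩
  obtain ⟨C, hC0, hC⟩ := weighted_energy hκ ha hφ hs4 hφ₀ hlo hrel (2 * M)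
  refine ⟨C / μ, by positivity, fun c hc T v hv t ht => ?_⟩
  -- The weighted energy, comparable to `eng s` with constants that depend on the weight only. This
  -- comparison is the whole of `K`; the level `M` enters only the exponent.
  let W : ℝ → ℝ := fun τ => hs 0 (v τ) ^ 2 + ∫ x, φ (v τ x) * 𝒟 s (v τ) x * 𝒟 s (v τ) x
  have hlow : ∀ τ ∈ Icc 0 T, μ * eng s (v τ) ≤ W τ := fun τ hτ => by
    have hvτ := hv.left τ hτ
    have hi := integrable_tri (hφ.comp hvτ.bInf) (hvτ.mem s) (hvτ.mem s)
    have h1 : φ₀ * hs s (v τ) ^ 2 ≤ ∫ x, φ (v τ x) * 𝒟 s (v τ) x * 𝒟 s (v τ) x := by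
      rw [hs, l2_sq (hvτ.mem s), ← integral_const_mul]
      refine integral_mono ((hvτ.mem s).integrable_sq.const_mul _) hi fun x => ?_
      simp only
      rw [mul_assoc, ← pow_two]
      exact mul_le_mul_of_nonneg_right (hlo _) (sq_nonneg _)
    have h2 : μ * hs s (v τ) ^ 2 ≤ φ₀ * hs s (v τ) ^ 2 :=
      mul_le_mul_of_nonneg_right (min_le_right _ _) (sq_nonneg _)
    have h3 : μ * hs 0 (v τ) ^ 2 ≤ 1 * hs 0 (v τ) ^ 2 :=
      mul_le_mul_of_nonneg_right (min_le_left _ _) (sq_nonneg _)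
    simp only [eng, W]
    linarith
  have hup : ∀ τ ∈ Icc 0 T, W τ ≤ (1 + D) * eng s (v τ) := fun τ hτ => by
    have hvτ := hv.left τ hτ
    have h1 := (le_abs_self _).trans (abs_tri_le (hφ.comp hvτ.bInf) (hvτ.mem s) (hvτ.mem s)
      (C := D) fun x => hD _)
    rw [tri] at h1
    have h2 : 0 ≤ D * hs 0 (v τ) ^ 2 := by positivity
    have h3 : 0 ≤ hs s (v τ) ^ 2 := sq_nonneg _
    simp only [eng, W, hs] at *
    nlinarith
  have key := gronwall (E := W) (K := 0) le_rfl (C := C / μ) (by positivity)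
    (fun τ hτ => (hv.hs_sq_hasDeriv 0 hτ).add (hv.weighted_hasDeriv hφ s hτ)) (fun τ hτ => ?_) ht
  · have h0 : (0 : ℝ) ∈ Icc 0 T := ⟨le_rfl, ht.1.trans ht.2⟩
    rw [zero_mul, add_zero] at key
    have h1 := (hlow t ht).trans (key.trans
      (mul_le_mul_of_nonneg_right (hup 0 h0) (Real.exp_pos _).le))
    rw [← le_div_iff₀' hμ0] at h1
    refine h1.trans (le_of_eq ?_)
    ring
  · have hvτ := hv.left τ hτ
    -- For fixed time `θ` is a number in `[0, 1]`, so the derivative of the energy is `θ` times the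
    -- untruncated one; where `θ` may be nonzero, the norm of `H^4` is at most `2 M`.
    set θ := cut M (Hn 4 (v τ) ^ 2)
    have e1 : ∫ x, 𝒟 0 (v τ) x * 𝒟 0 (cutF κ a c M (v τ)) x =
        θ * ∫ x, v τ x * Fop κ a c (v τ) x := by
      rw [← integral_const_mul]
      congr 1; ext x; simp only [iteratedDeriv_zero, cutF, θ]; ring
    have hF : 𝒟 s (cutF κ a c M (v τ)) = fun x => θ * 𝒟 s (Fop κ a c (v τ)) x :=
      iter_const_mul _ _ _
    have e2 : ∫ x, (𝒟 1 φ (v τ x) * cutF κ a c M (v τ) x * 𝒟 s (v τ) x +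
        2 * (φ (v τ x) * 𝒟 s (cutF κ a c M (v τ)) x)) * 𝒟 s (v τ) x =
        θ * ∫ x, (𝒟 1 φ (v τ x) * Fop κ a c (v τ) x * 𝒟 s (v τ) x +
        2 * (φ (v τ x) * 𝒟 s (Fop κ a c (v τ)) x)) * 𝒟 s (v τ) x := by
      rw [← integral_const_mul, hF]
      congr 1; ext x; simp only [cutF, θ]; ring
    have hE := hlow τ hτ
    have hE0 := eng_nonneg s (v τ)
    have h3 : C * eng s (v τ) ≤ C / μ * W τ := by
      calc C * eng s (v τ) = C / μ * (μ * eng s (v τ)) := by field_simp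
        _ ≤ _ := mul_le_mul_of_nonneg_left hE (by positivity)
    have h4 : 0 ≤ C * eng s (v τ) := mul_nonneg hC0 hE0
    rw [e1, e2, add_zero]
    refine le_trans ?_ h3
    by_cases h : (2 * M) ^ 2 < Hn 4 (v τ) ^ 2
    · have : θ = 0 := cut_eq_zero hM h
      rw [this]; simpa using h4
    · have h1 : Hn 4 (v τ) ≤ 2 * M := by
        by_contra! h2
        exact h (pow_lt_pow_left₀ h2 (by positivity) two_ne_zero)
      have h2 := mul_le_mul_of_nonneg_left (hC c hc (v τ) hvτ h1) (cut_nonneg M (Hn 4 (v τ) ^ 2))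
      have h5 : θ * (C * eng s (v τ)) ≤ 1 * (C * eng s (v τ)) :=
        mul_le_mul_of_nonneg_right (cut_le_one _ _) h4
      change θ * _ ≤ θ * _ at h2
      linarith

include hκ ha in
/-- Displacement from the initial value, uniformly in the regularization. -/
lemma abs_sub_sq_le_of_isC1_cutF {M : ℝ} (hM : 0 < M) : ∃ L, 0 ≤ L ∧ ∀ c ∈ Icc (0 : ℝ) 1, ∀ T v,
    IsC1 T v (fun t => cutF κ a c M (v t)) → (∀ t ∈ Icc 0 T, Hn 4 (v t) ≤ M) → ∀ t ∈ Icc 0 T,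
      ∀ x, (v t x - v 0 x) ^ 2 ≤ L * t := by
  obtain ⟨C, hC0, hC⟩ := ((DP_Nop hκ ha).weaken (n' := 4 + 3) le_rfl (by omega) le_rfl).tame le_rfl
    (by norm_num) M
  refine ⟨2 * ((C + 1) * M) * (2 * M), by positivity, fun c hc T v hv hB t ht x => ?_⟩
  have hT : 0 ≤ T := ht.1.trans ht.2
  have h0 : (0 : ℝ) ∈ Icc 0 T := ⟨le_rfl, hT⟩
  have hbd : ∀ τ ∈ Icc 0 T, l2 (cutF κ a c M (v τ)) ≤ (C + 1) * M := fun τ hτ => by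
    have hvτ := hv.left τ hτ
    have e : l2 (cutF κ a c M (v τ)) = |cut M (Hn 4 (v τ) ^ 2)| * l2 (Fop κ a c (v τ)) :=
      l2_const_mul _ _
    have h1 : l2 (Fop κ a c (v τ)) ≤ (C + 1) * M := by
      have h2 := l2_sub_le (((DP_Nop hκ ha).hInf hvτ).neg).mem0 ((hvτ.iter 4).const_mul c).mem0
      rw [l2_neg, l2_const_mul] at h2
      have h3 := hC (v τ) hvτ (hB τ hτ)
      have h4 : C * Hn 4 (v τ) ≤ C * M := mul_le_mul_of_nonneg_left (hB τ hτ) hC0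
      have h5 : |c| * l2 (𝒟 4 (v τ)) ≤ 1 * M := by
        refine mul_le_mul ?_ ((hs_le_Hn le_rfl _).trans (hB τ hτ)) (l2_nonneg _) zero_le_one
        rw [abs_of_nonneg hc.1]; exact hc.2
      calc l2 (Fop κ a c (v τ)) ≤ _ := h2
        _ ≤ _ := by linarith
    rw [e]
    exact (mul_le_mul (abs_cut_le_one _ _) h1 (l2_nonneg _) zero_le_one).trans (by rw [one_mul])
  have h1 := (convex_Icc 0 T).norm_image_sub_le_of_norm_hasDerivWithin_le
    (fun τ hτ => hv.toL2_hasDeriv 0 hτ) (C := (C + 1) * M) (fun τ hτ => by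
      rw [norm_toL2 ((hv.right τ hτ).mem 0), iteratedDeriv_zero]; exact hbd τ hτ) h0 ht
  simp only [iteratedDeriv_zero, sub_zero] at h1
  rw [← toL2_sub (hv.left t ht).mem0 (hv.left 0 h0).mem0,
    norm_toL2 ((hv.left t ht).sub (hv.left 0 h0)).mem0, Real.norm_of_nonneg ht.1, ← hs_zero] at h1
  have h2 : hs 1 (fun x => v t x - v 0 x) ≤ 2 * M := by
    have h3 := (hs_le_Hn (show 1 ≤ 4 by norm_num) _).trans (hB t ht)
    have h4 := (hs_le_Hn (show 1 ≤ 4 by norm_num) _).trans (hB 0 h0)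
    linarith [hs_sub_le 1 (hv.left t ht) (hv.left 0 h0)]
  -- The displacement is of order `t` in `L²` and bounded in `H^1`; the product inequality gives
  -- order `t` for its squared supremum.
  have h3 := sq_le_two_mul ((hv.left t ht).sub (hv.left 0 h0)) x
  refine h3.trans ?_
  have h4 := mul_le_mul h1 h2 (hs_nonneg _ _) (mul_nonneg (by positivity) ht.1)
  linarith

end Weighted

/-! ### Smooth approximation of Sobolev functions -/

lemma l2_le_of_ae_tendsto {f : ℕ → ℝ → ℝ} {g : ℝ → ℝ} (hf : ∀ n, MemLp (f n) 2 volume) {ε : ℝ}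
    (hε : 0 ≤ ε) (h : ∀ᶠ n in atTop, l2 (f n) ≤ ε)
    (hlim : ∀ᵐ x, Tendsto (fun n => f n x) atTop (𝓝 (g x))) :
    MemLp g 2 volume ∧ l2 g ≤ ε := by
  have hm : AEStronglyMeasurable g volume := aestronglyMeasurable_of_tendsto_ae atTop
    (fun n => (hf n).1) hlim
  have h1 : eLpNorm g 2 volume ≤ ENNReal.ofReal ε := by
    refine (Lp.eLpNorm_lim_le_liminf_eLpNorm (p := 2) (fun n => (hf n).1) g hlim).trans ?_
    refine (Filter.liminf_le_liminf (v := fun _ => ENNReal.ofReal ε) ?_).trans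
      (le_of_eq (liminf_const _))
    filter_upwards [h] with n hn
    exact (ENNReal.le_ofReal_iff_toReal_le (hf n).2.ne hε).2 hn
  exact ⟨⟨hm, h1.trans_lt ENNReal.ofReal_lt_top⟩, ENNReal.toReal_le_of_le_ofReal hε h1⟩

lemma exists_smoothing_seq {f : ℝ → ℝ} (hf : LocallyIntegrable f volume) :
    ∃ j : ℕ → ℝ → ℝ, (∀ n, IsSmoothing (j n) (1 / ((n : ℝ) + 1))) ∧
      ∀ᵐ x, Tendsto (fun n => conv (j n) f x) atTop (𝓝 (f x)) := by
  have hpos : ∀ n : ℕ, (0 : ℝ) < 1 / (n + 1) := fun n => by positivity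
  let φ : ℕ → ContDiffBump (0 : ℝ) := fun n =>
    ⟨1 / ((n : ℝ) + 1) / 2, 1 / (n + 1), half_pos (hpos n), half_lt_self (hpos n)⟩
  refine ⟨fun n => (φ n).normed volume, fun n => ⟨(φ n).contDiff_normed,
    (φ n).hasCompactSupport_normed, (φ n).nonneg_normed, (φ n).normed_neg, (φ n).integral_normed,
    fun x hx => ?_⟩, ?_⟩
  · have : x ∈ Function.support ((φ n).normed volume) := hx
    rw [(φ n).support_normed_eq] at this
    have h2 : |x| < 1 / ((n : ℝ) + 1) := by simpa [φ] using this
    exact h2.le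
  · have h := ContDiffBump.ae_convolution_tendsto_right_of_locallyIntegrable (φ := φ) (l := atTop)
      (K := 2) (μ := (volume : Measure ℝ)) tendsto_one_div_add_atTop_nhds_zero_nat
      (Eventually.of_forall fun n => by simp only [φ]; linarith) hf
    filter_upwards [h] with x hx
    refine hx.congr fun n => ?_
    rw [conv_comm]
    simp [convolution]

lemma iter_reflect (f : ℝ → ℝ) (x : ℝ) (k : ℕ) :
    𝒟 k (fun y => f (x - y)) = fun y => (-1) ^ k * 𝒟 k f (x - y) := by
  rw [iteratedDeriv_comp_const_sub]; simp only [smul_eq_mul]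

lemma HInf.reflect {f : ℝ → ℝ} (hf : HInf f) (x : ℝ) : HInf fun y => f (x - y) := by
  refine ⟨hf.smooth.comp (contDiff_const.sub contDiff_id), fun k => ?_⟩
  rw [iter_reflect]
  exact ((hf.mem k).comp_measurePreserving
    (Measure.measurePreserving_sub_left volume x)).const_mul _

/-- Convolution with a test function turns weak derivatives into derivatives. -/
lemma IsSmoothing.iter_conv_weak {j v g : ℝ → ℝ} {δ : ℝ} (hj : IsSmoothing j δ)
    (hv : MemLp v 2 volume) {l : ℕ} (hg : IsWeakDeriv l v g) : 𝒟 l (conv j v) = conv j g := by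
  rw [hj.iter_conv_left hv]
  ext x
  have h := hg (fun y => j (x - y)) (hj.smooth.comp (contDiff_const.sub contDiff_id))
    (hj.compact.comp_homeomorph (Homeomorph.subLeft x))
  rw [iter_reflect] at h
  have h1 : ((-1 : ℝ) ^ l) * (-1) ^ l = 1 := by rw [← mul_pow]; simp
  have e1 : ∫ y, v y * ((-1) ^ l * 𝒟 l j (x - y)) = (-1) ^ l * conv (𝒟 l j) v x := by
    rw [conv, ← integral_const_mul]; congr 1; ext y; ring
  have e2 : ∫ y, g y * j (x - y) = conv j g x := by
    rw [conv]; congr 1; ext y; ring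
  rw [e1, e2] at h
  calc _ = (-1) ^ l * ((-1) ^ l * conv (𝒟 l j) v x) := by rw [← mul_assoc, h1, one_mul]
    _ = _ := by rw [h, ← mul_assoc, h1, one_mul]

lemma IsSmoothing.conv_mem_Icc {j v : ℝ → ℝ} {δ m M : ℝ} (hj : IsSmoothing j δ)
    (hv : MemLp v 2 volume) (h : ∀ᵐ x, v x ∈ Icc m M) (x : ℝ) : conv j v x ∈ Icc m M := by
  have h1 : Integrable (fun y => j (x - y)) volume := hj.integrable.comp_sub_left x
  have h2 : Integrable (fun y => j (x - y) * v y) volume :=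
    integrable_mul (hj.hInf.reflect x).mem0 hv
  have h3 : ∀ c, ∫ y, j (x - y) * c = c := fun c => by
    rw [integral_mul_const, integral_sub_left_eq_self (fun y => j y) volume x, hj.integral, one_mul]
  constructor
  · rw [← h3 m]
    refine integral_mono_ae (h1.mul_const m) h2 ?_
    filter_upwards [h] with y hy
    exact mul_le_mul_of_nonneg_left hy.1 (hj.nonneg _)
  · rw [← h3 M]
    refine integral_mono_ae h2 (h1.mul_const M) ?_
    filter_upwards [h] with y hy
    exact mul_le_mul_of_nonneg_left hy.2 (hj.nonneg _)

lemma weakDeriv_spec {l : ℕ} {f : ℝ → ℝ} (h : ∃ g : ℝ → ℝ, MemLp g 2 volume ∧ IsWeakDeriv l f g) :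
    MemLp (weakDeriv l f) 2 volume ∧ IsWeakDeriv l f (weakDeriv l f) := by
  rw [weakDeriv, dif_pos h]; exact h.choose_spec

/-- Nonnegative kernels of mass one preserve the range and do not increase the norms of weak
derivatives. -/
lemma exists_hInf_approx {q : ℕ} (hq : 1 ≤ q) {v : ℝ → ℝ} (hv : MemSobolev q v) {m M : ℝ}
    (hJ : ∀ᵐ x, v x ∈ Icc m M) :
    ∃ f : ℕ → ℝ → ℝ, (∀ n, HInf (f n)) ∧ (∀ n x, f n x ∈ Icc m M) ∧
      (∀ n, ∀ l ≤ q, hs l (f n) ≤ l2 (weakDeriv l v)) ∧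
      ∀ n, l2 (fun x => f n x - v x) ≤ 1 / ((n : ℝ) + 1) * l2 (weakDeriv 1 v) := by
  obtain ⟨j, hj, hlim⟩ := exists_smoothing_seq (hv.1.locallyIntegrable (by norm_num))
  have hbd : ∀ n, ∀ l ≤ q, hs l (conv (j n) v) ≤ l2 (weakDeriv l v) := fun n l hl => by
    obtain ⟨h1, h2⟩ := weakDeriv_spec (hv.2 l hl)
    rw [hs, (hj n).iter_conv_weak hv.1 h2]
    have := (memLp_conv (hj n).integrable (hj n).measurable h1).2
    rwa [(hj n).integral_abs, one_mul] at this
  refine ⟨fun n => conv (j n) v, fun n => (hj n).hInf_conv hv.1,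
    fun n x => (hj n).conv_mem_Icc hv.1 hJ x, hbd, fun n => ?_⟩
  have hδ : (0 : ℝ) ≤ 1 / ((n : ℝ) + 1) := by positivity
  have hI := fun i => (hj i).hInf_conv hv.1
  -- The rate for smooth functions is applied to the second mollification `conv (j i) v`, and then
  -- `i → ∞` almost everywhere.
  refine (l2_le_of_ae_tendsto (f := fun i x => conv (j n) (conv (j i) v) x - conv (j i) v x)
    (fun i => (((hj n).conv_hInf (hI i)).sub (hI i)).mem0) (mul_nonneg hδ (l2_nonneg _))
    (Eventually.of_forall fun i => ?_) ?_).2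
  · exact ((hj n).l2_conv_sub_le hδ (hI i)).trans (mul_le_mul_of_nonneg_left (hbd i 1 hq) hδ)
  · filter_upwards [hlim] with x hx
    refine Tendsto.sub ?_ hx
    refine tendsto_integral_of_dominated_convergence (fun y => |j n (x - y)| * max |m| |M|)
      (fun i => ?_) ?_ (fun i => ae_of_all _ fun y => ?_) ?_
    · exact (integrable_mul ((hj n).hInf.reflect x).mem0 (hI i).mem0).1
    · exact ((hj n).integrable.comp_sub_left x).abs.mul_const _
    · rw [norm_mul, Real.norm_eq_abs, Real.norm_eq_abs]
      have h := (hj i).conv_mem_Icc hv.1 hJ y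
      exact mul_le_mul_of_nonneg_left (abs_le_max_abs_abs h.1 h.2) (abs_nonneg _)
    · filter_upwards [hlim] with y hy
      exact hy.const_mul _

/-! ### Convolution with a kernel in `H^∞` -/

section Kernel

variable {K : ℝ → ℝ} (hK : HInf K) (hK1 : ∀ k, Integrable (𝒟 k K) volume)

include hK hK1

lemma iter_conv_add {f : ℝ → ℝ} (hf : HInf f) (l m : ℕ) :
    𝒟 (l + m) (conv K f) = conv (𝒟 m K) (𝒟 l f) := by
  have hK0 : Integrable K volume := by simpa using hK1 0
  rw [iter_conv hK0 hK.continuous.measurable hf]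
  ext x
  have h := integral_mul_iter (hK.reflect x) (hf.iter l) m
  rw [iteratedDeriv_comp_iteratedDeriv, iter_reflect] at h
  have h1 : ((-1 : ℝ) ^ m) * (-1) ^ m = 1 := by rw [← mul_pow]; simp
  rw [conv, add_comm l m, h, conv, ← integral_const_mul]
  congr 1; ext y
  rw [mul_assoc, ← mul_assoc, h1, one_mul]

lemma hs_conv_add_le {f : ℝ → ℝ} (hf : HInf f) (l m : ℕ) :
    hs (l + m) (conv K f) ≤ (∫ x, |𝒟 m K x|) * hs l f := by
  rw [hs, iter_conv_add hK hK1 hf]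
  exact (memLp_conv (hK1 m) (hK.iter m).continuous.measurable (hf.mem l)).2

/-- Bernstein type estimates for the convolution of Sobolev functions. -/
lemma hInf_conv_of_memSobolev {q : ℕ} (hq : 1 ≤ q) {v : ℝ → ℝ} (hv : MemSobolev q v) {m M : ℝ}
    (hJ : ∀ᵐ x, v x ∈ Icc m M) : HInf (conv K v) ∧
      (∀ l ≤ q, ∀ i, hs (l + i) (conv K v) ≤ (∫ x, |𝒟 i K x|) * l2 (weakDeriv l v)) ∧
      ∀ S : Set ℝ, IsClosed S → (∀ f, HInf f → (∀ x, f x ∈ Icc m M) →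
        (∀ l ≤ q, hs l f ≤ l2 (weakDeriv l v)) → ∀ x, conv K f x ∈ S) → ∀ x, conv K v x ∈ S := by
  obtain ⟨f, hf, hfJ, hbd, hfv⟩ := exists_hInf_approx hq hv hJ
  have hK0 : Integrable K volume := by simpa using hK1 0
  have hKm := hK.continuous.measurable
  have hu : ∀ n, HInf (conv K (f n)) := fun n => (hf n).conv hK0 hKm
  set w := l2 (weakDeriv 1 v)
  have hw : 0 ≤ w := l2_nonneg _
  have htend : Tendsto (fun n : ℕ => (1 : ℝ) / (n + 1)) atTop (𝓝 0) :=
    tendsto_one_div_add_atTop_nhds_zero_nat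
  have hI : ∀ k, 0 ≤ ∫ x, |𝒟 k K x| := fun k => integral_nonneg fun _ => abs_nonneg _
  have hcau : ∀ k : ℕ, ∀ ε > 0, ∃ N, ∀ a ≥ N, ∀ b ≥ N,
      hs k (fun x => conv K (f a) x - conv K (f b) x) ≤ ε := fun k ε hε => by
    have h1 : Tendsto (fun n : ℕ => (∫ x, |𝒟 k K x|) * ((1 : ℝ) / (n + 1) * w)) atTop (𝓝 0) := by
      simpa using (htend.mul_const w).const_mul (∫ x, |𝒟 k K x|)
    obtain ⟨N, hN⟩ := eventually_atTop.1 (h1.eventually_lt_const (half_pos hε))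
    refine ⟨N, fun a ha b hb => ?_⟩
    have h2 := hs_conv_add_le hK hK1 ((hf a).sub (hf b)) 0 k
    rw [zero_add, conv_sub hK.mem0 (hf a).mem0 (hf b).mem0, hs_zero] at h2
    have h3 : l2 (fun x => f a x - f b x) ≤ 1 / ((a : ℝ) + 1) * w + 1 / ((b : ℝ) + 1) * w := by
      have h4 := l2_sub_le ((hf a).mem0.sub hv.1) ((hf b).mem0.sub hv.1)
      simp only [Pi.sub_apply, sub_sub_sub_cancel_right] at h4
      exact h4.trans (add_le_add (hfv a) (hfv b))
    have h5 := mul_le_mul_of_nonneg_left h3 (hI k)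
    rw [mul_add] at h5
    linarith [hN a ha, hN b hb]
  obtain ⟨g, hg, hgt, hgb⟩ := exists_hInf_limit hu hcau
  have hpt : ∀ x, Tendsto (fun n => conv K (f n) x) atTop (𝓝 (conv K v x)) := fun x => by
    rw [tendsto_iff_norm_sub_tendsto_zero]
    have h1 : Tendsto (fun n : ℕ => l2 K * ((1 : ℝ) / (n + 1) * w)) atTop (𝓝 0) := by
      simpa using (htend.mul_const w).const_mul (l2 K)
    refine squeeze_zero (fun n => norm_nonneg _) (fun n => ?_) h1
    have h2 := abs_conv_le hK.mem0 ((hf n).mem0.sub hv.1) x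
    have h3 : conv K (f n - v) = conv K fun y => f n y - v y := rfl
    rw [h3, conv_sub hK.mem0 (hf n).mem0 hv.1] at h2
    exact h2.trans (mul_le_mul_of_nonneg_left (hfv n) (l2_nonneg _))
  have hgv : conv K v = g := by
    ext x
    have := hgt 0 x
    simp only [iteratedDeriv_zero] at this
    exact tendsto_nhds_unique (hpt x) this
  refine ⟨hgv ▸ hg, fun l hl i => ?_, fun S hS h x => ?_⟩
  · refine le_of_forall_pos_le_add fun ε hε => ?_
    obtain ⟨N, hN⟩ := hcau (l + i) ε hε
    have h1 := hgb (l + i) N ε hε.le ((eventually_ge_atTop N).mono fun b hb => hN N le_rfl b hb)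
    have h2 := hs_sub_le (l + i) (hu N) ((hu N).sub hg)
    simp only [sub_sub_cancel] at h2
    have h3 := (hs_conv_add_le hK hK1 (hf N) l i).trans
      (mul_le_mul_of_nonneg_left (hbd N l hl) (hI i))
    rw [hgv]; linarith
  -- Any pointwise closed condition on the convolution needs a check only for smooth data with the
  -- same range and norms; it is used to locate the values of the mollified data.
  · exact hS.mem_of_tendsto (hpt x) (Eventually.of_forall fun n => h (f n) (hf n) (hfJ n) (hbd n) x)

end Kernel

/-! ### Mollifier kernels -/

lemma schwartz_hInf (ψ : SchwartzMap ℝ ℝ) : HInf ψ ∧ ∀ k, Integrable (𝒟 k ψ) volume := by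
  have h : ∀ k, ∃ ψ' : SchwartzMap ℝ ℝ, 𝒟 k ψ = ψ' := fun k => by
    induction k with
    | zero => exact ⟨ψ, by simp⟩
    | succ k ih =>
      obtain ⟨ψ', h'⟩ := ih
      refine ⟨SchwartzMap.derivCLM ℝ ℝ ψ', ?_⟩
      ext x
      rw [iteratedDeriv_succ, h', SchwartzMap.derivCLM_apply]
  refine ⟨⟨ψ.smooth', fun k => ?_⟩, fun k => ?_⟩ <;> obtain ⟨ψ', h'⟩ := h k <;> rw [h']
  · exact ψ'.memLp 2 volume
  · exact ψ'.integrable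

open FourierTransform in
/-- A mollifier kernel is reproduced by a Schwartz function. -/
lemma IsMollifierKernel.exists_reproducing {χ : ℝ → ℝ} (hχ : IsMollifierKernel χ) :
    ∃ ψ : SchwartzMap ℝ ℝ, conv χ ψ = χ := by
  set f : ℝ → ℂ := fun x => (χ x : ℂ) with hf
  have hfi : Integrable f volume := hχ.integrable.ofReal
  have hfc : Continuous f := Complex.continuous_ofReal.comp hχ.smooth.continuous
  have hFc : Continuous (𝓕 f) := by
    have := VectorFourier.fourierIntegral_continuous (L := innerₗ ℝ) Real.continuous_fourierChar
      continuous_inner hfi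
    exact this
  have hFi : Integrable (𝓕 f) volume := hFc.integrable_of_hasCompactSupport hχ.fourier_support
  obtain ⟨r, hr⟩ := hχ.fourier_support.isCompact.isBounded.subset_closedBall 0
  -- A bump equal to `1` on the support of the Fourier transform of `χ`. Its inverse transform is a
  -- Schwartz function, and its real part is the reproducing `ψ`.
  let β : ContDiffBump (0 : ℝ) := ⟨|r| + 1, |r| + 2, by positivity, by linarith⟩
  have hβ : ContDiff ℝ ((⊤ : ℕ∞) : WithTop ℕ∞) fun ξ => ((β ξ : ℝ) : ℂ) :=
    Complex.ofRealCLM.contDiff.comp β.contDiff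
  have hβc : HasCompactSupport fun ξ => ((β ξ : ℝ) : ℂ) :=
    β.hasCompactSupport.comp_left Complex.ofReal_zero
  let b : SchwartzMap ℝ ℂ := hβc.toSchwartzMap hβ
  have hb : ∀ ξ, b ξ = ((β ξ : ℝ) : ℂ) := fun ξ => rfl
  have hmul : ∀ ξ, 𝓕 f ξ * b ξ = 𝓕 f ξ := fun ξ => by
    by_cases h : ξ ∈ tsupport (𝓕 f)
    · have h1 : ξ ∈ Metric.closedBall (0 : ℝ) (|r| + 1) :=
        Metric.closedBall_subset_closedBall (by linarith [le_abs_self r]) (hr h)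
      rw [hb, β.one_of_mem_closedBall h1]; simp
    · rw [image_eq_zero_of_notMem_tsupport h, zero_mul]
  have hinv : ∀ x, (χ x : ℂ) = ∫ y, f y * (𝓕⁻ b) (x - y) := fun x => by
    have h1 : 𝓕⁻ (𝓕 f) x = f x := hfi.fourierInv_fourier_eq hFi hfc.continuousAt
    have hg : Integrable (fun ξ => (Real.fourierChar (ξ * x) : ℂ) * b ξ) volume := by
      refine b.integrable.bdd_mul (c := 1) ?_ (ae_of_all _ fun ξ => ?_)
      · exact (by fun_prop : Continuous fun ξ : ℝ => (Real.fourierChar (ξ * x) : ℂ)).aestronglyMeasurable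
      · exact (Circle.norm_coe _).le
    have h2 := VectorFourier.integral_fourierIntegral_smul_eq_flip (L := innerₗ ℝ)
      (μ := volume) (ν := volume) Real.continuous_fourierChar continuous_inner hfi hg
    rw [← hf] at *
    have h3 : 𝓕⁻ (𝓕 f) x = ∫ ξ, 𝓕 f ξ • ((Real.fourierChar (ξ * x) : ℂ) * b ξ) := by
      rw [Real.fourierInv_eq]
      congr 1; ext ξ
      rw [smul_eq_mul, mul_left_comm, hmul, Circle.smul_def, smul_eq_mul]
      simp [mul_comm]
    have h4 : ∀ y, VectorFourier.fourierIntegral Real.fourierChar volume (innerₗ ℝ).flip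
        (fun ξ => (Real.fourierChar (ξ * x) : ℂ) * b ξ) y = (𝓕⁻ b) (x - y) := fun y => by
      rw [SchwartzMap.fourierInv_coe, Real.fourierInv_eq, VectorFourier.fourierIntegral]
      congr 1; ext ξ
      rw [Circle.smul_def, Circle.smul_def, smul_eq_mul, smul_eq_mul, ← mul_assoc, ← Circle.coe_mul,
        ← AddChar.map_add_eq_mul]
      congr 3
      simp; ring
    change ∫ ξ, 𝓕 f ξ • _ = _ at h2
    rw [← h3, h1] at h2
    change f x = _
    rw [h2]
    congr 1; ext y
    rw [h4, smul_eq_mul]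
  refine ⟨(𝓕⁻ b).postcompCLM (𝕜 := ℝ) Complex.reCLM, ?_⟩
  ext x
  have hint : Integrable (fun y => f y * (𝓕⁻ b) (x - y)) volume := by
    refine hfi.mul_bdd (c := ‖(𝓕⁻ b).toBoundedContinuousFunction‖) ?_ (ae_of_all _ fun y => ?_)
    · exact ((𝓕⁻ b).continuous.comp (continuous_const.sub continuous_id)).aestronglyMeasurable
    · exact (𝓕⁻ b).toBoundedContinuousFunction.norm_coe_le_norm (x - y)
  have h5 := Complex.reCLM.integral_comp_comm hint
  rw [← hinv x] at h5
  rw [conv_comm]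
  refine Eq.trans ?_ h5
  congr 1; ext y
  simp [hf]

/-- The rescaled kernel. -/
def rescale (χ : ℝ → ℝ) (δ : ℝ) (z : ℝ) : ℝ := δ⁻¹ * χ (z / δ)

namespace IsMollifierKernel

variable {χ : ℝ → ℝ} (hχ : IsMollifierKernel χ)

include hχ

lemma hInf : HInf χ := by
  obtain ⟨ψ, hψ⟩ := hχ.exists_reproducing
  rw [← hψ]
  exact (schwartz_hInf ψ).1.conv hχ.integrable hχ.smooth.continuous.measurable

/-- In `χ = χ * ψ` the derivatives fall on `ψ`, and `L¹ * L¹ ⊆ L¹`. -/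
lemma integrable_iter (k : ℕ) : Integrable (𝒟 k χ) volume := by
  obtain ⟨ψ, hψ⟩ := hχ.exists_reproducing
  obtain ⟨h1, h2⟩ := schwartz_hInf ψ
  have e : 𝒟 k χ = convolution (𝒟 k ψ) χ (ContinuousLinearMap.mul ℝ ℝ) volume := by
    conv_lhs => rw [← hψ, iter_conv hχ.integrable hχ.smooth.continuous.measurable h1]
    ext x
    simp only [conv, convolution, ContinuousLinearMap.mul_apply', mul_comm]
  rw [e]
  exact (h2 k).integrable_convolution _ hχ.integrable

lemma integral : ∫ x, χ x = 1 := by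
  have h := hχ.fourier_one.self_of_nhds
  rw [Real.fourier_real_eq] at h
  simp only [mul_zero, neg_zero, AddChar.map_zero_eq_one, one_smul] at h
  exact Complex.ofReal_eq_one.1 (integral_complex_ofReal.symm.trans h)

lemma iter_rescale (δ : ℝ) (k : ℕ) (z : ℝ) :
    𝒟 k (rescale χ δ) z = (δ⁻¹) ^ k * (δ⁻¹ * 𝒟 k χ (z / δ)) := by
  have e : rescale χ δ = fun z => δ⁻¹ * χ (δ⁻¹ * z) := by
    ext z; rw [rescale, div_eq_inv_mul]
  rw [e, iter_const_mul, iteratedDeriv_comp_const_mul (smooth_le hχ.smooth), div_eq_inv_mul]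
  ring

end IsMollifierKernel

lemma mollify_eq_conv (χ : ℝ → ℝ) (δ : ℝ) (v : ℝ → ℝ) : mollify χ δ v = conv (rescale χ δ) v := rfl

lemma integral_rescale {δ : ℝ} (hδ : 0 < δ) (g : ℝ → ℝ) :
    ∫ z, δ⁻¹ * g (z / δ) = ∫ z, g z := by
  rw [integral_const_mul, Measure.integral_comp_div, smul_eq_mul, abs_of_pos hδ, ← mul_assoc,
    inv_mul_cancel₀ hδ.ne', one_mul]

namespace IsMollifierKernel

variable {χ : ℝ → ℝ} (hχ : IsMollifierKernel χ) {δ : ℝ} (hδ : 0 < δ)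

include hχ hδ

lemma integrable_iter_rescale (k : ℕ) : Integrable (𝒟 k (rescale χ δ)) volume := by
  rw [funext (hχ.iter_rescale δ k)]
  exact (((hχ.integrable_iter k).comp_div hδ.ne').const_mul _).const_mul _

lemma integral_abs_iter_rescale (k : ℕ) :
    ∫ z, |𝒟 k (rescale χ δ) z| = (δ⁻¹) ^ k * ∫ z, |𝒟 k χ z| := by
  simp only [hχ.iter_rescale δ k, abs_mul, abs_of_pos (inv_pos.2 hδ), abs_pow]
  rw [integral_const_mul, integral_rescale hδ fun z => |𝒟 k χ z|]

lemma hInf_rescale : HInf (rescale χ δ) := by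
  refine ⟨?_, fun k => ?_⟩
  · exact contDiff_const.mul (hχ.smooth.comp (contDiff_id.div_const δ))
  · rw [funext (hχ.iter_rescale δ k)]
    refine MemLp.const_mul (MemLp.const_mul ?_ _) _
    have hm := (hχ.hInf.iter k).continuous
    have hc : Continuous fun z => 𝒟 k χ (z / δ) := by fun_prop
    rw [memLp_two_iff_integrable_sq hc.aestronglyMeasurable]
    exact (hχ.hInf.mem k).integrable_sq.comp_div hδ.ne'

end IsMollifierKernel

/-- Mollification moves bounded Lipschitz functions only little. -/
lemma IsMollifierKernel.exists_close {χ : ℝ → ℝ} (hχ : IsMollifierKernel χ) (C L : ℝ) (hC : 0 ≤ C)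
    (hL : 0 ≤ L) {r : ℝ} (hr : 0 < r) : ∃ δ₀ > 0, ∀ δ, 0 < δ → δ ≤ δ₀ → ∀ f, HInf f →
      (∀ x, |f x| ≤ C) → (∀ x, |𝒟 1 f x| ≤ L) → ∀ x, |conv (rescale χ δ) f x - f x| ≤ r := by
  -- Since `χ` is merely integrable, a first moment is not available; the minimum with `2 C` gives
  -- dominated convergence instead, with a modulus that depends only on `C` and `L`.
  let ω : ℝ → ℝ := fun δ => ∫ z, |χ z| * min (2 * C) (L * (|δ| * |z|))
  have hcχ := hχ.smooth.continuous
  have hω : Tendsto ω (𝓝 0) (𝓝 0) := by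
    suffices h : Tendsto ω (𝓝 0) (𝓝 (∫ z, |χ z| * min (2 * C) (L * (|(0 : ℝ)| * |z|)))) by
      simpa [min_eq_right (show (0 : ℝ) ≤ 2 * C by positivity)] using h
    refine tendsto_integral_filter_of_dominated_convergence (fun z => |χ z| * (2 * C))
      (Eventually.of_forall fun δ => ?_) (Eventually.of_forall fun δ => ae_of_all _ fun z => ?_)
      (hχ.integrable.abs.mul_const _) (ae_of_all _ fun z => ?_)
    · exact (by fun_prop : Continuous fun z => |χ z| * min (2 * C) (L * (|δ| * |z|))).aestronglyMeasurable
    · rw [Real.norm_of_nonneg (by positivity)]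
      exact mul_le_mul_of_nonneg_left (min_le_left _ _) (abs_nonneg _)
    · exact (by fun_prop : Continuous fun δ : ℝ =>
        |χ z| * min (2 * C) (L * (|δ| * |z|))).tendsto 0
  obtain ⟨δ₁, hδ₁, h⟩ := Metric.eventually_nhds_iff.1 (hω.eventually_lt_const hr)
  refine ⟨δ₁ / 2, half_pos hδ₁, fun δ hδ hδ0 f hf hfC hfL x => ?_⟩
  have hK0 : Integrable (rescale χ δ) volume := by simpa using hχ.integrable_iter_rescale hδ 0
  have hKm := (hχ.hInf_rescale hδ).continuous.measurable
  have hK1 : ∫ z, rescale χ δ z = 1 := (integral_rescale hδ χ).trans hχ.integral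
  have e : conv (rescale χ δ) f x - f x = ∫ z, rescale χ δ z * (f (x - z) - f x) := by
    simp only [mul_sub]
    rw [integral_sub (integrable_kernel_mul hK0 hKm hf x) (hK0.mul_const _), integral_mul_const,
      hK1, one_mul, conv_comm]
  have hlip : ∀ z, |f (x - z) - f x| ≤ L * |z| := fun z => by
    have := convex_univ.norm_image_sub_le_of_norm_hasDerivWithin_le (f := f) (f' := 𝒟 1 f) (C := L)
      (fun y _ => (hf.hasDerivAt0 y).hasDerivWithinAt) (fun y _ => hfL y) (mem_univ x)
      (mem_univ (x - z))
    simpa using this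
  have hb : ∀ z, |f (x - z) - f x| ≤ min (2 * C) (L * |z|) := fun z => by
    refine le_min ((abs_sub _ _).trans ?_) (hlip z)
    linarith [hfC (x - z), hfC x]
  have hωδ : ω δ = ∫ z, |rescale χ δ z| * min (2 * C) (L * |z|) := by
    have h1 := integral_rescale hδ fun z => |χ z| * min (2 * C) (L * (|δ| * |z|))
    simp only [ω]
    rw [← h1]
    congr 1; ext z
    have h2 : |δ| * |z / δ| = |z| := by rw [← abs_mul]; congr 1; field_simp
    rw [h2, rescale, abs_mul, abs_of_pos (inv_pos.2 hδ), mul_assoc]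
  have hlt : ω δ < r := h (by rw [dist_zero_right, Real.norm_of_nonneg hδ.le]; linarith)
  rw [e]
  refine (abs_integral_le_integral_abs).trans (le_trans ?_ hlt.le)
  rw [hωδ]
  refine integral_mono_of_nonneg (ae_of_all _ fun z => abs_nonneg _) ?_ (ae_of_all _ fun z => ?_)
  · refine (hK0.abs.mul_const (2 * C)).mono' ?_ (ae_of_all _ fun z => ?_)
    · exact hK0.1.norm.mul
        (by fun_prop : Continuous fun z : ℝ => min (2 * C) (L * |z|)).aestronglyMeasurable
    · rw [Real.norm_of_nonneg (by positivity)]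
      exact mul_le_mul_of_nonneg_left (min_le_left _ _) (abs_nonneg _)
  · simp only [abs_mul]
    exact mul_le_mul_of_nonneg_left (hb z) (abs_nonneg _)

/-! ### Coefficients -/

/-- Smooth functions that are equal to the constant `c` outside a compact set. -/
structure EvConst (f : ℝ → ℝ) (c : ℝ) : Prop where
  smooth : Smooth f
  compact : HasCompactSupport fun x => f x - c

namespace EvConst

variable {f : ℝ → ℝ} {c : ℝ}

lemma bInf (hf : EvConst f c) : BInf f := by
  refine ⟨hf.smooth, fun k => ?_⟩
  have hg : Smooth fun x => f x - c := hf.smooth.sub contDiff_const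
  have hk : HasCompactSupport (𝒟 k fun x => f x - c) := by
    rw [iteratedDeriv_eq_iterate]
    induction k with
    | zero => exact hf.compact
    | succ k ih => rw [Function.iterate_succ_apply']; exact ih.deriv
  obtain ⟨C, hC⟩ := hk.exists_bound_of_continuous (smooth_iter hg k).continuous
  obtain ⟨D, hD⟩ := (bInf_const c).bdd k
  refine ⟨C + D, fun x => ?_⟩
  have e : f = fun x => (f x - c) + c := by ext x; ring
  rw [e, iter_add hg contDiff_const]
  exact (abs_add_le _ _).trans (add_le_add (hC x) (hD x))

lemma exists_pos_le (hf : EvConst f c) (h : ∀ x, 0 < f x) : ∃ φ₀, 0 < φ₀ ∧ ∀ x, φ₀ ≤ f x := by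
  have hc : Continuous fun x => f x - c := hf.smooth.continuous.sub continuous_const
  obtain ⟨x₀, h₀⟩ := hc.exists_forall_le_of_hasCompactSupport hf.compact
  exact ⟨f x₀, h x₀, fun x => by have := h₀ x; linarith⟩

lemma rpow (hf : EvConst f c) (h : ∀ x, 0 < f x) (r : ℝ) : EvConst (fun x => f x ^ r) (c ^ r) := by
  refine ⟨hf.smooth.rpow_const_of_ne fun x => (h x).ne', hf.compact.mono fun x hx => ?_⟩
  rw [Function.mem_support] at hx ⊢
  contrapose! hx
  rw [show f x = c by linarith, sub_self]

/-- Existence of the weights of the energy estimates. -/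
lemma exists_weight (hf : EvConst f c) (h : ∀ x, 0 < f x) (s : ℕ) :
    ∃ φ, BInf φ ∧ (∃ φ₀, 0 < φ₀ ∧ ∀ x, φ₀ ≤ φ x) ∧
      ∀ y, 3 * 𝒟 1 (fun y => φ y * f y) y = 2 * (s + 2) * (φ y * deriv f y) := by
  -- For `φ = f^r` the condition reads `3 (r + 1) = 2 (s + 2)`.
  set r : ℝ := (2 * s + 1) / 3 with hr
  have hφ := hf.rpow h r
  refine ⟨fun x => f x ^ r, hφ.bInf, hφ.exists_pos_le fun x => Real.rpow_pos_of_pos (h x) r,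
    fun y => ?_⟩
  have e : (fun y => f y ^ r * f y) = fun y => f y ^ (r + 1) := by
    ext y; rw [Real.rpow_add_one (h y).ne']
  have hd : HasDerivAt f (deriv f y) y := (hf.smooth.differentiable (by simp) y).hasDerivAt
  rw [iteratedDeriv_one, e, (hd.rpow_const (p := r + 1) (Or.inl (h y).ne')).deriv,
    add_sub_cancel_right, hr]
  ring

end EvConst

lemma exists_cutoff {I : Set ℝ} (hI : IsOpen I) {m M : ℝ} (hmM : m ≤ M) (h : Icc m M ⊆ I) :
    ∃ β : ℝ → ℝ, Smooth β ∧ HasCompactSupport β ∧ tsupport β ⊆ I ∧ (∀ x, β x ∈ Icc 0 1) ∧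
      ∀ x ∈ Icc m M, β x = 1 := by
  obtain ⟨r, hr, hrI⟩ := isCompact_Icc.exists_cthickening_subset_open hI h
  have hM : 0 ≤ (M - m) / 2 := by linarith
  let β : ContDiffBump ((m + M) / 2) := ⟨(M - m) / 2 + r / 2, (M - m) / 2 + r, by positivity,
    by linarith⟩
  refine ⟨β, β.contDiff, β.hasCompactSupport, fun x hx => hrI ?_, fun x => ⟨β.nonneg, β.le_one⟩,
    fun x hx => β.one_of_mem_closedBall ?_⟩
  · rw [β.tsupport_eq, Real.closedBall_eq_Icc] at hx
    have h1 : m - r ≤ x := by have := hx.1; simp only [β] at this; linarith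
    have h2 : x ≤ M + r := by have := hx.2; simp only [β] at this; linarith
    refine Metric.mem_cthickening_of_dist_le x (max m (min x M)) r _
      ⟨le_max_left _ _, max_le hmM (min_le_right _ _)⟩ ?_
    rw [Real.dist_eq, abs_le]
    rcases le_total x M with h3 | h3 <;> rcases le_total m x with h4 | h4 <;>
      simp only [min_eq_left, min_eq_right, max_eq_left, max_eq_right, h3, h4, hmM] <;>
      constructor <;> linarith
  · rw [Real.closedBall_eq_Icc]
    have h1 := hx.1
    have h2 := hx.2
    constructor <;> simp only [β] <;> linarith

/-- A convex combination of `F` and the constant `c` by a cutoff supported in `I`; positivity is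
therefore preserved, and the extension is bounded away from zero when it is positive. -/
lemma exists_extension {I : Set ℝ} (hI : IsOpen I) {m M : ℝ} (hmM : m ≤ M) (h : Icc m M ⊆ I)
    {F : ℝ → ℝ} (hF : ContDiffOn ℝ ((⊤ : ℕ∞) : WithTop ℕ∞) F I) (c : ℝ) :
    ∃ f, EvConst f c ∧ (∀ x ∈ Icc m M, f x = F x) ∧ ((∀ x ∈ I, 0 < F x) → 0 < c → ∀ x, 0 < f x) := by
  obtain ⟨β, h1, h2, h3, h4, h5⟩ := exists_cutoff hI hmM h
  refine ⟨fun x => β x * F x + (1 - β x) * c, ⟨?_, ?_⟩, fun x hx => by simp [h5 x hx],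
    fun hpos hc x => ?_⟩
  · refine ContDiff.add ?_ ((contDiff_const.sub h1).mul contDiff_const)
    rw [contDiff_iff_contDiffAt]
    intro x
    by_cases hx : x ∈ I
    · exact h1.contDiffAt.mul (hF.contDiffAt (hI.mem_nhds hx))
    · have hx' : x ∉ tsupport β := fun h => hx (h3 h)
      have : (fun x => β x * F x) =ᶠ[𝓝 x] fun _ => 0 := by
        filter_upwards [notMem_tsupport_iff_eventuallyEq.1 hx'] with y hy
        simp [hy]
      exact contDiffAt_const.congr_of_eventuallyEq this
  · refine h2.mono fun x hx => ?_
    rw [Function.mem_support] at hx ⊢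
    contrapose! hx
    rw [hx]; ring
  · by_cases hx : x ∈ tsupport β
    · have h6 := hpos x (h3 hx)
      have h7 := (h4 x).1
      rcases (h4 x).2.lt_or_eq with h8 | h8
      · have := mul_nonneg h7 h6.le
        have := mul_pos (sub_pos.2 h8) hc
        linarith
      · simp only [h8]; linarith
    · simp only [image_eq_zero_of_notMem_tsupport hx]; linarith

/-- The dispersive term in expanded form. -/
lemma dispersiveTerm_eq {κ : ℝ → ℝ} (hκ : Smooth κ) (hpos : ∀ y, 0 < κ y) {u : ℝ → ℝ}
    (hu : Smooth u) (x : ℝ) : dispersiveTerm κ u x = κ (u x) * 𝒟 3 u x +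
      2 * (deriv κ (u x) * (𝒟 1 u x * 𝒟 2 u x)) +
      1 / 2 * (deriv (deriv κ) (u x) * 𝒟 1 u x ^ 3) := by
  have hu0 : ∀ y, HasDerivAt u (𝒟 1 u y) y := fun y => by simpa using smooth_hasDerivAt hu 0 y
  have hκ0 : ∀ F : ℝ → ℝ, Smooth F → ∀ y, HasDerivAt (fun y => F (u y)) (deriv F (u y) * 𝒟 1 u y) y :=
    fun F hF y => (hF.differentiable (by simp) (u y)).hasDerivAt.comp y (hu0 y)
  have e : (fun y => √(κ (u y)) * deriv (fun z => √(κ (u z)) * deriv u z) y) = fun y =>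
      1 / 2 * (deriv κ (u y) * (𝒟 1 u y * 𝒟 1 u y)) + κ (u y) * 𝒟 2 u y := by
    ext y
    have h1 := ((hκ0 κ hκ y).sqrt (hpos _).ne').mul (smooth_hasDerivAt hu 1 y)
    have h2 : (fun z => √(κ (u z)) * deriv u z) = (fun y => √(κ (u y))) * 𝒟 1 u := by
      ext z; simp
    rw [h2, h1.deriv]
    have h4 : √(κ (u y)) ≠ 0 := (Real.sqrt_pos.2 (hpos _)).ne'
    field_simp
    rw [Real.sq_sqrt (hpos _).le]; ring
  rw [dispersiveTerm, e]
  have h1 := (((hκ0 _ (smooth_deriv hκ) x).mul ((smooth_hasDerivAt hu 1 x).mul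
    (smooth_hasDerivAt hu 1 x))).const_mul (1 / 2)).add
    ((hκ0 κ hκ x).mul (smooth_hasDerivAt hu 2 x))
  refine h1.deriv.trans ?_
  simp only [Pi.mul_apply]
  ring

/-! ### Sobolev spaces -/

lemma smooth_isWeakDeriv {f : ℝ → ℝ} (hf : Smooth f) (l : ℕ) : IsWeakDeriv l f (𝒟 l f) := by
  intro φ hφ hc
  have hck : ∀ k, HasCompactSupport (𝒟 k φ) := fun k => by
    rw [iteratedDeriv_eq_iterate]
    induction k with
    | zero => exact hc
    | succ k ih => rw [Function.iterate_succ_apply']; exact ih.deriv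
  have hint : ∀ i k, Integrable (fun x => 𝒟 i f x * 𝒟 k φ x) volume := fun i k =>
    ((smooth_iter hf i).continuous.mul (smooth_iter hφ k).continuous).integrable_of_hasCompactSupport
      (hck k).mul_left
  have key : ∀ i k, ∫ x, 𝒟 i f x * 𝒟 (k + 1) φ x = - ∫ x, 𝒟 (i + 1) f x * 𝒟 k φ x := fun i k =>
    integral_mul_deriv_eq_deriv_mul_of_integrable (fun x _ => smooth_hasDerivAt hf i x)
      (fun x _ => smooth_hasDerivAt hφ k x) (hint i (k + 1)) (hint (i + 1) k) (hint i k)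
  have h : ∀ i k, ∫ x, 𝒟 i f x * 𝒟 k φ x = (-1) ^ k * ∫ x, 𝒟 (i + k) f x * φ x := fun i k => by
    induction k generalizing i with
    | zero => simp
    | succ k ih => rw [key, ih, show i + 1 + k = i + (k + 1) by ring, pow_succ]; ring
  simpa using h 0 l

lemma IsWeakDeriv.ae_eq {f g g' : ℝ → ℝ} {l : ℕ} (hg : IsWeakDeriv l f g) (hg' : IsWeakDeriv l f g')
    (h : LocallyIntegrable g volume) (h' : LocallyIntegrable g' volume) : g =ᵐ[volume] g' := by
  refine ae_eq_of_integral_contDiff_smul_eq h h' fun φ hφ hc => ?_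
  have h1 := (hg φ hφ hc).symm.trans (hg' φ hφ hc)
  have h2 : ((-1 : ℝ) ^ l) ≠ 0 := by simp
  simpa only [smul_eq_mul, mul_comm] using mul_left_cancel₀ h2 h1

lemma hInf_of_memSobolev {f : ℝ → ℝ} (hf : Smooth f) (h : ∀ k, MemSobolev k f) : HInf f := by
  refine ⟨hf, fun k => ?_⟩
  obtain ⟨g, hg, hgw⟩ := (h k).2 k le_rfl
  exact (memLp_congr_ae (hgw.ae_eq (smooth_isWeakDeriv hf k) (hg.locallyIntegrable (by norm_num))
    (smooth_iter hf k).continuous.locallyIntegrable)).1 hg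

lemma HInf.memSobolev {f : ℝ → ℝ} (hf : HInf f) (k : ℕ) : MemSobolev k f :=
  ⟨hf.mem0, fun l _ => ⟨_, hf.mem l, smooth_isWeakDeriv hf.smooth l⟩⟩

lemma sobolevNorm_eq {f : ℝ → ℝ} (hf : HInf f) (k : ℕ) : sobolevNorm k f = Hn k f := by
  rw [sobolevNorm, Hn]
  congr 1
  refine Finset.sum_congr rfl fun l _ => ?_
  obtain ⟨h1, h2⟩ := weakDeriv_spec ⟨_, hf.mem l, smooth_isWeakDeriv hf.smooth l⟩
  have h3 := h2.ae_eq (smooth_isWeakDeriv hf.smooth l) (h1.locallyIntegrable (by norm_num))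
    ((hf.mem l).locallyIntegrable (by norm_num))
  rw [hs, ← l2_congr h3, l2]

lemma l2_weakDeriv_le {l k : ℕ} (h : l ≤ k) (f : ℝ → ℝ) : l2 (weakDeriv l f) ≤ sobolevNorm k f := by
  refine Real.le_sqrt_of_sq_le ?_
  exact Finset.single_le_sum (f := fun l => (eLpNorm (weakDeriv l f) 2 volume).toReal ^ 2)
    (fun i _ => sq_nonneg _) (Finset.mem_range.2 (by omega))

lemma sobolevNorm_nonneg (k : ℕ) (f : ℝ → ℝ) : 0 ≤ sobolevNorm k f := Real.sqrt_nonneg _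

/-- If `0 ∉ J`, then `|v|` is bounded below by a positive constant almost everywhere, which is
impossible in `L²(ℝ)`. -/
lemma zero_mem_of_memLp {v : ℝ → ℝ} (hv : MemLp v 2 volume) {J : Set ℝ} (hJ : IsClosed J)
    (h : ∀ᵐ x, v x ∈ J) : (0 : ℝ) ∈ J := by
  by_contra h0
  obtain ⟨d, hd, hball⟩ := Metric.isOpen_iff.1 hJ.isOpen_compl 0 h0
  have h1 : MemLp (fun _ : ℝ => d) 2 volume := by
    refine hv.mono aestronglyMeasurable_const ?_
    filter_upwards [h] with x hx
    by_contra h2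
    rw [Real.norm_of_nonneg hd.le] at h2
    exact hball (mem_ball_zero_iff.2 (not_le.1 h2)) hx
  rw [memLp_const_iff (by norm_num) (by norm_num)] at h1
  rcases h1 with h1 | h1
  · exact hd.ne' h1
  · simp at h1

/-! ### Solutions of the regularized equation -/

lemma IsC1.congr_right {T : ℝ} {u g g' : ℝ → ℝ → ℝ} (hu : IsC1 T u g)
    (h : ∀ t ∈ Icc 0 T, g t = g' t) : IsC1 T u g' where
  left := hu.left
  right t ht := h t ht ▸ hu.right t ht
  deriv k t ht := by rw [← h t ht]; exact hu.deriv k t ht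

lemma dispersiveTerm_congr {κ κ' u : ℝ → ℝ} (h : ∀ x, κ (u x) = κ' (u x)) :
    dispersiveTerm κ u = dispersiveTerm κ' u := by
  simp only [dispersiveTerm, h]

namespace IsRegularizedSolution

variable {I : Set ℝ} {κ p : ℝ → ℝ} {ε T : ℝ} {u₀ : ℝ → ℝ} {w : ℝ → ℝ → ℝ}
  (hw : IsRegularizedSolution I κ p ε T u₀ w)

include hw

lemma hInf {t : ℝ} (ht : t ∈ Icc 0 T) : HInf (w t) :=
  hInf_of_memSobolev (hw.smooth t ht) (hw.mem_sobolev t ht)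

lemma isC0 : IsC0 T w := fun k t ht => by
  refine squeeze_zero' (Eventually.of_forall fun _ => hs_nonneg _ _) ?_ (hw.continuous_sobolev k t ht)
  filter_upwards [self_mem_nhdsWithin] with τ hτ
  rw [sobolevNorm_eq ((hw.hInf hτ).sub (hw.hInf ht))]
  exact hs_le_Hn le_rfl _

/-- The definition of a solution asks for a pointwise time derivative only. As the right-hand side
is continuous in all `H^k`, `isC1_of_pointwise` supplies the differentiability that energy estimates
need. -/
lemma isC1 {κ' a' : ℝ → ℝ} (hκ : BInf κ') (hpos : ∀ y, 0 < κ' y) (ha : BInf a') {m M : ℝ}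
    (hκκ : ∀ y ∈ Icc m M, κ' y = κ y) (haa : ∀ y ∈ Icc m M, a' y = deriv p y)
    (hr : ∀ t ∈ Icc 0 T, ∀ x, w t x ∈ Icc m M) : IsC1 T w fun t => Fop κ' a' (ε ^ 4) (w t) := by
  have hD := DP_Fop hκ ha (c := ε ^ 4)
  refine isC1_of_pointwise (fun t ht => hw.hInf ht) (fun t ht => hD.hInf (hw.hInf ht))
    (hD.isC0 hw.isC0 fun t ht => hw.hInf ht) fun t ht x => ?_
  have h := hw.equation t ht x
  rw [dispersiveTerm_congr (κ' := κ') fun x => (hκκ _ (hr t ht x)).symm,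
    dispersiveTerm_eq hκ.smooth hpos (hw.smooth t ht), ← haa _ (hr t ht x)] at h
  refine h.congr_deriv ?_
  simp only [Fop, Nop, iteratedDeriv_one]
  ring

/-- The values of a solution stay in a compact part of the interval. -/
lemma exists_range (hI : IsOpen I) (hI' : I.OrdConnected) (h0 : (0 : ℝ) ∈ I) :
    ∃ m M, m ≤ M ∧ Icc m M ⊆ I ∧ ∀ t ∈ Icc 0 T, ∀ x, w t x ∈ Icc m M := by
  obtain ⟨L, hL, hLI, hwL⟩ : ∃ L, IsCompact L ∧ L ⊆ I ∧ ∀ t ∈ Icc 0 T, ∀ x, w t x ∈ L := by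
    -- By compactness of `[0, T]` it suffices to confine the values near each time. At fixed time
    -- the values together with their limit `0` at infinity are compact, and continuity in `H^1`
    -- moves them little.
    refine (isCompact_Icc (a := (0 : ℝ)) (b := T)).induction_on
      (p := fun S => ∃ L, IsCompact L ∧ L ⊆ I ∧ ∀ t ∈ S, ∀ x, w t x ∈ L)
      ⟨∅, isCompact_empty, empty_subset _, fun t ht => absurd ht (notMem_empty t)⟩ ?_ ?_ ?_
    · rintro S S' hSS ⟨L, h1, h2, h3⟩
      exact ⟨L, h1, h2, fun t ht => h3 t (hSS ht)⟩
    · rintro S S' ⟨L, h1, h2, h3⟩ ⟨L', h1', h2', h3'⟩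
      refine ⟨L ∪ L', h1.union h1', union_subset h2 h2', fun t ht x => ?_⟩
      rcases ht with ht | ht
      · exact Or.inl (h3 t ht x)
      · exact Or.inr (h3' t ht x)
    · intro t ht
      have hc : IsCompact (insert 0 (range (w t))) := by
        refine Tendsto.isCompact_insert_range_of_cocompact ?_ (hw.hInf ht).continuous
        rw [cocompact_eq_atBot_atTop]
        exact (hw.hInf ht).tendsto_zero.1.sup (hw.hInf ht).tendsto_zero.2
      have hsub : insert 0 (range (w t)) ⊆ I := by
        rintro y (rfl | ⟨x, rfl⟩)
        · exact h0
        · exact hw.range_subset t ht x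
      obtain ⟨r, hr, hrI⟩ := hc.exists_cthickening_subset_open hI hsub
      have h1 := (hw.isC0 0 t ht).add (hw.isC0 1 t ht)
      rw [add_zero] at h1
      refine ⟨_, inter_mem (h1.eventually_lt_const hr) self_mem_nhdsWithin,
        Metric.cthickening r (insert 0 (range (w t))), hc.cthickening, hrI, fun τ hτ x => ?_⟩
      refine Metric.mem_cthickening_of_dist_le _ (w t x) r _ (Or.inr ⟨x, rfl⟩) ?_
      rw [Real.dist_eq]
      exact (abs_le_hs ((hw.hInf hτ.2).sub (hw.hInf ht)) x).trans hτ.1.le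
  have hLb := hL.insert 0
  have hbd := hLb.isBounded
  refine ⟨sInf (insert 0 L), sSup (insert 0 L), ?_, ?_, fun t ht x => ?_⟩
  · exact (csInf_le hbd.bddBelow (mem_insert _ _)).trans (le_csSup hbd.bddAbove (mem_insert _ _))
  · have hsub := insert_subset h0 hLI
    exact hI'.out (hsub (hLb.sInf_mem (insert_nonempty _ _)))
      (hsub (hLb.sSup_mem (insert_nonempty _ _)))
  · have h1 := mem_insert_of_mem 0 (hwL t ht x)
    exact ⟨csInf_le hbd.bddBelow h1, le_csSup hbd.bddAbove h1⟩

end IsRegularizedSolution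

lemma isRegularizedSolution_of_isC1 {I : Set ℝ} {κ p : ℝ → ℝ} {ε T : ℝ} {u₀ : ℝ → ℝ}
    {v : ℝ → ℝ → ℝ} {κ' a' : ℝ → ℝ} (hκ : BInf κ') (hpos : ∀ y, 0 < κ' y) {m M : ℝ} (hmM : Icc m M ⊆ I)
    (hκκ : ∀ y ∈ Icc m M, κ' y = κ y) (haa : ∀ y ∈ Icc m M, a' y = deriv p y)
    (hv : IsC1 T v fun t => Fop κ' a' (ε ^ 4) (v t)) (h0 : v 0 = u₀)
    (hr : ∀ t ∈ Icc 0 T, ∀ x, v t x ∈ Icc m M) : IsRegularizedSolution I κ p ε T u₀ v where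
  smooth t ht := (hv.left t ht).smooth
  mem_sobolev t ht k := (hv.left t ht).memSobolev k
  continuous_sobolev k t ht := by
    have h2 : Tendsto (fun τ => √(∑ l ∈ Finset.range (k + 1), hs l (fun x => v τ x - v t x) ^ 2))
        (𝓝[Icc 0 T] t) (𝓝 √(∑ l ∈ Finset.range (k + 1), (0 : ℝ) ^ 2)) :=
      (tendsto_finsetSum _ fun l _ => (hv.isC0 l t ht).pow 2).sqrt
    have h3 : √(∑ l ∈ Finset.range (k + 1), (0 : ℝ) ^ 2) = 0 := by simp
    rw [h3] at h2
    refine h2.congr' ?_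
    filter_upwards [self_mem_nhdsWithin] with τ hτ
    rw [sobolevNorm_eq ((hv.left τ hτ).sub (hv.left t ht)), Hn]
  range_subset t ht x := hmM (hr t ht x)
  equation t ht x := by
    rw [dispersiveTerm_congr (κ' := κ') fun x => (hκκ _ (hr t ht x)).symm,
      dispersiveTerm_eq hκ.smooth hpos (hv.left t ht).smooth, ← haa _ (hr t ht x)]
    refine (hv.hasDeriv_apply ht x).congr_deriv ?_
    simp only [Fop, Nop, iteratedDeriv_one]
    ring
  initial x := by rw [h0]

/-! ### Uniqueness, uniform existence time and uniform estimates. -/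

section Main

variable {I J : Set ℝ} (hI_open : IsOpen I) (hI_conn : I.OrdConnected)
  {κ p : ℝ → ℝ} (hκ : ContDiffOn ℝ (⊤ : ℕ∞) κ I) (hκ_pos : ∀ u ∈ I, 0 < κ u)
  (hp : ContDiffOn ℝ (⊤ : ℕ∞) p I)

include hI_open hκ hκ_pos hp

lemma exists_coefficients {m M : ℝ} (hmM : m ≤ M) (h : Icc m M ⊆ I) :
    ∃ κ' a', EvConst κ' 1 ∧ (∀ y, 0 < κ' y) ∧ BInf a' ∧ (∀ y ∈ Icc m M, κ' y = κ y) ∧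
      ∀ y ∈ Icc m M, a' y = deriv p y := by
  have hp' : ContDiffOn ℝ ((⊤ : ℕ∞) : WithTop ℕ∞) (deriv p) I :=
    hp.deriv_of_isOpen hI_open (by simp)
  obtain ⟨κ', h1, h2, h3⟩ := exists_extension hI_open hmM h hκ 1
  obtain ⟨a', h4, h5, -⟩ := exists_extension hI_open hmM h hp' 0
  exact ⟨κ', a', h1, h3 hκ_pos one_pos, h4.bInf, h2, h5⟩

-- Both solutions take values in one compact interval, where `κ` and `p'` can be replaced by
-- globally defined coefficients; `eq_of_isC1_Fop` then applies.
include hI_conn in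
lemma IsRegularizedSolution.unique (h0 : (0 : ℝ) ∈ I) {ε T : ℝ} (hε : 0 < ε) {u₀ : ℝ → ℝ}
    {v w : ℝ → ℝ → ℝ} (hv : IsRegularizedSolution I κ p ε T u₀ v)
    (hw : IsRegularizedSolution I κ p ε T u₀ w) {t : ℝ} (ht : t ∈ Icc 0 T) : v t = w t := by
  obtain ⟨m₁, M₁, h1, h2, h3⟩ := hv.exists_range hI_open hI_conn h0
  obtain ⟨m₂, M₂, h4, h5, h6⟩ := hw.exists_range hI_open hI_conn h0
  have hsub : Icc (min m₁ m₂) (max M₁ M₂) ⊆ I := by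
    refine hI_conn.out ?_ ?_
    · rcases min_choice m₁ m₂ with h | h <;> rw [h]
      · exact h2 ⟨le_rfl, h1⟩
      · exact h5 ⟨le_rfl, h4⟩
    · rcases max_choice M₁ M₂ with h | h <;> rw [h]
      · exact h2 ⟨h1, le_rfl⟩
      · exact h5 ⟨h4, le_rfl⟩
  obtain ⟨κ', a', hκ', hpos, ha', hκκ, haa⟩ := exists_coefficients hI_open hκ hκ_pos hp
    ((min_le_left _ _).trans (h1.trans (le_max_left _ _))) hsub
  refine eq_of_isC1_Fop hκ'.bInf ha' (pow_pos hε 4)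
    (hv.isC1 hκ'.bInf hpos ha' hκκ haa fun t ht x => ?_)
    (hw.isC1 hκ'.bInf hpos ha' hκκ haa fun t ht x => ?_) ?_ ht
  · exact Icc_subset_Icc (min_le_left _ _) (le_max_left _ _) (h3 t ht x)
  · exact Icc_subset_Icc (min_le_right _ _) (le_max_right _ _) (h6 t ht x)
  · ext x; rw [hv.initial, hw.initial]

include hI_conn in
/-- Existence on a uniform time interval together with the estimates. -/
lemma exists_isRegularizedSolution (hJ : IsCompact J) (hJI : J ⊆ I) (hJ0 : J.Nonempty)
    {χ η : ℝ → ℝ} (hχ : IsMollifierKernel χ) (hη : IsMollifierScale η) (R : ℝ) :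
    ∃ T > 0, ∃ ε₀ > 0, ∀ q s : ℕ, 4 ≤ q → q ≤ s → ∃ C : ℝ, ∀ v₀ : ℝ → ℝ, MemSobolev q v₀ →
      (∀ᵐ x, v₀ x ∈ J) → sobolevNorm 4 v₀ ≤ R → ∀ ε ∈ Ioc 0 ε₀, ∃ v : ℝ → ℝ → ℝ,
        IsRegularizedSolution I κ p ε T (mollify χ (η ε) v₀) v ∧ ∀ t ∈ Icc 0 T,
          sobolevNorm s (v t) ≤ C * (sobolevNorm q v₀ / η ε ^ (s - q)) := by
  set m₀ := sInf J
  set M₀ := sSup J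
  have hJsub : J ⊆ Icc m₀ M₀ := fun y hy =>
    ⟨csInf_le hJ.isBounded.bddBelow hy, le_csSup hJ.isBounded.bddAbove hy⟩
  have hmM₀ : m₀ ≤ M₀ := csInf_le_csSup hJ0 hJ.isBounded.bddBelow hJ.isBounded.bddAbove
  have hsub₀ : Icc m₀ M₀ ⊆ I := hI_conn.out (hJI (hJ.sInf_mem hJ0)) (hJI (hJ.sSup_mem hJ0))
  obtain ⟨ρ, hρ, hρI⟩ := isCompact_Icc.exists_cthickening_subset_open hI_open hsub₀
  set r := ρ / 2 with hr
  have hr0 : 0 < r := half_pos hρ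
  have hsub : Icc (m₀ - 2 * r) (M₀ + 2 * r) ⊆ I := by
    refine hI_conn.out (hρI ?_) (hρI ?_)
    · refine Metric.mem_cthickening_of_dist_le _ m₀ ρ _ ⟨le_rfl, hmM₀⟩ ?_
      rw [Real.dist_eq, abs_le]; constructor <;> linarith
    · refine Metric.mem_cthickening_of_dist_le _ M₀ ρ _ ⟨hmM₀, le_rfl⟩ ?_
      rw [Real.dist_eq, abs_le]; constructor <;> linarith
  obtain ⟨κ', a', hκ', hpos, ha', hκκ, haa⟩ := exists_coefficients hI_open hκ hκ_pos hp
    (show m₀ - 2 * r ≤ M₀ + 2 * r by linarith) hsub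
  set A : ℕ → ℝ := fun i => ∫ x, |𝒟 i χ x|
  have hA : ∀ i, 0 ≤ A i := fun i => integral_nonneg fun _ => abs_nonneg _
  have hweight : ∀ s : ℕ, 4 ≤ s → ∃ K, 0 ≤ K ∧ ∀ M > 0, ∃ C, 0 ≤ C ∧ ∀ c ∈ Icc (0 : ℝ) 1,
      ∀ T v, IsC1 T v (fun t => cutF κ' a' c M (v t)) → ∀ t ∈ Icc 0 T,
        eng s (v t) ≤ K * eng s (v 0) * Real.exp (C * t) := fun s hs => by
    obtain ⟨φ, h1, ⟨φ₀, h2, h3⟩, h4⟩ := hκ'.exists_weight hpos s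
    exact eng_le_of_isC1_cutF hκ'.bInf ha' h1 hs h2 h3 h4
  obtain ⟨K₄, hK₄, hgrow⟩ := hweight 4 le_rfl
  -- `K₄` is known before any truncation level is fixed, so there is no circularity. The `5` comes
  -- from `Hn_sq_le` at level `4`, `2 (A 0 |R|)²` bounds the energy of the data, and `exp 1` is the
  -- growth allowed on `[0, T]`.
  set Q := 5 * (K₄ * (2 * (A 0 * |R|) ^ 2) * Real.exp 1) with hQ
  have hQ0 : 0 ≤ Q := by positivity
  set M := √Q + 1 with hM
  have hM0 : 0 < M := by positivity
  have hQM : Q ≤ M ^ 2 := by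
    have := Real.sq_sqrt hQ0
    have := Real.sqrt_nonneg Q
    nlinarith
  obtain ⟨C₄, hC₄, hgrow⟩ := hgrow M hM0
  obtain ⟨L, hL, hdisp⟩ := abs_sub_sq_le_of_isC1_cutF hκ'.bInf ha' hM0
  -- The first bound keeps the norm of `H^4` below `M`, the second keeps the displacement of the
  -- values below `r`. Neither involves `q`, `s` or `ε`.
  set T := min (1 / (C₄ + 1)) (r ^ 2 / (L + 1)) with hT
  have hT0 : 0 < T := lt_min (by positivity) (by positivity)
  have hT1 : C₄ * T ≤ 1 := by
    have h1 : T * (C₄ + 1) ≤ 1 := (le_div_iff₀ (by positivity)).1 (min_le_left _ _)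
    linarith
  have hT2 : L * T ≤ r ^ 2 := by
    have h1 : T * (L + 1) ≤ r ^ 2 := (le_div_iff₀ (by positivity)).1 (min_le_right _ _)
    linarith
  -- Since `χ` may change sign, mollification can leave the convex hull of `J`; for small `δ` it
  -- leaves by at most `r`. The slope `2 |R|` comes from the bound in `H^2`.
  obtain ⟨δ₀, hδ₀, hclose⟩ := hχ.exists_close (max |m₀| |M₀|) (2 * |R|) (by positivity)
    (by positivity) hr0
  have hev : ∀ᶠ ε in 𝓝[>] 0, η ε < min δ₀ 1 :=
    hη.tendsto.eventually_lt_const (lt_min hδ₀ one_pos)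
  obtain ⟨ε₁, hε₁, hη₁⟩ := mem_nhdsGT_iff_exists_Ioo_subset.1 hev
  -- Half of `ε₁` because the interval obtained is open; the bound `1` gives `ε⁴ ≤ 1`.
  refine ⟨T, hT0, min (ε₁ / 2) 1, lt_min (half_pos hε₁) one_pos, fun q s hq hqs => ?_⟩
  obtain ⟨Kₛ, hKₛ, hgrowₛ⟩ := hweight s (hq.trans hqs)
  obtain ⟨Cₛ, hCₛ, hgrowₛ⟩ := hgrowₛ M hM0
  set B := ((s : ℝ) + 1) * (Kₛ * (A 0 ^ 2 + A (s - q) ^ 2) * Real.exp (Cₛ * T)) with hB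
  have hB0 : 0 ≤ B := by positivity
  refine ⟨√B, fun v₀ hv₀ hv₀J hv₀R ε hε => ?_⟩
  have hε1 : ε ≤ 1 := hε.2.trans (min_le_right _ _)
  have hηε : η ε < min δ₀ 1 := hη₁ ⟨hε.1, by
    have := hε.2.trans (min_le_left _ _); linarith [show (0 : ℝ) < ε₁ from hε₁]⟩
  set δ := η ε
  have hδ : 0 < δ := hη.pos ε hε.1
  have hδ1 : δ ≤ 1 := hηε.le.trans (min_le_right _ _)
  have hv₀J' : ∀ᵐ x, v₀ x ∈ Icc m₀ M₀ := hv₀J.mono fun x hx => hJsub hx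
  obtain ⟨hu, hbern, hrange⟩ := hInf_conv_of_memSobolev (hχ.hInf_rescale hδ)
    (hχ.integrable_iter_rescale hδ) (show 1 ≤ q by omega) hv₀ hv₀J'
  rw [← mollify_eq_conv] at hu hbern hrange
  simp only [hχ.integral_abs_iter_rescale hδ] at hbern
  set u₀ := mollify χ δ v₀
  have hw4 : ∀ l ≤ 4, l2 (weakDeriv l v₀) ≤ |R| := fun l hl =>
    (l2_weakDeriv_le hl v₀).trans (hv₀R.trans (le_abs_self R))
  have hu₀J : ∀ x, u₀ x ∈ Icc (m₀ - r) (M₀ + r) := by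
    refine hrange _ isClosed_Icc fun f hf hfJ hfb x => ?_
    have h1 := hclose δ hδ (hηε.le.trans (min_le_left _ _)) f hf
      (fun x => abs_le_max_abs_abs (hfJ x).1 (hfJ x).2) (fun x => by
        have h2 := abs_iter_le_hs hf 1 x
        have h3 := (hfb 1 (by omega)).trans (hw4 1 (by norm_num))
        have h4 := (hfb 2 (by omega)).trans (hw4 2 (by norm_num))
        linarith) x
    rw [abs_le] at h1
    have h2 := hfJ x
    exact ⟨by linarith [h2.1], by linarith [h2.2]⟩
  have hu4 : eng 4 u₀ ≤ 2 * (A 0 * |R|) ^ 2 := by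
    have h1 : ∀ l ≤ 4, hs l u₀ ≤ A 0 * |R| := fun l hl => by
      have h2 := hbern l (hl.trans hq) 0
      rw [add_zero, pow_zero, one_mul] at h2
      exact h2.trans (mul_le_mul_of_nonneg_left (hw4 l hl) (hA 0))
    have h3 := pow_le_pow_left₀ (hs_nonneg _ _) (h1 0 (by norm_num)) 2
    have h4 := pow_le_pow_left₀ (hs_nonneg _ _) (h1 4 le_rfl) 2
    rw [eng]; linarith
  set N := sobolevNorm q v₀ / δ ^ (s - q) with hN
  have hN0 : 0 ≤ N := div_nonneg (sobolevNorm_nonneg _ _) (by positivity)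
  have hus : eng s u₀ ≤ (A 0 ^ 2 + A (s - q) ^ 2) * N ^ 2 := by
    have h1 : hs 0 u₀ ≤ A 0 * N := by
      have h2 := hbern 0 (Nat.zero_le q) 0
      rw [add_zero, pow_zero, one_mul] at h2
      refine h2.trans (mul_le_mul_of_nonneg_left ?_ (hA 0))
      refine (l2_weakDeriv_le (Nat.zero_le q) v₀).trans ?_
      -- Here `δ ≤ 1` matters: dividing by `δ^(s-q)` can only increase the norm.
      exact le_div_self (sobolevNorm_nonneg _ _) (by positivity) (pow_le_one₀ hδ.le hδ1)
    have h3 : hs s u₀ ≤ A (s - q) * N := by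
      have h2 := hbern q le_rfl (s - q)
      rw [Nat.add_sub_cancel' hqs] at h2
      refine h2.trans ?_
      have h4 := mul_le_mul_of_nonneg_left (l2_weakDeriv_le le_rfl v₀ (k := q))
        (mul_nonneg (pow_nonneg (inv_nonneg.2 hδ.le) (s - q)) (hA (s - q)))
      refine h4.trans (le_of_eq ?_)
      rw [hN, inv_pow]; ring
    have h5 := pow_le_pow_left₀ (hs_nonneg _ _) h1 2
    have h6 := pow_le_pow_left₀ (hs_nonneg _ _) h3 2
    rw [mul_pow] at h5 h6
    rw [eng]; linarith
  have hc0 : 0 < ε ^ 4 := pow_pos hε.1 4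
  have hc1 : ε ^ 4 ∈ Icc (0 : ℝ) 1 := ⟨hc0.le, pow_le_one₀ hε.1.le hε1⟩
  obtain ⟨v, hv0, hv⟩ := exists_isC1_cutF hκ'.bInf ha' hc0 hM0 hu hT0.le
  have hvM : ∀ t ∈ Icc 0 T, Hn 4 (v t) ≤ M := fun t ht => by
    have h1 := hgrow _ hc1 T v hv t ht
    have h2 := Hn_sq_le (hv.left t ht) 4
    have h3 : Real.exp (C₄ * t) ≤ Real.exp 1 :=
      Real.exp_le_exp.2 ((mul_le_mul_of_nonneg_left ht.2 hC₄).trans hT1)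
    refine le_of_sq_le_sq (le_trans ?_ hQM) hM0.le
    rw [hv0] at h1
    have h4 : K₄ * eng 4 u₀ * Real.exp (C₄ * t) ≤ K₄ * (2 * (A 0 * |R|) ^ 2) * Real.exp 1 :=
      mul_le_mul (mul_le_mul_of_nonneg_left hu4 hK₄) h3 (Real.exp_pos _).le (by positivity)
    have h5 : Hn 4 (v t) ^ 2 ≤ 5 * eng 4 (v t) := by
      rw [eng]; norm_num at h2; exact h2
    linarith
  -- Below the level `M` the cutoff equals one, so the truncated solution solves the original
  -- equation.
  have hvF : IsC1 T v fun t => Fop κ' a' (ε ^ 4) (v t) := hv.congr_right fun t ht => by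
    ext x
    rw [cutF, cut_eq_one hM0 (pow_le_pow_left₀ (Hn_nonneg _ _) (hvM t ht) 2), one_mul]
  have hvr : ∀ t ∈ Icc 0 T, ∀ x, v t x ∈ Icc (m₀ - 2 * r) (M₀ + 2 * r) := fun t ht x => by
    have h1 := hdisp _ hc1 T v hv hvM t ht x
    have h2 : |v t x - v 0 x| ≤ r := by
      refine abs_le_of_sq_le_sq (h1.trans ?_) hr0.le
      exact (mul_le_mul_of_nonneg_left ht.2 hL).trans hT2
    rw [hv0, abs_le] at h2
    have h3 := hu₀J x
    exact ⟨by linarith [h3.1], by linarith [h3.2]⟩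
  refine ⟨v, isRegularizedSolution_of_isC1 hκ'.bInf hpos hsub hκκ haa hvF hv0 hvr, fun t ht => ?_⟩
  rw [sobolevNorm_eq (hv.left t ht)]
  have h1 := hgrowₛ _ hc1 T v hv t ht
  rw [hv0] at h1
  have h2 := Hn_sq_le (hv.left t ht) s
  have h3 : Real.exp (Cₛ * t) ≤ Real.exp (Cₛ * T) :=
    Real.exp_le_exp.2 (mul_le_mul_of_nonneg_left ht.2 hCₛ)
  refine le_of_sq_le_sq ?_ (mul_nonneg (Real.sqrt_nonneg _) hN0)
  rw [mul_pow, Real.sq_sqrt hB0]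
  calc Hn s (v t) ^ 2 ≤ ((s : ℝ) + 1) * eng s (v t) := h2
    _ ≤ ((s : ℝ) + 1) * (Kₛ * ((A 0 ^ 2 + A (s - q) ^ 2) * N ^ 2) * Real.exp (Cₛ * T)) := by
        refine mul_le_mul_of_nonneg_left (h1.trans ?_) (by positivity)
        exact mul_le_mul (mul_le_mul_of_nonneg_left hus hKₛ) h3 (Real.exp_pos _).le (by positivity)
    _ = B * N ^ 2 := by rw [hB]; ring

end Main

end QKdV

end

theorem mainTheorem5
    (I J : Set ℝ) (hI_open : IsOpen I) (hI_conn : I.OrdConnected)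
    (hJ : IsCompact J) (hJI : J ⊆ I)
    (κ p : ℝ → ℝ) (hκ : ContDiffOn ℝ (⊤ : ℕ∞) κ I) (hκ_pos : ∀ u ∈ I, 0 < κ u)
    (hp : ContDiffOn ℝ (⊤ : ℕ∞) p I)
    (χ η : ℝ → ℝ) (hχ : QKdV.IsMollifierKernel χ) (hη : QKdV.IsMollifierScale η) (R : ℝ) :
    ∃ T > 0, ∃ ε₀ > 0,
      -- existence and uniqueness of the solution on the common interval `[0, T]`
      (∀ v₀ : ℝ → ℝ, QKdV.MemSobolev 4 v₀ → (∀ᵐ x, v₀ x ∈ J) → QKdV.sobolevNorm 4 v₀ ≤ R →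
        ∀ ε ∈ Set.Ioc 0 ε₀, ∃ v : ℝ → ℝ → ℝ,
          QKdV.IsRegularizedSolution I κ p ε T (QKdV.mollify χ (η ε) v₀) v ∧
          ∀ w : ℝ → ℝ → ℝ, QKdV.IsRegularizedSolution I κ p ε T (QKdV.mollify χ (η ε) v₀) w →
            ∀ t ∈ Set.Icc 0 T, ∀ x, w t x = v t x) ∧
      -- the estimate in `H^s` in terms of the norm of the data in `H^q`
      (∀ q s : ℕ, 4 ≤ q → q ≤ s → ∃ C : ℝ, ∀ v₀ : ℝ → ℝ, QKdV.MemSobolev q v₀ →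
        (∀ᵐ x, v₀ x ∈ J) → QKdV.sobolevNorm 4 v₀ ≤ R →
        ∀ ε ∈ Set.Ioc 0 ε₀, ∀ v : ℝ → ℝ → ℝ,
          QKdV.IsRegularizedSolution I κ p ε T (QKdV.mollify χ (η ε) v₀) v →
            ∀ t ∈ Set.Icc 0 T,
              QKdV.sobolevNorm s (v t) ≤ C * (QKdV.sobolevNorm q v₀ / η ε ^ (s - q))) ∧
      -- in particular, bounds in `H^s` that are uniform in `ε`
      (∀ s : ℕ, 4 ≤ s → ∃ C : ℝ, ∀ v₀ : ℝ → ℝ, QKdV.MemSobolev s v₀ →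
        (∀ᵐ x, v₀ x ∈ J) → QKdV.sobolevNorm 4 v₀ ≤ R →
        ∀ ε ∈ Set.Ioc 0 ε₀, ∀ v : ℝ → ℝ → ℝ,
          QKdV.IsRegularizedSolution I κ p ε T (QKdV.mollify χ (η ε) v₀) v →
            ∀ t ∈ Set.Icc 0 T, QKdV.sobolevNorm s (v t) ≤ C * QKdV.sobolevNorm s v₀) := by
  -- If `0 ∉ J` there are no admissible data at all. If `0 ∈ J`, then `0 ∈ I`, as the confinement of
  -- solutions that vanish at infinity requires.
  by_cases h0 : (0 : ℝ) ∈ J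
  · obtain ⟨T, hT, ε₀, hε₀, h⟩ := QKdV.exists_isRegularizedSolution hI_open hI_conn hκ hκ_pos hp hJ
      hJI ⟨0, h0⟩ hχ hη R
    have huniq : ∀ ε ∈ Set.Ioc 0 ε₀, ∀ u₀ v w, QKdV.IsRegularizedSolution I κ p ε T u₀ v →
        QKdV.IsRegularizedSolution I κ p ε T u₀ w → ∀ t ∈ Set.Icc 0 T, v t = w t :=
      fun ε hε u₀ v w hv hw t ht =>
        hv.unique hI_open hI_conn hκ hκ_pos hp (hJI h0) hε.1 hw ht
    have hest : ∀ q s : ℕ, 4 ≤ q → q ≤ s → ∃ C : ℝ, ∀ v₀ : ℝ → ℝ, QKdV.MemSobolev q v₀ →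
        (∀ᵐ x, v₀ x ∈ J) → QKdV.sobolevNorm 4 v₀ ≤ R →
        ∀ ε ∈ Set.Ioc 0 ε₀, ∀ v : ℝ → ℝ → ℝ,
          QKdV.IsRegularizedSolution I κ p ε T (QKdV.mollify χ (η ε) v₀) v →
            ∀ t ∈ Set.Icc 0 T,
              QKdV.sobolevNorm s (v t) ≤ C * (QKdV.sobolevNorm q v₀ / η ε ^ (s - q)) := by
      intro q s hq hqs
      obtain ⟨C, hC⟩ := h q s hq hqs
      refine ⟨C, fun v₀ h1 h2 h3 ε hε v hv t ht => ?_⟩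
      obtain ⟨w, hw, hw'⟩ := hC v₀ h1 h2 h3 ε hε
      rw [huniq ε hε _ v w hv hw t ht]
      exact hw' t ht
    refine ⟨T, hT, ε₀, hε₀, fun v₀ h1 h2 h3 ε hε => ?_, hest, fun s hs => ?_⟩
    · obtain ⟨C, hC⟩ := h 4 4 le_rfl le_rfl
      obtain ⟨v, hv, -⟩ := hC v₀ h1 h2 h3 ε hε
      exact ⟨v, hv, fun w hw t ht x => congrFun (huniq ε hε _ w v hw hv t ht) x⟩
    · obtain ⟨C, hC⟩ := hest s s hs le_rfl
      refine ⟨C, fun v₀ h1 h2 h3 ε hε v hv t ht => ?_⟩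
      simpa only [Nat.sub_self, pow_zero, div_one] using hC v₀ h1 h2 h3 ε hε v hv t ht
  · have hno : ∀ (k : ℕ) (v₀ : ℝ → ℝ), QKdV.MemSobolev k v₀ → ¬ ∀ᵐ x, v₀ x ∈ J :=
      fun k v₀ h1 h2 => h0 (QKdV.zero_mem_of_memLp h1.1 hJ.isClosed h2)
    exact ⟨1, one_pos, 1, one_pos, fun v₀ h1 h2 => (hno _ _ h1 h2).elim,
      fun q s _ _ => ⟨0, fun v₀ h1 h2 => (hno _ _ h1 h2).elim⟩,
      fun s _ => ⟨0, fun v₀ h1 h2 => (hno _ _ h1 h2).elim⟩⟩
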